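/- Conventions. All 2-categories are small and strict. We write $\cdot$ for the composition of 1-cells and the horizontal composition of 2-cells, and $\circ$ for the vertical composition of 2-cells; $u\cdot v$ means "first $v$, then $u$". A 1-cell also denotes its identity 2-cell. A 2-category is *presented* by 0-cells, generating 1-cells with relations, and generating 2-cells with relations if its 1-cells are the composable sequences of generating 1-cells modulo the congruence generated by the relations, and its 2-cells are the formal vertical and horizontal composites of generating 2-cells and identities, modulo the congruence generated by the axioms of strict 2-categories and the relations. The lax Gray tensor product $\mathcal B\otimes_l\mathcal C$ of two 2-categories is presented as follows. Its 0-cells are the pairs $(b,c)$. Its generating 1-cells are $(f,\mathrm{Id}):(b,c)\to(b',c)$ for $f:b\to b'$ in $\mathcal B$ and $(\mathrm{Id},g):(b,c)\to(b,c')$ for $g:c\to c'$ in $\mathcal C$, subject to $(f_1,\mathrm{Id})\cdot(f_2,\mathrm{Id})=(f_1\cdot f_2,\mathrm{Id})$, $(\mathrm{Id},g_1)\cdot(\mathrm{Id},g_2)=(\mathrm{Id},g_1\cdot g_2)$, and $(\mathrm{Id}_b,\mathrm{Id})$ and $(\mathrm{Id},\mathrm{Id}_c)$ being identities. Its generating 2-cells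 are $(\phi,\mathrm{Id}):(f_1,\mathrm{Id})\to(f_2,\mathrm{Id})$, $(\mathrm{Id},\psi):(\mathrm{Id},g_1)\to(\mathrm{Id},g_2)$ and $\gamma_{f,g}:(f,\mathrm{Id})\cdot(\mathrm{Id},g)\to(\mathrm{Id},g)\cdot(f,\mathrm{Id})$. The relations on 2-cells say that $\phi\mapsto(\phi,\mathrm{Id})$ and $\psi\mapsto(\mathrm{Id},\psi)$ preserve identities, vertical and horizontal composition, and that $$\gamma_{f,\mathrm{Id}}=(f,\mathrm{Id}),\qquad \gamma_{\mathrm{Id},g}=(\mathrm{Id},g),$$ $$\gamma_{f_1\cdot f_2,g}=(\gamma_{f_1,g}\cdot(f_2,\mathrm{Id}))\circ((f_1,\mathrm{Id})\cdot\gamma_{f_2,g}),\qquad \gamma_{f,g_1\cdot g_2}=((\mathrm{Id},g_1)\cdot\gamma_{f,g_2})\circ(\gamma_{f,g_1}\cdot(\mathrm{Id},g_2)),$$ $$\gamma_{f_2,g_2}\circ((\phi,\mathrm{Id})\cdot(\mathrm{Id},\psi))=((\mathrm{Id},\psi)\cdot(\phi,\mathrm{Id}))\circ\gamma_{f_1,g_1}$$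 for $\phi:f_1\to f_2$ and $\psi:g_1\to g_2$. For $n\ge1$ and 2-categories $\mathcal C_1,\dots,\mathcal C_n$, define the left-iterated tensor product by $\bigotimes_{i=1}^1\mathcal C_i:=\mathcal C_1$ and $\bigotimes_{i=1}^{k+1}\mathcal C_i:=(\bigotimes_{i=1}^k\mathcal C_i)\otimes_l\mathcal C_{k+1}$. **Theorem (Iterated lax Gray tensor products).** The 2-category $\bigotimes_{i=1}^n\mathcal C_i$ is presented as follows; that is, there are strict 2-functors in both directions between it and the 2-category with this presentation, whose composites are equal to the identity 2-functors. 1. The 0-cells are the $n$-tuples $(a_1,\dots,a_n)$ of 0-cells $a_i$ of $\mathcal C_i$. 2. The 1-cells are generated by $\{f\}_i:(a_1,\dots,a_i,\dots,a_n)\to(a_1,\dots,a_i',\dots,a_n)$ for $f:a_i\to a_i'$ in $\mathcal C_i$, subject to $\{f\}_i\cdot\{g\}_i=\{f\cdot g\}_i$ and $\{\mathrm{Id}\}_i=\mathrm{Id}$. 3. The 2-cells are generated by $\{\phi\}_i:\{f\}_i\to\{g\}_i$ for $\phi:f\to g$ in $\mathcal C_i$, and by $\gamma^{i,j}_{f,g}:\{f\}_i\cdot\{g\}_j\to\{g\}_j\cdot\{f\}_i$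 for $i<j$, $f$ in $\mathcal C_i$ and $g$ in $\mathcal C_j$, subject to the following relations, whenever they are well-typed: - (a) for each $i$: $\{\phi\}_i\circ\{\psi\}_i=\{\phi\circ\psi\}_i$, $\{\phi\}_i\cdot\{\psi\}_i=\{\phi\cdot\psi\}_i$, and $\{\mathrm{Id}_f\}_i=\mathrm{Id}_{\{f\}_i}$; - (b) for each $i<j$: $\gamma^{i,j}_{f,\mathrm{Id}}=\{f\}_i$ and $\gamma^{i,j}_{\mathrm{Id},g}=\{g\}_j$; - (c) for each $i<j$: $\gamma^{i,j}_{f_1\cdot f_2,g}=(\gamma^{i,j}_{f_1,g}\cdot\{f_2\}_i)\circ(\{f_1\}_i\cdot\gamma^{i,j}_{f_2,g})$ and $\gamma^{i,j}_{f,g_1\cdot g_2}=(\{g_1\}_j\cdot\gamma^{i,j}_{f,g_2})\circ(\gamma^{i,j}_{f,g_1}\cdot\{g_2\}_j)$; - (d) for each $i<j$, $\phi:f_1\to f_2$ and $\psi:g_1\to g_2$: $(\{\psi\}_j\cdot\{\phi\}_i)\circ\gamma^{i,j}_{f_1,g_1}=\gamma^{i,j}_{f_2,g_2}\circ(\{\phi\}_i\cdot\{\psi\}_j)$;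 - (e) the Yang–Baxter equation, for each $i<j<k$: $$(\{h\}_k\cdot\gamma^{i,j}_{f,g})\circ(\gamma^{i,k}_{f,h}\cdot\{g\}_j)\circ(\{f\}_i\cdot\gamma^{j,k}_{g,h})=(\gamma^{j,k}_{g,h}\cdot\{f\}_i)\circ(\{g\}_j\cdot\gamma^{i,k}_{f,h})\circ(\gamma^{i,j}_{f,g}\cdot\{h\}_k).$$ Under this isomorphism the tuple $(a_1,\dots,a_n)$ corresponds to $((\cdots(a_1,a_2),\cdots),a_n)$, and the generators correspond to the cells defined recursively as follows. For $n=1$, $\{f\}_1:=f$ and $\{\phi\}_1:=\phi$. For $n+1$ factors and $i<j\le n$, $\{f\}_i:=(\{f\}_i,\mathrm{Id})$, $\{\phi\}_i:=(\{\phi\}_i,\mathrm{Id})$, $\gamma^{i,j}_{f,g}:=(\gamma^{i,j}_{f,g},\mathrm{Id})$; for the last factor, $\{f\}_{n+1}:=(\mathrm{Id},f)$, $\{\phi\}_{n+1}:=(\mathrm{Id},\phi)$; and $\gamma^{i,n+1}_{f,g}:=\gamma_{\{f\}_i,g}$ for $i\le n$. -/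

import Mathlib

open CategoryTheory Bicategory

universe u

/-- A strict 2-category. -/
structure TwoCat : Type (u + 1) where
  carrier : Type u
  [bicategory : Bicategory.{u, u} carrier]
  [strict : Bicategory.Strict carrier]

instance : CoeSort TwoCat.{u} (Type u) := ⟨TwoCat.carrier⟩

attribute [instance] TwoCat.bicategory TwoCat.strict

/-! ### Strict 2-categories presented by a category of 1-cells, generating 2-cells, and relations -/

namespace Presented

variable {K : Type u} [Category.{u} K]

/-- Formal 2-cells over the 1-cells of `K`, generated by `G` under vertical composition and
whiskering. The cell `eqTo h` is the identity 2-cell between two equal 1-cells. -/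
inductive Cell (G : ∀ ⦃a b : K⦄, (a ⟶ b) → (a ⟶ b) → Type u) :
    ∀ {a b : K}, (a ⟶ b) → (a ⟶ b) → Type u
  | gen {a b : K} {f g : a ⟶ b} (s : G f g) : Cell G f g
  | eqTo {a b : K} {f g : a ⟶ b} (h : f = g) : Cell G f g
  | vcomp {a b : K} {f g h : a ⟶ b} (s : Cell G f g) (t : Cell G g h) : Cell G f h
  | whiskerLeft {a b c : K} (f : a ⟶ b) {g h : b ⟶ c} (s : Cell G g h) : Cell G (f ≫ g) (f ≫ h)
  | whiskerRight {a b c : K} {f g : a ⟶ b} (s : Cell G f g) (h : b ⟶ c) : Cell G (f ≫ h) (g ≫ h)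

variable {G : ∀ ⦃a b : K⦄, (a ⟶ b) → (a ⟶ b) → Type u}

/-- Horizontal composition of formal 2-cells, in diagrammatic order. -/
def Cell.hcomp {a b c : K} {f g : a ⟶ b} {h k : b ⟶ c} (s : Cell G f g) (t : Cell G h k) :
    Cell G (f ≫ h) (g ≫ k) :=
  .vcomp (.whiskerRight s h) (.whiskerLeft g t)

/-- The congruence on formal 2-cells generated by `R` and the axioms of strict 2-categories. -/
inductive Cong (R : ∀ ⦃a b : K⦄ ⦃f g : a ⟶ b⦄, Cell G f g → Cell G f g → Prop) :
    ∀ {a b : K} {f g : a ⟶ b}, Cell G f g → Cell G f g → Prop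
  | of {a b : K} {f g : a ⟶ b} {s t : Cell G f g} (h : R s t) : Cong R s t
  | refl {a b : K} {f g : a ⟶ b} (s : Cell G f g) : Cong R s s
  | symm {a b : K} {f g : a ⟶ b} {s t : Cell G f g} (h : Cong R s t) : Cong R t s
  | trans {a b : K} {f g : a ⟶ b} {s t r : Cell G f g} (h : Cong R s t) (h' : Cong R t r) :
      Cong R s r
  | vcomp {a b : K} {f g h : a ⟶ b} {s s' : Cell G f g} {t t' : Cell G g h}
      (hs : Cong R s s') (ht : Cong R t t') : Cong R (.vcomp s t) (.vcomp s' t')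
  | whiskerLeft {a b c : K} (f : a ⟶ b) {g h : b ⟶ c} {s s' : Cell G g h} (hs : Cong R s s') :
      Cong R (.whiskerLeft f s) (.whiskerLeft f s')
  | whiskerRight {a b c : K} {f g : a ⟶ b} {s s' : Cell G f g} (hs : Cong R s s') (h : b ⟶ c) :
      Cong R (.whiskerRight s h) (.whiskerRight s' h)
  | id_vcomp {a b : K} {f g : a ⟶ b} (s : Cell G f g) : Cong R (.vcomp (.eqTo rfl) s) s
  | vcomp_id {a b : K} {f g : a ⟶ b} (s : Cell G f g) : Cong R (.vcomp s (.eqTo rfl)) s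
  | vcomp_assoc {a b : K} {f g h k : a ⟶ b} (s : Cell G f g) (t : Cell G g h) (r : Cell G h k) :
      Cong R (.vcomp (.vcomp s t) r) (.vcomp s (.vcomp t r))
  | whiskerLeft_id {a b c : K} (f : a ⟶ b) (g : b ⟶ c) :
      Cong R (.whiskerLeft f (.eqTo (rfl : g = g))) (.eqTo rfl)
  | whiskerLeft_comp {a b c : K} (f : a ⟶ b) {g h k : b ⟶ c} (s : Cell G g h) (t : Cell G h k) :
      Cong R (.whiskerLeft f (.vcomp s t)) (.vcomp (.whiskerLeft f s) (.whiskerLeft f t))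
  | id_whiskerRight {a b c : K} (f : a ⟶ b) (g : b ⟶ c) :
      Cong R (.whiskerRight (.eqTo (rfl : f = f)) g) (.eqTo rfl)
  | comp_whiskerRight {a b c : K} {f g h : a ⟶ b} (s : Cell G f g) (t : Cell G g h) (k : b ⟶ c) :
      Cong R (.whiskerRight (.vcomp s t) k) (.vcomp (.whiskerRight s k) (.whiskerRight t k))
  | id_whiskerLeft {a b : K} {f g : a ⟶ b} (s : Cell G f g) :
      Cong R (.whiskerLeft (𝟙 a) s)
        (.vcomp (.eqTo (Category.id_comp f)) (.vcomp s (.eqTo (Category.id_comp g).symm)))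
  | comp_whiskerLeft {a b c d : K} (f : a ⟶ b) (g : b ⟶ c) {h k : c ⟶ d} (s : Cell G h k) :
      Cong R (.whiskerLeft (f ≫ g) s)
        (.vcomp (.eqTo (Category.assoc f g h))
          (.vcomp (.whiskerLeft f (.whiskerLeft g s)) (.eqTo (Category.assoc f g k).symm)))
  | whiskerRight_id {a b : K} {f g : a ⟶ b} (s : Cell G f g) :
      Cong R (.whiskerRight s (𝟙 b))
        (.vcomp (.eqTo (Category.comp_id f)) (.vcomp s (.eqTo (Category.comp_id g).symm)))
  | whiskerRight_comp {a b c d : K} {f g : a ⟶ b} (s : Cell G f g) (h : b ⟶ c) (k : c ⟶ d) :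
      Cong R (.whiskerRight s (h ≫ k))
        (.vcomp (.eqTo (Category.assoc f h k).symm)
          (.vcomp (.whiskerRight (.whiskerRight s h) k) (.eqTo (Category.assoc g h k))))
  | whisker_assoc {a b c d : K} (f : a ⟶ b) {g h : b ⟶ c} (s : Cell G g h) (k : c ⟶ d) :
      Cong R (.whiskerRight (.whiskerLeft f s) k)
        (.vcomp (.eqTo (Category.assoc f g k))
          (.vcomp (.whiskerLeft f (.whiskerRight s k)) (.eqTo (Category.assoc f h k).symm)))
  | whisker_exchange {a b c : K} {f g : a ⟶ b} {h k : b ⟶ c} (s : Cell G f g) (t : Cell G h k) :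
      Cong R (.vcomp (.whiskerLeft f t) (.whiskerRight s k))
        (.vcomp (.whiskerRight s h) (.whiskerLeft g t))

variable (R : ∀ ⦃a b : K⦄ ⦃f g : a ⟶ b⦄, Cell G f g → Cell G f g → Prop)

/-- The 2-cells of the presented 2-category. -/
def Hom₂ {a b : K} (f g : a ⟶ b) : Type u := Quot (Cong R (f := f) (g := g))

/-- The 2-cell represented by a formal 2-cell. -/
def mk {a b : K} {f g : a ⟶ b} (s : Cell G f g) : Hom₂ R f g := Quot.mk _ s

variable {R} in
theorem sound {a b : K} {f g : a ⟶ b} {s t : Cell G f g} (h : Cong R s t) : mk R s = mk R t :=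
  Quot.sound h

variable {R} in
theorem mk_surj {a b : K} {f g : a ⟶ b} (s : Hom₂ R f g) : ∃ t, mk R t = s :=
  Quot.exists_rep s

/-- The category of 1-cells `a ⟶ b` and 2-cells between them. -/
abbrev homCat (a b : K) : Category.{u} (a ⟶ b) where
  Hom f g := Hom₂ R f g
  id f := mk R (.eqTo (Eq.refl f))
  comp := Quot.map₂ Cell.vcomp (fun s _ _ h => .vcomp (.refl s) h) (fun _ _ t h => .vcomp h (.refl t))
  id_comp s := by obtain ⟨s, rfl⟩ := mk_surj s; exact sound (.id_vcomp s)
  comp_id s := by obtain ⟨s, rfl⟩ := mk_surj s; exact sound (.vcomp_id s)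
  assoc s t r := by
    obtain ⟨s, rfl⟩ := mk_surj s
    obtain ⟨t, rfl⟩ := mk_surj t
    obtain ⟨r, rfl⟩ := mk_surj r
    exact sound (.vcomp_assoc s t r)

theorem mk_whiskerLeft_eqTo {a b c : K} (f : a ⟶ b) {g h : b ⟶ c} (p : g = h) :
    mk R (.whiskerLeft f (.eqTo p)) = mk R (.eqTo (congrArg (f ≫ ·) p)) := by
  subst p; exact sound (.whiskerLeft_id _ _)

theorem mk_whiskerRight_eqTo {a b c : K} {f g : a ⟶ b} (p : f = g) (h : b ⟶ c) :
    mk R (.whiskerRight (.eqTo p) h) = mk R (.eqTo (congrArg (· ≫ h) p)) := by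
  subst p; exact sound (.id_whiskerRight _ _)

theorem mk_eqTo_vcomp {a b : K} {f g h : a ⟶ b} (p : f = g) (q : g = h) :
    mk R (.vcomp (.eqTo p) (.eqTo q)) = mk R (.eqTo (p.trans q)) := by
  subst p q; exact sound (.id_vcomp _)

/-- The identity 2-cell between equal 1-cells, as an isomorphism. -/
abbrev eqIso {a b : K} {f g : a ⟶ b} (p : f = g) : @Iso (a ⟶ b) (homCat R a b) f g :=
  letI := homCat R a b
  { hom := mk R (.eqTo p)
    inv := mk R (.eqTo p.symm)
    hom_inv_id := mk_eqTo_vcomp R p p.symm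
    inv_hom_id := mk_eqTo_vcomp R p.symm p }

theorem eqIso_eq {a b : K} {f g : a ⟶ b} (p : f = g) :
    eqIso R p = @eqToIso (a ⟶ b) (homCat R a b) _ _ p := by
  subst p; rfl

/-- The bicategory structure with underlying category `K` and 2-cells `Hom₂ R`. -/
abbrev bicategory : Bicategory.{u, u} K where
  homCategory := homCat R
  whiskerLeft f _ _ := Quot.map (Cell.whiskerLeft f) (fun _ _ h => .whiskerLeft f h)
  whiskerRight s h :=
    Quot.map (fun s => Cell.whiskerRight s h) (fun _ _ hs => .whiskerRight hs h) s
  associator f g h := eqIso R (Category.assoc f g h)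
  leftUnitor f := eqIso R (Category.id_comp f)
  rightUnitor f := eqIso R (Category.comp_id f)
  whiskerLeft_id f g := sound (.whiskerLeft_id f g)
  whiskerLeft_comp f _ _ _ s t := by
    obtain ⟨s, rfl⟩ := mk_surj s
    obtain ⟨t, rfl⟩ := mk_surj t
    exact sound (.whiskerLeft_comp f s t)
  id_whiskerLeft s := by
    obtain ⟨s, rfl⟩ := mk_surj s
    exact sound (.id_whiskerLeft s)
  comp_whiskerLeft f g _ _ s := by
    obtain ⟨s, rfl⟩ := mk_surj s
    exact sound (.comp_whiskerLeft f g s)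
  id_whiskerRight f g := sound (.id_whiskerRight f g)
  comp_whiskerRight s t k := by
    obtain ⟨s, rfl⟩ := mk_surj s
    obtain ⟨t, rfl⟩ := mk_surj t
    exact sound (.comp_whiskerRight s t k)
  whiskerRight_id s := by
    obtain ⟨s, rfl⟩ := mk_surj s
    exact sound (.whiskerRight_id s)
  whiskerRight_comp s h k := by
    obtain ⟨s, rfl⟩ := mk_surj s
    exact sound (.whiskerRight_comp s h k)
  whisker_assoc f _ _ s k := by
    obtain ⟨s, rfl⟩ := mk_surj s
    exact sound (.whisker_assoc f s k)
  whisker_exchange s t := by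
    obtain ⟨s, rfl⟩ := mk_surj s
    obtain ⟨t, rfl⟩ := mk_surj t
    exact sound (.whisker_exchange s t)
  pentagon {a b c d e} f g h k := by
    let := homCat R a e
    refine (congrArg₂ (· ≫ ·) (mk_whiskerRight_eqTo R (Category.assoc f g h) k)
      (congrArg₂ (· ≫ ·) rfl (mk_whiskerLeft_eqTo R f (Category.assoc g h k)))).trans ?_
    refine (congrArg₂ (· ≫ ·) rfl (mk_eqTo_vcomp R _ _)).trans ?_
    exact (mk_eqTo_vcomp R _ _).trans (mk_eqTo_vcomp R _ _).symm
  triangle {a b c} f g := by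
    let := homCat R a c
    refine (congrArg₂ (· ≫ ·) rfl (mk_whiskerLeft_eqTo R f (Category.id_comp g))).trans ?_
    exact (mk_eqTo_vcomp R _ _).trans (mk_whiskerRight_eqTo R (Category.comp_id f) g).symm

theorem strict : @Bicategory.Strict K (bicategory R) :=
  letI := bicategory R
  { id_comp := fun f => Category.id_comp f
    comp_id := fun f => Category.comp_id f
    assoc := fun f g h => Category.assoc f g h
    leftUnitor_eqToIso := fun _ => eqIso_eq R _
    rightUnitor_eqToIso := fun _ => eqIso_eq R _
    associator_eqToIso := fun _ _ _ => eqIso_eq R _ }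

/-- The strict 2-category with category of 1-cells `K` and with 2-cells generated by `G` under
vertical and horizontal composition, subject to the relations `R`. -/
abbrev twoCat : TwoCat.{u} where
  carrier := K
  bicategory := bicategory R
  strict := strict R

end Presented

/-! ### The lax Gray tensor product of two strict 2-categories -/

namespace Gray

open Presented

variable (B C : TwoCat.{u})

/-- Pairs of 0-cells. -/
structure Obj : Type u where
  fst : B
  snd : C

/-- Generating 1-cells `(f, Id)` and `(Id, g)`. -/
inductive Gen₁ : Obj B C → Obj B C → Type u
  | left {b b' : B} (f : b ⟶ b') (c : C) : Gen₁ ⟨b, c⟩ ⟨b', c⟩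
  | right (b : B) {c c' : C} (g : c ⟶ c') : Gen₁ ⟨b, c⟩ ⟨b, c'⟩

instance : Quiver.{u} (Obj B C) := ⟨Gen₁ B C⟩

variable {B C} in
/-- The one-term sequence `(f, Id)`. -/
def pathLeft {b b' : B} (f : b ⟶ b') (c : C) :
    (Paths.of (Obj B C)).obj ⟨b, c⟩ ⟶ (Paths.of (Obj B C)).obj ⟨b', c⟩ :=
  (Paths.of (Obj B C)).map (Gen₁.left f c)

variable {B C} in
/-- The one-term sequence `(Id, g)`. -/
def pathRight (b : B) {c c' : C} (g : c ⟶ c') :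
    (Paths.of (Obj B C)).obj ⟨b, c⟩ ⟶ (Paths.of (Obj B C)).obj ⟨b, c'⟩ :=
  (Paths.of (Obj B C)).map (Gen₁.right b g)

inductive Rel₁ : HomRel (Paths (Obj B C))
  | left_id (b : B) (c : C) : Rel₁ (pathLeft (𝟙 b) c) (𝟙 _)
  | right_id (b : B) (c : C) : Rel₁ (pathRight b (𝟙 c)) (𝟙 _)
  | left_comp {b b' b'' : B} (f : b ⟶ b') (f' : b' ⟶ b'') (c : C) :
      Rel₁ (pathLeft f c ≫ pathLeft f' c) (pathLeft (f ≫ f') c)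
  | right_comp (b : B) {c c' c'' : C} (g : c ⟶ c') (g' : c' ⟶ c'') :
      Rel₁ (pathRight b g ≫ pathRight b g') (pathRight b (g ≫ g'))

/-- The category of 0-cells and 1-cells of the lax Gray tensor product. -/
abbrev OneCat : Type u := CategoryTheory.Quotient (Rel₁ B C)

variable {B C}

def pt₁ (b : B) (c : C) : OneCat B C := ⟨(⟨b, c⟩ : Obj B C)⟩

/-- The 1-cell `(f, Id)`. -/
def left₁ {b b' : B} (f : b ⟶ b') (c : C) : pt₁ b c ⟶ pt₁ b' c :=
  (CategoryTheory.Quotient.functor (Rel₁ B C)).map (pathLeft f c)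

/-- The 1-cell `(Id, g)`. -/
def right₁ (b : B) {c c' : C} (g : c ⟶ c') : pt₁ b c ⟶ pt₁ b c' :=
  (CategoryTheory.Quotient.functor (Rel₁ B C)).map (pathRight b g)

theorem left₁_id (b : B) (c : C) : left₁ (𝟙 b) c = 𝟙 (pt₁ b c) :=
  CategoryTheory.Quotient.sound _ (Rel₁.left_id b c)

theorem right₁_id (b : B) (c : C) : right₁ b (𝟙 c) = 𝟙 (pt₁ b c) :=
  CategoryTheory.Quotient.sound _ (Rel₁.right_id b c)

theorem left₁_comp {b b' b'' : B} (f : b ⟶ b') (f' : b' ⟶ b'') (c : C) :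
    left₁ (f ≫ f') c = left₁ f c ≫ left₁ f' c :=
  (CategoryTheory.Quotient.sound _ (Rel₁.left_comp f f' c)).symm

theorem right₁_comp (b : B) {c c' c'' : C} (g : c ⟶ c') (g' : c' ⟶ c'') :
    right₁ b (g ≫ g') = right₁ b g ≫ right₁ b g' :=
  (CategoryTheory.Quotient.sound _ (Rel₁.right_comp b g g')).symm

variable (B C) in
/-- Generating 2-cells `(φ, Id)`, `(Id, ψ)` and `γ_{f,g}`. -/
inductive Gen₂ : ∀ ⦃X Y : OneCat B C⦄, (X ⟶ Y) → (X ⟶ Y) → Type u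
  | left {b b' : B} {f f' : b ⟶ b'} (φ : f ⟶ f') (c : C) : Gen₂ (left₁ f c) (left₁ f' c)
  | right (b : B) {c c' : C} {g g' : c ⟶ c'} (ψ : g ⟶ g') : Gen₂ (right₁ b g) (right₁ b g')
  | swap {b b' : B} (f : b ⟶ b') {c c' : C} (g : c ⟶ c') :
      Gen₂ (right₁ b g ≫ left₁ f c') (left₁ f c ≫ right₁ b' g)

abbrev cellLeft {b b' : B} {f f' : b ⟶ b'} (φ : f ⟶ f') (c : C) :
    Cell (Gen₂ B C) (left₁ f c) (left₁ f' c) := .gen (.left φ c)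

abbrev cellRight (b : B) {c c' : C} {g g' : c ⟶ c'} (ψ : g ⟶ g') :
    Cell (Gen₂ B C) (right₁ b g) (right₁ b g') := .gen (.right b ψ)

abbrev cellSwap {b b' : B} (f : b ⟶ b') {c c' : C} (g : c ⟶ c') :
    Cell (Gen₂ B C) (right₁ b g ≫ left₁ f c') (left₁ f c ≫ right₁ b' g) := .gen (.swap f g)

variable (B C) in
inductive Rel₂ : ∀ ⦃X Y : OneCat B C⦄ ⦃F G : X ⟶ Y⦄,
    Cell (Gen₂ B C) F G → Cell (Gen₂ B C) F G → Prop
  | left_id {b b' : B} (f : b ⟶ b') (c : C) : Rel₂ (cellLeft (𝟙 f) c) (.eqTo rfl)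
  | right_id (b : B) {c c' : C} (g : c ⟶ c') : Rel₂ (cellRight b (𝟙 g)) (.eqTo rfl)
  | left_vcomp {b b' : B} {f f' f'' : b ⟶ b'} (φ : f ⟶ f') (φ' : f' ⟶ f'') (c : C) :
      Rel₂ (.vcomp (cellLeft φ c) (cellLeft φ' c)) (cellLeft (φ ≫ φ') c)
  | right_vcomp (b : B) {c c' : C} {g g' g'' : c ⟶ c'} (ψ : g ⟶ g') (ψ' : g' ⟶ g'') :
      Rel₂ (.vcomp (cellRight b ψ) (cellRight b ψ')) (cellRight b (ψ ≫ ψ'))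
  | left_hcomp {b b' b'' : B} {f f' : b ⟶ b'} {h h' : b' ⟶ b''} (φ : f ⟶ f') (χ : h ⟶ h')
      (c : C) :
      Rel₂ (cellLeft (φ ▷ h ≫ f' ◁ χ) c)
        (.vcomp (.eqTo (left₁_comp f h c))
          (.vcomp (.hcomp (cellLeft φ c) (cellLeft χ c)) (.eqTo (left₁_comp f' h' c).symm)))
  | right_hcomp (b : B) {c c' c'' : C} {g g' : c ⟶ c'} {h h' : c' ⟶ c''} (ψ : g ⟶ g')
      (χ : h ⟶ h') :
      Rel₂ (cellRight b (ψ ▷ h ≫ g' ◁ χ))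
        (.vcomp (.eqTo (right₁_comp b g h))
          (.vcomp (.hcomp (cellRight b ψ) (cellRight b χ)) (.eqTo (right₁_comp b g' h').symm)))
  | swap_id_right {b b' : B} (f : b ⟶ b') (c : C) :
      Rel₂ (cellSwap f (𝟙 c)) (.eqTo (by simp only [right₁_id, Category.id_comp, Category.comp_id]))
  | swap_id_left (b : B) {c c' : C} (g : c ⟶ c') :
      Rel₂ (cellSwap (𝟙 b) g) (.eqTo (by simp only [left₁_id, Category.id_comp, Category.comp_id]))
  | swap_comp_left {b b' b'' : B} (f : b ⟶ b') (f' : b' ⟶ b'') {c c' : C} (g : c ⟶ c') :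
      Rel₂ (cellSwap (f ≫ f') g)
        (.vcomp (.eqTo (by simp only [left₁_comp, Category.assoc]))
          (.vcomp (.whiskerRight (cellSwap f g) (left₁ f' c'))
            (.vcomp (.eqTo (Category.assoc _ _ _))
              (.vcomp (.whiskerLeft (left₁ f c) (cellSwap f' g))
                (.eqTo (by simp only [left₁_comp, Category.assoc]))))))
  | swap_comp_right {b b' : B} (f : b ⟶ b') {c c' c'' : C} (g : c ⟶ c') (g' : c' ⟶ c'') :
      Rel₂ (cellSwap f (g ≫ g'))
        (.vcomp (.eqTo (by simp only [right₁_comp, Category.assoc]))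
          (.vcomp (.whiskerLeft (right₁ b g) (cellSwap f g'))
            (.vcomp (.eqTo (Category.assoc _ _ _).symm)
              (.vcomp (.whiskerRight (cellSwap f g) (right₁ b' g'))
                (.eqTo (by simp only [right₁_comp, Category.assoc]))))))
  | swap_naturality {b b' : B} {f f' : b ⟶ b'} (φ : f ⟶ f') {c c' : C} {g g' : c ⟶ c'}
      (ψ : g ⟶ g') :
      Rel₂ (.vcomp (.hcomp (cellRight b ψ) (cellLeft φ c')) (cellSwap f' g'))
        (.vcomp (cellSwap f g) (.hcomp (cellLeft φ c) (cellRight b' ψ)))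

end Gray

/-- The lax Gray tensor product of two strict 2-categories. -/
def gray (B C : TwoCat.{u}) : TwoCat.{u} := Presented.twoCat (Gray.Rel₂ B C)

namespace Gray

open Presented

variable {B C : TwoCat.{u}}

/-- The 0-cell `(b, c)` of the lax Gray tensor product. -/
def pt (b : B) (c : C) : gray B C := pt₁ b c

/-- The 1-cell `(f, Id)` of the lax Gray tensor product. -/
def left {b b' : B} (f : b ⟶ b') (c : C) : pt b c ⟶ pt b' c := left₁ f c

/-- The 1-cell `(Id, g)` of the lax Gray tensor product. -/
def right (b : B) {c c' : C} (g : c ⟶ c') : pt b c ⟶ pt b c' := right₁ b g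

/-- The 2-cell `(φ, Id)` of the lax Gray tensor product. -/
def left₂ {b b' : B} {f f' : b ⟶ b'} (φ : f ⟶ f') (c : C) : left f c ⟶ left f' c :=
  Presented.mk (Rel₂ B C) (cellLeft φ c)

/-- The 2-cell `(Id, ψ)` of the lax Gray tensor product. -/
def right₂ (b : B) {c c' : C} {g g' : c ⟶ c'} (ψ : g ⟶ g') : right b g ⟶ right b g' :=
  Presented.mk (Rel₂ B C) (cellRight b ψ)

/-- The 2-cell `γ_{f,g}` of the lax Gray tensor product. -/
def swap {b b' : B} (f : b ⟶ b') {c c' : C} (g : c ⟶ c') :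
    right b g ≫ left f c' ⟶ left f c ≫ right b' g :=
  Presented.mk (Rel₂ B C) (cellSwap f g)

end Gray

/-- The left-iterated lax Gray tensor product `(⋯(C₀ ⊗ C₁) ⊗ ⋯) ⊗ Cₙ` of `n + 1` strict
2-categories. -/
def grayIter : (n : ℕ) → (Fin (n + 1) → TwoCat.{u}) → TwoCat.{u}
  | 0, C => C 0
  | n + 1, C => gray (grayIter n fun i => C i.castSucc) (C (Fin.last (n + 1)))

namespace GrayIter

/-- The 0-cell `((⋯(a₀, a₁), ⋯), aₙ)` of the iterated lax Gray tensor product. -/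
def pt : (n : ℕ) → (C : Fin (n + 1) → TwoCat.{u}) → (∀ i, C i) → grayIter n C
  | 0, _, a => a 0
  | n + 1, C, a =>
      Gray.pt (pt n (fun i => C i.castSucc) fun i => a i.castSucc) (a (Fin.last (n + 1)))

/-- `IsOneCell n C i f F`: the 1-cell `F` of the iterated tensor product is `{f}ᵢ`
(at some tuple of 0-cells, which is determined by the source of `F`). -/
inductive IsOneCell : ∀ (n : ℕ) (C : Fin (n + 1) → TwoCat.{u}) (i : Fin (n + 1)) {x y : C i}
    (_ : x ⟶ y) {A B : grayIter n C} (_ : A ⟶ B), Prop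
  | base (C : Fin 1 → TwoCat.{u}) {x y : C 0} (f : x ⟶ y) :
      IsOneCell 0 C 0 f (A := x) (B := y) f
  | castSucc {n : ℕ} {C : Fin (n + 2) → TwoCat.{u}} {i : Fin (n + 1)} {x y : C i.castSucc}
      {f : x ⟶ y} {A B : grayIter n fun i => C i.castSucc} {F : A ⟶ B}
      (h : IsOneCell n (fun i => C i.castSucc) i f F) (c : C (Fin.last (n + 1))) :
      IsOneCell (n + 1) C i.castSucc f (A := Gray.pt A c) (B := Gray.pt B c) (Gray.left F c)
  | last {n : ℕ} {C : Fin (n + 2) → TwoCat.{u}} (A : grayIter n fun i => C i.castSucc)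
      {x y : C (Fin.last (n + 1))} (f : x ⟶ y) :
      IsOneCell (n + 1) C (Fin.last (n + 1)) f (A := Gray.pt A x) (B := Gray.pt A y)
        (Gray.right A f)

/-- `IsTwoCell n C i φ Φ`: the 2-cell `Φ` of the iterated tensor product is `{φ}ᵢ`. The last
clause only says that this does not depend on how the source and target of `Φ` are written. -/
inductive IsTwoCell : ∀ (n : ℕ) (C : Fin (n + 1) → TwoCat.{u}) (i : Fin (n + 1)) {x y : C i}
    {f g : x ⟶ y} (_ : f ⟶ g) {A B : grayIter n C} {F G : A ⟶ B} (_ : F ⟶ G), Prop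
  | base (C : Fin 1 → TwoCat.{u}) {x y : C 0} {f g : x ⟶ y} (φ : f ⟶ g) :
      IsTwoCell 0 C 0 φ (A := x) (B := y) (F := f) (G := g) φ
  | castSucc {n : ℕ} {C : Fin (n + 2) → TwoCat.{u}} {i : Fin (n + 1)} {x y : C i.castSucc}
      {f g : x ⟶ y} {φ : f ⟶ g} {A B : grayIter n fun i => C i.castSucc} {F G : A ⟶ B} {Φ : F ⟶ G}
      (h : IsTwoCell n (fun i => C i.castSucc) i φ Φ) (c : C (Fin.last (n + 1))) :
      IsTwoCell (n + 1) C i.castSucc φ (A := Gray.pt A c) (B := Gray.pt B c)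
        (F := Gray.left F c) (G := Gray.left G c) (Gray.left₂ Φ c)
  | last {n : ℕ} {C : Fin (n + 2) → TwoCat.{u}} (A : grayIter n fun i => C i.castSucc)
      {x y : C (Fin.last (n + 1))} {f g : x ⟶ y} (φ : f ⟶ g) :
      IsTwoCell (n + 1) C (Fin.last (n + 1)) φ (A := Gray.pt A x) (B := Gray.pt A y)
        (F := Gray.right A f) (G := Gray.right A g) (Gray.right₂ A φ)
  | congr {n : ℕ} {C : Fin (n + 1) → TwoCat.{u}} {i : Fin (n + 1)} {x y : C i}
      {f g : x ⟶ y} {φ : f ⟶ g} {A B : grayIter n C} {F G F' G' : A ⟶ B} {Φ : F ⟶ G}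
      (h : IsTwoCell n C i φ Φ) (hF : F' = F) (hG : G = G') :
      IsTwoCell n C i φ (eqToHom hF ≫ Φ ≫ eqToHom hG)

/-- `IsSwap n C i j f g Γ`: the 2-cell `Γ` of the iterated tensor product is `γ^{i,j}_{f,g}`, where
`i < j`. The last clause only says that this does not depend on how the source and target of `Γ`
are written. -/
inductive IsSwap : ∀ (n : ℕ) (C : Fin (n + 1) → TwoCat.{u}) (i j : Fin (n + 1)) {x x' : C i}
    (_ : x ⟶ x') {y y' : C j} (_ : y ⟶ y') {A B : grayIter n C} {F G : A ⟶ B} (_ : F ⟶ G), Prop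
  | castSucc {n : ℕ} {C : Fin (n + 2) → TwoCat.{u}} {i j : Fin (n + 1)} {x x' : C i.castSucc}
      {f : x ⟶ x'} {y y' : C j.castSucc} {g : y ⟶ y'} {A B : grayIter n fun i => C i.castSucc}
      {F G : A ⟶ B} {Γ : F ⟶ G} (h : IsSwap n (fun i => C i.castSucc) i j f g Γ)
      (c : C (Fin.last (n + 1))) :
      IsSwap (n + 1) C i.castSucc j.castSucc f g (A := Gray.pt A c) (B := Gray.pt B c)
        (F := Gray.left F c) (G := Gray.left G c) (Gray.left₂ Γ c)
  | last {n : ℕ} {C : Fin (n + 2) → TwoCat.{u}} {i : Fin (n + 1)} {x x' : C i.castSucc}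
      {f : x ⟶ x'} {A B : grayIter n fun i => C i.castSucc} {F : A ⟶ B}
      (h : IsOneCell n (fun i => C i.castSucc) i f F) {y y' : C (Fin.last (n + 1))} (g : y ⟶ y') :
      IsSwap (n + 1) C i.castSucc (Fin.last (n + 1)) f g (A := Gray.pt A y) (B := Gray.pt B y')
        (F := Gray.right A g ≫ Gray.left F y') (G := Gray.left F y ≫ Gray.right B g)
        (Gray.swap F g)
  | congr {n : ℕ} {C : Fin (n + 1) → TwoCat.{u}} {i j : Fin (n + 1)} {x x' : C i}
      {f : x ⟶ x'} {y y' : C j} {g : y ⟶ y'} {A B : grayIter n C} {F G F' G' : A ⟶ B}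
      {Γ : F ⟶ G} (h : IsSwap n C i j f g Γ) (hF : F' = F) (hG : G = G') :
      IsSwap n C i j f g (eqToHom hF ≫ Γ ≫ eqToHom hG)

end GrayIter

/-! ### The explicit presentation with `n` factors -/

namespace Multi

open Presented

variable {n : ℕ}

/-- `n`-tuples of 0-cells. -/
@[ext]
structure Obj (C : Fin n → TwoCat.{u}) : Type u where
  val : ∀ i, C i

variable {C : Fin n → TwoCat.{u}}

/-- The tuples `a` and `b` are `(a₁, …, x, …, aₙ)` and `(a₁, …, y, …, aₙ)`, with `x` and `y` in
position `i`. -/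
structure IsStep (i : Fin n) (x y : C i) (a b : Obj C) : Prop where
  src : a.val i = x
  tgt : b.val i = y
  off : ∀ j, j ≠ i → a.val j = b.val j

theorem IsStep.trans {i : Fin n} {x y z : C i} {a b c : Obj C} (h : IsStep i x y a b)
    (h' : IsStep i y z b c) : IsStep i x z a c :=
  ⟨h.src, h'.tgt, fun j hj => (h.off j hj).trans (h'.off j hj)⟩

/-- The tuples `a`, `b`, `c`, `d` agree outside the positions `i` and `j`, where they are
`(x, y)`, `(x', y)`, `(x, y')` and `(x', y')`. -/
structure IsSquare (i j : Fin n) (x x' : C i) (y y' : C j) (a b c d : Obj C) : Prop where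
  ab : IsStep i x x' a b
  ac : IsStep j y y' a c
  bd : IsStep j y y' b d
  cd : IsStep i x x' c d

variable (C) in
/-- Generating 1-cells `{f}ᵢ`. -/
inductive Gen₁ : Obj C → Obj C → Type u
  | cell {i : Fin n} {x y : C i} (f : x ⟶ y) {a b : Obj C} (h : IsStep i x y a b) : Gen₁ a b

instance : Quiver.{u} (Obj C) := ⟨Gen₁ C⟩

/-- The one-term sequence `{f}ᵢ`. -/
def path {i : Fin n} {x y : C i} (f : x ⟶ y) {a b : Obj C} (h : IsStep i x y a b) :
    (Paths.of (Obj C)).obj a ⟶ (Paths.of (Obj C)).obj b :=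
  (Paths.of (Obj C)).map (Gen₁.cell f h)

variable (C) in
inductive Rel₁ : HomRel (Paths (Obj C))
  | id {i : Fin n} {x : C i} {a : Obj C} (h : IsStep i x x a a) : Rel₁ (path (𝟙 x) h) (𝟙 _)
  | comp {i : Fin n} {x y z : C i} (f : x ⟶ y) (g : y ⟶ z) {a b c : Obj C}
      (h : IsStep i x y a b) (h' : IsStep i y z b c) :
      Rel₁ (path f h ≫ path g h') (path (f ≫ g) (h.trans h'))

variable (C) in
/-- The category of 0-cells and 1-cells of the presented 2-category. -/
abbrev OneCat : Type u := CategoryTheory.Quotient (Rel₁ C)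

def pt₁ (a : Obj C) : OneCat C := ⟨a⟩

/-- The 1-cell `{f}ᵢ`. -/
def one {i : Fin n} {x y : C i} (f : x ⟶ y) {a b : Obj C} (h : IsStep i x y a b) :
    pt₁ a ⟶ pt₁ b :=
  (CategoryTheory.Quotient.functor (Rel₁ C)).map (path f h)

theorem one_id {i : Fin n} {x : C i} {a : Obj C} (h : IsStep i x x a a) :
    one (𝟙 x) h = 𝟙 (pt₁ a) :=
  CategoryTheory.Quotient.sound _ (Rel₁.id h)

theorem one_comp {i : Fin n} {x y z : C i} (f : x ⟶ y) (g : y ⟶ z) {a b c : Obj C}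
    (h : IsStep i x y a b) (h' : IsStep i y z b c) :
    one (f ≫ g) (h.trans h') = one f h ≫ one g h' :=
  (CategoryTheory.Quotient.sound _ (Rel₁.comp f g h h')).symm

variable (C) in
/-- Generating 2-cells `{φ}ᵢ`, and `γ^{i,j}_{f,g}` for `i < j`. -/
inductive Gen₂ : ∀ ⦃X Y : OneCat C⦄, (X ⟶ Y) → (X ⟶ Y) → Type u
  | cell {i : Fin n} {x y : C i} {f g : x ⟶ y} (φ : f ⟶ g) {a b : Obj C} (h : IsStep i x y a b) :
      Gen₂ (one f h) (one g h)
  | swap {i j : Fin n} (hij : i < j) {x x' : C i} (f : x ⟶ x') {y y' : C j} (g : y ⟶ y')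
      {a b c d : Obj C} (s : IsSquare i j x x' y y' a b c d) :
      Gen₂ (one g s.ac ≫ one f s.cd) (one f s.ab ≫ one g s.bd)

abbrev two {i : Fin n} {x y : C i} {f g : x ⟶ y} (φ : f ⟶ g) {a b : Obj C}
    (h : IsStep i x y a b) : Cell (Gen₂ C) (one f h) (one g h) := .gen (.cell φ h)

abbrev swap {i j : Fin n} (hij : i < j) {x x' : C i} (f : x ⟶ x') {y y' : C j} (g : y ⟶ y')
    {a b c d : Obj C} (s : IsSquare i j x x' y y' a b c d) :
    Cell (Gen₂ C) (one g s.ac ≫ one f s.cd) (one f s.ab ≫ one g s.bd) := .gen (.swap hij f g s)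

variable (C) in
inductive Rel₂ : ∀ ⦃X Y : OneCat C⦄ ⦃F G : X ⟶ Y⦄, Cell (Gen₂ C) F G → Cell (Gen₂ C) F G → Prop
  | id {i : Fin n} {x y : C i} (f : x ⟶ y) {a b : Obj C} (h : IsStep i x y a b) :
      Rel₂ (two (𝟙 f) h) (.eqTo rfl)
  | vcomp {i : Fin n} {x y : C i} {f g k : x ⟶ y} (φ : f ⟶ g) (ψ : g ⟶ k) {a b : Obj C}
      (h : IsStep i x y a b) :
      Rel₂ (.vcomp (two φ h) (two ψ h)) (two (φ ≫ ψ) h)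
  | hcomp {i : Fin n} {x y z : C i} {f f' : x ⟶ y} {g g' : y ⟶ z} (φ : f ⟶ f') (ψ : g ⟶ g')
      {a b c : Obj C} (h : IsStep i x y a b) (h' : IsStep i y z b c) :
      Rel₂ (two (φ ▷ g ≫ f' ◁ ψ) (h.trans h'))
        (.vcomp (.eqTo (one_comp f g h h'))
          (.vcomp (.hcomp (two φ h) (two ψ h')) (.eqTo (one_comp f' g' h h').symm)))
  | swap_id_right {i j : Fin n} (hij : i < j) {x x' : C i} (f : x ⟶ x') {y : C j} {a b : Obj C}
      (s : IsSquare i j x x' y y a b a b) :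
      Rel₂ (swap hij f (𝟙 y) s)
        (.eqTo (by simp only [one_id, Category.id_comp, Category.comp_id]))
  | swap_id_left {i j : Fin n} (hij : i < j) {x : C i} {y y' : C j} (g : y ⟶ y') {a c : Obj C}
      (s : IsSquare i j x x y y' a a c c) :
      Rel₂ (swap hij (𝟙 x) g s)
        (.eqTo (by simp only [one_id, Category.id_comp, Category.comp_id]))
  | swap_comp_left {i j : Fin n} (hij : i < j) {x x' x'' : C i} (f : x ⟶ x') (f' : x' ⟶ x'')
      {y y' : C j} (g : y ⟶ y') {a b e c d k : Obj C} (s : IsSquare i j x x' y y' a b c d)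
      (t : IsSquare i j x' x'' y y' b e d k) :
      Rel₂ (swap hij (f ≫ f') g ⟨s.ab.trans t.ab, s.ac, t.bd, s.cd.trans t.cd⟩)
        (.vcomp (.eqTo (by simp only [one_comp _ _ s.cd t.cd, Category.assoc]))
          (.vcomp (.whiskerRight (swap hij f g s) (one f' t.cd))
            (.vcomp (.eqTo (Category.assoc _ _ _))
              (.vcomp (.whiskerLeft (one f s.ab) (swap hij f' g t))
                (.eqTo (by simp only [one_comp _ _ s.ab t.ab, Category.assoc]))))))
  | swap_comp_right {i j : Fin n} (hij : i < j) {x x' : C i} (f : x ⟶ x') {y y' y'' : C j}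
      (g : y ⟶ y') (g' : y' ⟶ y'') {a b c d e k : Obj C} (s : IsSquare i j x x' y y' a b c d)
      (t : IsSquare i j x x' y' y'' c d e k) :
      Rel₂ (swap hij f (g ≫ g') ⟨s.ab, s.ac.trans t.ac, s.bd.trans t.bd, t.cd⟩)
        (.vcomp (.eqTo (by simp only [one_comp _ _ s.ac t.ac, Category.assoc]))
          (.vcomp (.whiskerLeft (one g s.ac) (swap hij f g' t))
            (.vcomp (.eqTo (Category.assoc _ _ _).symm)
              (.vcomp (.whiskerRight (swap hij f g s) (one g' t.bd))
                (.eqTo (by simp only [one_comp _ _ s.bd t.bd, Category.assoc]))))))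
  | swap_naturality {i j : Fin n} (hij : i < j) {x x' : C i} {f f' : x ⟶ x'} (φ : f ⟶ f')
      {y y' : C j} {g g' : y ⟶ y'} (ψ : g ⟶ g') {a b c d : Obj C}
      (s : IsSquare i j x x' y y' a b c d) :
      Rel₂ (.vcomp (.hcomp (two ψ s.ac) (two φ s.cd)) (swap hij f' g' s))
        (.vcomp (swap hij f g s) (.hcomp (two φ s.ab) (two ψ s.bd)))
  /- The eight tuples are the vertices of a cube: a subscript `1` in the first, second or third
  place means that position `i`, `j` or `k` has already been changed, by `f`, `g` or `h`. -/
  | yangBaxter {i j k : Fin n} (hij : i < j) (hjk : j < k) {x x' : C i} (f : x ⟶ x')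
      {y y' : C j} (g : y ⟶ y') {z z' : C k} (h : z ⟶ z')
      {a₀₀₀ a₁₀₀ a₀₁₀ a₁₁₀ a₀₀₁ a₁₀₁ a₀₁₁ a₁₁₁ : Obj C}
      (sij : IsSquare i j x x' y y' a₀₀₀ a₁₀₀ a₀₁₀ a₁₁₀)
      (sij' : IsSquare i j x x' y y' a₀₀₁ a₁₀₁ a₀₁₁ a₁₁₁)
      (sik : IsSquare i k x x' z z' a₀₀₀ a₁₀₀ a₀₀₁ a₁₀₁)
      (sik' : IsSquare i k x x' z z' a₀₁₀ a₁₁₀ a₀₁₁ a₁₁₁)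
      (sjk : IsSquare j k y y' z z' a₀₀₀ a₀₁₀ a₀₀₁ a₀₁₁)
      (sjk' : IsSquare j k y y' z z' a₁₀₀ a₁₁₀ a₁₀₁ a₁₁₁) :
      Rel₂
        (.vcomp (.whiskerRight (swap hjk g h sjk) (one f sij'.cd))
          (.vcomp (.eqTo (Category.assoc _ _ _))
            (.vcomp (.whiskerLeft (one g sij.ac) (swap (hij.trans hjk) f h sik'))
              (.vcomp (.eqTo (Category.assoc _ _ _).symm)
                (.whiskerRight (swap hij f g sij) (one h sjk'.bd))))))
        (.vcomp (.eqTo (Category.assoc _ _ _))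
          (.vcomp (.whiskerLeft (one h sik.ac) (swap hij f g sij'))
            (.vcomp (.eqTo (Category.assoc _ _ _).symm)
              (.vcomp (.whiskerRight (swap (hij.trans hjk) f h sik) (one g sij'.bd))
                (.vcomp (.eqTo (Category.assoc _ _ _))
                  (.vcomp (.whiskerLeft (one f sij.ab) (swap hjk g h sjk'))
                    (.eqTo (Category.assoc _ _ _).symm)))))))

end Multi

/-- The strict 2-category given by the explicit presentation with `n` factors. -/
def multiGray {n : ℕ} (C : Fin n → TwoCat.{u}) : TwoCat.{u} := Presented.twoCat (Multi.Rel₂ C)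

namespace MultiGray

open Multi

variable {n : ℕ} {C : Fin n → TwoCat.{u}}

/-- The 0-cell of the presented 2-category given by a tuple. -/
def pt (a : Obj C) : multiGray C := pt₁ a

/-- The 1-cell `{f}ᵢ` of the presented 2-category. -/
def oneCell {i : Fin n} {x y : C i} (f : x ⟶ y) {a b : Obj C} (h : IsStep i x y a b) :
    pt a ⟶ pt b := one f h

/-- The 2-cell `{φ}ᵢ` of the presented 2-category. -/
def twoCell {i : Fin n} {x y : C i} {f g : x ⟶ y} (φ : f ⟶ g) {a b : Obj C}
    (h : IsStep i x y a b) : oneCell f h ⟶ oneCell g h :=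
  Presented.mk (Rel₂ C) (two φ h)

/-- The 2-cell `γ^{i,j}_{f,g}` of the presented 2-category. -/
def swapCell {i j : Fin n} (hij : i < j) {x x' : C i} (f : x ⟶ x') {y y' : C j} (g : y ⟶ y')
    {a b c d : Obj C} (s : IsSquare i j x x' y y' a b c d) :
    oneCell g s.ac ≫ oneCell f s.cd ⟶ oneCell f s.ab ≫ oneCell g s.bd :=
  Presented.mk (Rel₂ C) (swap hij f g s)

end MultiGray

/-! ### Heterogeneous equality of cells and extensionality of strict pseudofunctors -/

namespace CategoryTheory.StrictPseudofunctor

variable {B C : Type u} [Bicategory.{u, u} B] [Bicategory.{u, u} C]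

/-! A strict 2-functor out of a presented 2-category amounts to values of the generators that
satisfy the relations; for `multiGray C` such a family of values is a `MultiData C E`
(`MultiData.lift`, `MultiData.ofFunctor`). The theorem follows by induction once the last factor can
be split off, that is, once `multiGray C` is identified with the tensor product of `multiGray
(initFam C)` and `C (Fin.last n)`.

The splitting rests on the closed structure of the lax Gray tensor product. A strict 2-functor `B →
oplaxHom D E` whose values are strict 2-functors `D → E` gives a strict 2-functor `gray B D → E`
(`Gray.uncurry`): 1-cells of `B` go to oplax transformations, whose naturality 2-cells are the
values of γ, and 2-cells of `B` go to modifications. On the side of the presentation,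
`MultiData.curry` turns a family for all factors into a family for all factors but the last with
values in such a 2-category. The swaps with the last position become naturality 2-cells, and the
Yang–Baxter equation with `k` the last position says exactly that γ^{i,j} is a modification.

In the other direction `MultiData.split` turns a family in `B` for all factors but the last into a
family for all factors in `gray B D`. There the Yang–Baxter equation at the last position is no
defining relation; it is the naturality of γ_{–,h} at the 2-cell γ^{i,j}_{f,g}, written out with the
rule for γ of a composite (`Gray.swap_yangBaxter`).

Given mutually inverse `F` and `G` for all factors but the last, the new 2-functor is `(ofFunctor
F).split.lift`. Its inverse is the uncurrying of `G` followed by the curried tautological family of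
`multiGray C`. One composite is computed on the generators of `multiGray C` (`split_comp_uncurry`).
For the other (`uncurry_comp_split`) the generators of `gray B D` involve arbitrary cells of `B`.
These are images under `F` because `G.comp F` is the identity, and γ_{f,g} for composite `f` is
reduced to generating 1-cells by `Gray.map₂_swap_comp_heq`.

A tuple and its reassembly from initial part and last entry are equal only propositionally, so
1-cells and 2-cells are compared by `HEq`. All coherence cells are `eqToHom`s, which `HEq` does not
see. -/

theorem ext_of_heq {S T : StrictPseudofunctor B C} (hobj : ∀ a, S.obj a = T.obj a)
    (hmap : ∀ {a b : B} (f : a ⟶ b), HEq (S.map f) (T.map f))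
    (hmap₂ : ∀ {a b : B} {f g : a ⟶ b} (η : f ⟶ g), HEq (S.map₂ η) (T.map₂ η)) : S = T := by
  obtain ⟨⟨⟨⟨⟨⟨objS, mapS⟩, map₂S⟩, _, _⟩, mapIdS, mapCompS, _, _, _, _, _⟩, idS, hidS⟩,
    compS, hcompS⟩ := S
  obtain ⟨⟨⟨⟨⟨⟨objT, mapT⟩, map₂T⟩, _, _⟩, mapIdT, mapCompT, _, _, _, _, _⟩, idT, hidT⟩,
    compT, hcompT⟩ := T
  obtain rfl : objS = objT := funext hobj
  obtain rfl : @mapS = @mapT := by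
    funext a b f
    exact eq_of_heq (hmap f)
  obtain rfl : @map₂S = @map₂T := by
    funext a b f g η
    exact eq_of_heq (hmap₂ η)
  -- The unit and composition isomorphisms are no extra data: strictness fixes them as `eqToIso`s.
  obtain rfl : mapIdS = mapIdT := by
    funext a
    exact (hidS a).trans (hidT a).symm
  obtain rfl : @mapCompS = @mapCompT := by
    funext a b c f g
    exact (hcompS f g).trans (hcompT f g).symm
  rfl

protected theorem id_comp (S : StrictPseudofunctor B C) :
    (StrictPseudofunctor.id B).comp S = S :=
  ext_of_heq (fun _ => rfl) (fun _ => .rfl) (fun _ => .rfl)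

protected theorem comp_assoc {D E : Type u} [Bicategory.{u, u} D] [Bicategory.{u, u} E]
    (S : StrictPseudofunctor B C) (T : StrictPseudofunctor C D) (U : StrictPseudofunctor D E) :
    (S.comp T).comp U = S.comp (T.comp U) :=
  ext_of_heq (fun _ => rfl) (fun _ => .rfl) (fun _ => .rfl)

variable (S : StrictPseudofunctor B C)

theorem map₂_whiskerLeft {a b c : B} (f : a ⟶ b) {g h : b ⟶ c} (η : g ⟶ h) :
    S.map₂ (f ◁ η) = eqToHom (S.map_comp f g) ≫ S.map f ◁ S.map₂ η ≫
      eqToHom (S.map_comp f h).symm := by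
  rw [S.map₂_whisker_left, S.mapComp_eq_eqToIso, S.mapComp_eq_eqToIso]; rfl

theorem map₂_whiskerRight {a b c : B} {f g : a ⟶ b} (η : f ⟶ g) (h : b ⟶ c) :
    S.map₂ (η ▷ h) = eqToHom (S.map_comp f h) ≫ S.map₂ η ▷ S.map h ≫
      eqToHom (S.map_comp g h).symm := by
  rw [S.map₂_whisker_right, S.mapComp_eq_eqToIso, S.mapComp_eq_eqToIso]; rfl

theorem map₂_eqToHom {a b : B} {f g : a ⟶ b} (h : f = g) :
    S.map₂ (eqToHom h) = eqToHom (congrArg S.map h) := by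
  subst h; exact S.map₂_id _

theorem map_heq {a b a' b' : B} {f : a ⟶ b} {f' : a' ⟶ b'} (ha : a = a') (hb : b = b')
    (h : HEq f f') : HEq (S.map f) (S.map f') := by
  subst ha hb; cases h; rfl

theorem map₂_heq {a b a' b' : B} {f g : a ⟶ b} {f' g' : a' ⟶ b'} {η : f ⟶ g} {η' : f' ⟶ g'}
    (ha : a = a') (hb : b = b') (hf : HEq f f') (hg : HEq g g') (h : HEq η η') :
    HEq (S.map₂ η) (S.map₂ η') := by
  subst ha hb; cases hf; cases hg; cases h; rfl

end CategoryTheory.StrictPseudofunctor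

namespace CategoryTheory.Bicategory

variable {B : Type u} [Bicategory.{u, u} B]

theorem id_heq {a a' : B} (h : a = a') : HEq (𝟙 a) (𝟙 a') := by
  subst h; rfl

theorem comp_heq {a b c a' b' c' : B} {f : a ⟶ b} {g : b ⟶ c} {f' : a' ⟶ b'} {g' : b' ⟶ c'}
    (ha : a = a') (hb : b = b') (hc : c = c') (hf : HEq f f') (hg : HEq g g') :
    HEq (f ≫ g) (f' ≫ g') := by
  subst ha hb hc; cases hf; cases hg; rfl

theorem comp₂_heq {a b a' b' : B} {f g h : a ⟶ b} {f' g' h' : a' ⟶ b'} {η : f ⟶ g} {θ : g ⟶ h}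
    {η' : f' ⟶ g'} {θ' : g' ⟶ h'} (ha : a = a') (hb : b = b') (hf : HEq f f') (hg : HEq g g')
    (hh : HEq h h') (hη : HEq η η') (hθ : HEq θ θ') : HEq (η ≫ θ) (η' ≫ θ') := by
  subst ha hb; cases hf; cases hg; cases hh; cases hη; cases hθ; rfl

theorem whiskerLeft_heq {a b c a' b' c' : B} {f : a ⟶ b} {g h : b ⟶ c} {f' : a' ⟶ b'}
    {g' h' : b' ⟶ c'} {η : g ⟶ h} {η' : g' ⟶ h'} (ha : a = a') (hb : b = b') (hc : c = c')
    (hf : HEq f f') (hg : HEq g g') (hh : HEq h h') (hη : HEq η η') :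
    HEq (f ◁ η) (f' ◁ η') := by
  subst ha hb hc; cases hf; cases hg; cases hh; cases hη; rfl

theorem whiskerRight_heq {a b c a' b' c' : B} {f g : a ⟶ b} {h : b ⟶ c} {f' g' : a' ⟶ b'}
    {h' : b' ⟶ c'} {η : f ⟶ g} {η' : f' ⟶ g'} (ha : a = a') (hb : b = b') (hc : c = c')
    (hf : HEq f f') (hg : HEq g g') (hh : HEq h h') (hη : HEq η η') :
    HEq (η ▷ h) (η' ▷ h') := by
  subst ha hb hc; cases hf; cases hg; cases hh; cases hη; rfl

theorem eqToHom_heq {a b a' b' : B} {f g : a ⟶ b} {f' g' : a' ⟶ b'} (ha : a = a') (hb : b = b')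
    (hf : HEq f f') (h : f = g) (h' : f' = g') : HEq (eqToHom h) (eqToHom h') := by
  subst ha hb h h'; cases hf; rfl

/-- Discards coherence cells wherever a comparison up to `HEq` is enough. -/
theorem eqToHom_comp_eqToHom_heq {a b : B} {f f' g g' : a ⟶ b} (p : f' = f) (η : f ⟶ g)
    (q : g = g') : HEq (eqToHom p ≫ η ≫ eqToHom q) η := by
  subst p q; simp

end CategoryTheory.Bicategory

namespace CategoryTheory.StrictPseudofunctor

variable {B C : Type u} [Bicategory.{u, u} B] [Bicategory.{u, u} C] {S T : StrictPseudofunctor B C}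

/-- With the next three lemmas: once `S` and `T` agree on 0-cells and 1-cells, the 2-cells on which
they agree contain the coherence cells and are closed under vertical composition and whiskering. -/
theorem map₂_eqToHom_heq (hobj : ∀ a, S.obj a = T.obj a)
    (hmap : ∀ {a b : B} (f : a ⟶ b), HEq (S.map f) (T.map f)) {a b : B} {f g : a ⟶ b}
    (h : f = g) : HEq (S.map₂ (eqToHom h)) (T.map₂ (eqToHom h)) := by
  rw [S.map₂_eqToHom, T.map₂_eqToHom]
  exact eqToHom_heq (hobj a) (hobj b) (hmap f) _ _

theorem map₂_comp_heq (hobj : ∀ a, S.obj a = T.obj a)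
    (hmap : ∀ {a b : B} (f : a ⟶ b), HEq (S.map f) (T.map f)) {a b : B} {f g h : a ⟶ b}
    {η : f ⟶ g} {θ : g ⟶ h} (hη : HEq (S.map₂ η) (T.map₂ η)) (hθ : HEq (S.map₂ θ) (T.map₂ θ)) :
    HEq (S.map₂ (η ≫ θ)) (T.map₂ (η ≫ θ)) := by
  rw [S.map₂_comp, T.map₂_comp]
  exact comp₂_heq (hobj a) (hobj b) (hmap f) (hmap g) (hmap h) hη hθ

theorem map₂_whiskerLeft_heq (hobj : ∀ a, S.obj a = T.obj a)
    (hmap : ∀ {a b : B} (f : a ⟶ b), HEq (S.map f) (T.map f)) {a b c : B} (f : a ⟶ b)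
    {g h : b ⟶ c} {η : g ⟶ h} (hη : HEq (S.map₂ η) (T.map₂ η)) :
    HEq (S.map₂ (f ◁ η)) (T.map₂ (f ◁ η)) := by
  rw [S.map₂_whiskerLeft, T.map₂_whiskerLeft]
  refine (eqToHom_comp_eqToHom_heq _ _ _).trans (HEq.trans ?_ (eqToHom_comp_eqToHom_heq _ _ _).symm)
  exact whiskerLeft_heq (hobj a) (hobj b) (hobj c) (hmap f) (hmap g) (hmap h) hη

theorem map₂_whiskerRight_heq (hobj : ∀ a, S.obj a = T.obj a)
    (hmap : ∀ {a b : B} (f : a ⟶ b), HEq (S.map f) (T.map f)) {a b c : B} {f g : a ⟶ b}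
    {η : f ⟶ g} (hη : HEq (S.map₂ η) (T.map₂ η)) (h : b ⟶ c) :
    HEq (S.map₂ (η ▷ h)) (T.map₂ (η ▷ h)) := by
  rw [S.map₂_whiskerRight, T.map₂_whiskerRight]
  refine (eqToHom_comp_eqToHom_heq _ _ _).trans (HEq.trans ?_ (eqToHom_comp_eqToHom_heq _ _ _).symm)
  exact whiskerRight_heq (hobj a) (hobj b) (hobj c) (hmap f) (hmap g) (hmap h) hη

theorem map₂_conj_heq (S : StrictPseudofunctor B C) {a b : B} {f f' g g' : a ⟶ b}
    (p : f' = f) (η : f ⟶ g) (q : g = g') :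
    HEq (S.map₂ (eqToHom p ≫ η ≫ eqToHom q)) (S.map₂ η) := by
  subst p q; simp

end CategoryTheory.StrictPseudofunctor

/-! ### Functors out of presented 2-categories -/

namespace Presented

variable {K : Type u} [Category.{u} K] {G : ∀ ⦃a b : K⦄, (a ⟶ b) → (a ⟶ b) → Type u}
  (R : ∀ ⦃a b : K⦄ ⦃f g : a ⟶ b⦄, Cell G f g → Cell G f g → Prop)

/-- The presented 2-category, whose 1-cells are not unfolded to the morphisms of `K`. -/
def pres : TwoCat.{u} := twoCat R

/-- An object of `K` as a 0-cell of the presented 2-category. -/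
def of (a : K) : pres R := a

/-- A morphism of `K` as a 1-cell of the presented 2-category. -/
def of₁ {a b : K} (f : a ⟶ b) : of R a ⟶ of R b := f

/-- The 2-cell of the presented 2-category given by a formal 2-cell. -/
def cell {a b : K} {f g : a ⟶ b} (s : Cell G f g) : of₁ R f ⟶ of₁ R g := mk R s

theorem cell_eqTo {a b : K} {f g : a ⟶ b} (h : f = g) :
    cell R (.eqTo h) = eqToHom (congrArg (of₁ R) h) := by
  subst h; rfl

theorem cell_vcomp {a b : K} {f g h : a ⟶ b} (s : Cell G f g) (t : Cell G g h) :
    cell R (.vcomp s t) = cell R s ≫ cell R t := rfl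

theorem cell_whiskerLeft {a b c : K} (f : a ⟶ b) {g h : b ⟶ c} (s : Cell G g h) :
    cell R (.whiskerLeft f s) = of₁ R f ◁ cell R s := rfl

theorem cell_whiskerRight {a b c : K} {f g : a ⟶ b} (s : Cell G f g) (h : b ⟶ c) :
    cell R (.whiskerRight s h) = cell R s ▷ of₁ R h := rfl

variable {E : TwoCat.{u}} (φ : K ⥤ E)
  (γ : ∀ ⦃a b : K⦄ ⦃f g : a ⟶ b⦄, G f g → (φ.map f ⟶ φ.map g))

/-- The value of a formal 2-cell in a strict 2-category, given the values of the 1-cells and of the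
generating 2-cells. -/
def Cell.eval : ∀ {a b : K} {f g : a ⟶ b}, Cell G f g → (φ.map f ⟶ φ.map g)
  | _, _, _, _, .gen s => γ s
  | _, _, _, _, .eqTo h => eqToHom (congrArg φ.map h)
  | _, _, _, _, .vcomp s t => s.eval ≫ t.eval
  | _, _, _, _, .whiskerLeft f s =>
      eqToHom (φ.map_comp _ _) ≫ φ.map f ◁ s.eval ≫ eqToHom (φ.map_comp _ _).symm
  | _, _, _, _, .whiskerRight s h =>
      eqToHom (φ.map_comp _ _) ≫ s.eval ▷ φ.map h ≫ eqToHom (φ.map_comp _ _).symm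

variable {R φ γ} in
-- Apart from `R`, every generator of the congruence is an axiom of strict 2-categories, and it
-- holds in `E` because the unitors and associators of `E` are `eqToHom`s.
theorem eval_eq_of_cong
    (hR : ∀ {a b : K} {f g : a ⟶ b} {s t : Cell G f g}, R s t → s.eval φ γ = t.eval φ γ)
    {a b : K} {f g : a ⟶ b} {s t : Cell G f g} (h : Cong R s t) : s.eval φ γ = t.eval φ γ := by
  induction h with
  | of h => exact hR h
  | refl => rfl
  | symm _ ih => exact ih.symm
  | trans _ _ ih ih' => exact ih.trans ih'
  | vcomp _ _ ih ih' => simp only [Cell.eval, ih, ih']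
  | whiskerLeft _ _ ih => simp only [Cell.eval, ih]
  | whiskerRight _ _ ih => simp only [Cell.eval, ih]
  | id_vcomp => simp [Cell.eval]
  | vcomp_id => simp [Cell.eval]
  | vcomp_assoc => simp [Cell.eval]
  | whiskerLeft_id => simp [Cell.eval]
  | whiskerLeft_comp => simp [Cell.eval]
  | id_whiskerRight => simp [Cell.eval]
  | comp_whiskerRight => simp [Cell.eval]
  | id_whiskerLeft s =>
    simp [Cell.eval, Strict.leftUnitor_eqToIso, congr_whiskerLeft (φ.map_id _)]
  | comp_whiskerLeft f g s =>
    simp [Cell.eval, Strict.associator_eqToIso, congr_whiskerLeft (φ.map_comp f g)]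
  | whiskerRight_id s =>
    simp [Cell.eval, Strict.rightUnitor_eqToIso, whiskerRight_congr (φ.map_id _)]
  | whiskerRight_comp s h k =>
    simp [Cell.eval, Strict.associator_eqToIso, whiskerRight_congr (φ.map_comp h k)]
  | whisker_assoc => simp [Cell.eval, Strict.associator_eqToIso]
  | whisker_exchange => simp [Cell.eval, whisker_exchange_assoc]

variable {R φ γ} in
/-- The strict 2-functor out of a presented 2-category given by the values of the generators. -/
def lift (hR : ∀ {a b : K} {f g : a ⟶ b} {s t : Cell G f g}, R s t → s.eval φ γ = t.eval φ γ) :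
    StrictPseudofunctor (pres R) E :=
  StrictPseudofunctor.mk''
  { obj := φ.obj
    map := φ.map
    map₂ := Quot.lift (fun s => s.eval φ γ) (fun _ _ h => eval_eq_of_cong hR h)
    map₂_id := fun _ => rfl
    map₂_comp := by
      rintro a b f g h ⟨s⟩ ⟨t⟩
      rfl
    map_id := φ.map_id
    map_comp := φ.map_comp
    map₂_whisker_left := by
      rintro a b c f g h ⟨s⟩
      rfl
    map₂_whisker_right := by
      rintro a b c f g ⟨s⟩ h
      rfl }

/-- A strict 2-functor out of a presented 2-category, on 1-cells. -/
def restrict (S : StrictPseudofunctor (pres R) E) : K ⥤ E where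
  obj a := S.obj (of R a)
  map f := S.map (of₁ R f)
  map_id a := S.map_id (of R a)
  map_comp f g := S.map_comp (of₁ R f) (of₁ R g)

/-- The uniqueness half of the universal property: a strict 2-functor is determined on 2-cells by
its 1-cell part and its values at the generators. -/
theorem map₂_cell (S : StrictPseudofunctor (pres R) E) {a b : K} {f g : a ⟶ b} (s : Cell G f g) :
    S.map₂ (cell R s) = s.eval (restrict R S) (fun _ _ _ _ s => S.map₂ (cell R (.gen s))) := by
  induction s with
  | gen s => rfl
  | eqTo h => rw [cell_eqTo, S.map₂_eqToHom]; rfl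
  | vcomp s t ihs iht => rw [cell_vcomp, S.map₂_comp, ihs, iht]; rfl
  | whiskerLeft f s ih =>
    simp only [Cell.eval]
    rw [cell_whiskerLeft, ← ih]
    exact S.map₂_whiskerLeft _ _
  | whiskerRight s h ih =>
    simp only [Cell.eval]
    rw [cell_whiskerRight, ← ih]
    exact S.map₂_whiskerRight _ _

variable {R} in
-- Turns each constructor of `R` into an equation between 2-cells of `E`, since related formal cells
-- are already equal in `pres R`.
theorem eval_restrict (S : StrictPseudofunctor (pres R) E) {a b : K} {f g : a ⟶ b}
    {s t : Cell G f g} (h : R s t) :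
    s.eval (restrict R S) (fun _ _ _ _ s => S.map₂ (cell R (.gen s))) =
      t.eval (restrict R S) (fun _ _ _ _ s => S.map₂ (cell R (.gen s))) := by
  rw [← map₂_cell, ← map₂_cell]
  exact congrArg S.map₂ (sound (.of h))

theorem Cell.eval_heq {φ φ' : K ⥤ E} {γ : ∀ ⦃a b : K⦄ ⦃f g : a ⟶ b⦄, G f g → (φ.map f ⟶ φ.map g)}
    {γ' : ∀ ⦃a b : K⦄ ⦃f g : a ⟶ b⦄, G f g → (φ'.map f ⟶ φ'.map g)} (hφ : φ = φ')
    (hγ : ∀ ⦃a b : K⦄ ⦃f g : a ⟶ b⦄ (s : G f g), HEq (γ s) (γ' s)) {a b : K} {f g : a ⟶ b}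
    (s : Cell G f g) : HEq (s.eval φ γ) (s.eval φ' γ') := by
  subst hφ
  obtain rfl : @γ = @γ' := by
    funext a b f g s
    exact eq_of_heq (hγ s)
  rfl

variable {R} in
theorem hom_ext {S T : StrictPseudofunctor (pres R) E} (hobj : ∀ a, S.obj (of R a) = T.obj (of R a))
    (hmap : ∀ {a b : K} (f : a ⟶ b), HEq (S.map (of₁ R f)) (T.map (of₁ R f)))
    (hgen : ∀ {a b : K} {f g : a ⟶ b} (s : G f g),
      HEq (S.map₂ (cell R (.gen s))) (T.map₂ (cell R (.gen s)))) : S = T := by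
  refine StrictPseudofunctor.ext_of_heq hobj hmap ?_
  rintro a b f g ⟨s⟩
  refine (heq_of_eq (map₂_cell R S s)).trans (HEq.trans ?_ (heq_of_eq (map₂_cell R T s)).symm)
  exact Cell.eval_heq (Functor.hext hobj fun _ _ f => hmap f) (fun _ _ _ _ s => hgen s) s

end Presented

/-! ### Functors out of categories presented by generators and relations -/

namespace PresentedCat

variable {V : Type u} [Quiver.{u} V] (r : HomRel (Paths V)) {E : Type u} [Category.{u} E]

/-- The composite of `x`, the value of the path `p`, with `m`; it is `m` if `p` has length zero. -/
def pathStep (φ : V ⥤q E) : ∀ {a b : V} {c : E}, Quiver.Path a b →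
    (φ.obj a ⟶ φ.obj b) → (φ.obj b ⟶ c) → (φ.obj a ⟶ c)
  | _, _, _, .nil, _, m => m
  | _, _, _, .cons _ _, x, m => x ≫ m

/-- The composite of the values of the arrows of a path. The value of a path of length one is the
value of its arrow, by definition. -/
def pathMap (φ : V ⥤q E) {a : V} : ∀ {b : V}, Quiver.Path a b → (φ.obj a ⟶ φ.obj b)
  | _, .nil => 𝟙 _
  | _, .cons p e => pathStep φ p (pathMap φ p) (φ.map e)

/-- The value of a one-arrow path omits the factor `𝟙 _`, so the case of length zero is `id_comp`
and not definitional. -/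
theorem pathMap_cons (φ : V ⥤q E) {a b c : V} (p : Quiver.Path a b) (e : b ⟶ c) :
    pathMap φ (p.cons e) = pathMap φ p ≫ φ.map e := by
  cases p with
  | nil => exact (Category.id_comp (φ.map e)).symm
  | cons p e' => rfl

theorem pathMap_comp (φ : V ⥤q E) {a b c : V} (p : Quiver.Path a b) (q : Quiver.Path b c) :
    pathMap φ (p.comp q) = pathMap φ p ≫ pathMap φ q := by
  induction q with
  | nil => exact (Category.comp_id (pathMap φ p)).symm
  | cons q e ih => rw [Quiver.Path.comp_cons, pathMap_cons, pathMap_cons, ih, Category.assoc]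

/-- The functor on the path category that extends a morphism of quivers. -/
def pathFunctor (φ : V ⥤q E) : Paths V ⥤ E where
  obj := φ.obj
  map p := pathMap φ p
  map_id _ := rfl
  map_comp p q := pathMap_comp φ p q

/-- The functor on a presented category given by the values of the generators. -/
def lift (φ : V ⥤q E)
    (h : ∀ a b : Paths V, ∀ f g : a ⟶ b, r f g → (pathFunctor φ).map f = (pathFunctor φ).map g) :
    Quotient r ⥤ E :=
  CategoryTheory.Quotient.lift r (pathFunctor φ) h

/-- The generating morphism given by an arrow. -/
abbrev gen {a b : V} (e : a ⟶ b) :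
    (⟨(Paths.of V).obj a⟩ : CategoryTheory.Quotient r) ⟶ ⟨(Paths.of V).obj b⟩ :=
  (CategoryTheory.Quotient.functor r).map ((Paths.of V).map e)

variable {r} in
theorem induction {P : ∀ {a b : CategoryTheory.Quotient r}, (a ⟶ b) → Prop}
    (id : ∀ a, P (𝟙 a))
    (comp : ∀ {a b c : CategoryTheory.Quotient r} (f : a ⟶ b) (g : b ⟶ c), P f → P g → P (f ≫ g))
    (gen : ∀ {a b : V} (e : a ⟶ b), P (gen r e)) :
    ∀ {a b : CategoryTheory.Quotient r} (f : a ⟶ b), P f := by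
  suffices h : ∀ {a b : V} (p : Quiver.Path a b),
      P ((CategoryTheory.Quotient.functor r).map (X := a) (Y := b) p) by
    rintro ⟨a⟩ ⟨b⟩ ⟨p⟩
    exact h p
  intro a b p
  induction p with
  | nil => exact id _
  | cons p e ih => exact comp _ (PresentedCat.gen r e) ih (gen e)

end PresentedCat

/-! ### The 2-category of oplax functors, oplax transformations and modifications -/

section OplaxFunctors

open scoped Oplax.OplaxTrans Oplax.OplaxTrans.OplaxFunctor

namespace OplaxHom

variable (D E : TwoCat.{u})

theorem trans_ext {F G : OplaxFunctor D E} {η θ : F ⟶ G} (happ : ∀ a, η.app a = θ.app a)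
    (hnat : ∀ {a b : D} (f : a ⟶ b), HEq (η.naturality f) (θ.naturality f)) : η = θ := by
  obtain ⟨app, nat, _, _, _⟩ := η
  obtain ⟨app', nat', _, _, _⟩ := θ
  obtain rfl : app = app' := funext happ
  obtain rfl : @nat = @nat' := by
    funext a b f
    exact eq_of_heq (hnat f)
  rfl

theorem eqToHom_as_app {F G : OplaxFunctor D E} {η θ : F ⟶ G} (h : η = θ) (a : D) :
    (eqToHom h).as.app a = eqToHom (congrArg (fun η : F ⟶ G => η.app a) h) := by
  subst h; rfl

variable {D E} in
theorem id_naturality (F : OplaxFunctor D E) {a b : D} (f : a ⟶ b) :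
    Oplax.OplaxTrans.naturality (𝟙 F) f =
      eqToHom ((Strict.comp_id _).trans (Strict.id_comp _).symm) := by
  change (ρ_ _).hom ≫ (λ_ _).inv = _
  simp [Strict.leftUnitor_eqToIso, Strict.rightUnitor_eqToIso]

variable {D E} in
theorem comp_naturality {F G H : OplaxFunctor D E} (η : F ⟶ G) (θ : G ⟶ H) {a b : D}
    (f : a ⟶ b) :
    (η ≫ θ).naturality f = eqToHom (Strict.assoc _ _ _).symm ≫ η.naturality f ▷ θ.app b ≫
      eqToHom (Strict.assoc _ _ _) ≫ η.app a ◁ θ.naturality f ≫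
        eqToHom (Strict.assoc _ _ _).symm := by
  change (α_ _ _ _).inv ≫ _ ≫ (α_ _ _ _).hom ≫ _ ≫ (α_ _ _ _).inv = _
  simp [Strict.associator_eqToIso]

/-- This and the next two lemmas are the 2-cell parts of the unit and associativity laws for oplax
transformations. The equality proofs are free variables, so the lemmas apply to whatever proofs
occur in the composites. -/
theorem id_comp_naturality_heq {a b a' b' : E} {p : a ⟶ b} {q : a' ⟶ b'} {x : a ⟶ a'}
    {y : b ⟶ b'} (η : p ≫ y ⟶ x ≫ q) (h₁ : p ≫ 𝟙 b ≫ y = (p ≫ 𝟙 b) ≫ y) (h₂ : p ≫ 𝟙 b = 𝟙 a ≫ p)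
    (h₃ : (𝟙 a ≫ p) ≫ y = 𝟙 a ≫ p ≫ y) (h₄ : 𝟙 a ≫ x ≫ q = (𝟙 a ≫ x) ≫ q) :
    HEq (eqToHom h₁ ≫ eqToHom h₂ ▷ y ≫ eqToHom h₃ ≫ 𝟙 a ◁ η ≫ eqToHom h₄) η := by
  simp [Strict.leftUnitor_eqToIso]

theorem comp_id_naturality_heq {a b a' b' : E} {p : a ⟶ b} {q : a' ⟶ b'} {x : a ⟶ a'}
    {y : b ⟶ b'} (η : p ≫ y ⟶ x ≫ q) (h₁ : p ≫ y ≫ 𝟙 b' = (p ≫ y) ≫ 𝟙 b')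
    (h₂ : q ≫ 𝟙 b' = 𝟙 a' ≫ q)
    (h₃ : (x ≫ q) ≫ 𝟙 b' = x ≫ q ≫ 𝟙 b') (h₄ : x ≫ 𝟙 a' ≫ q = (x ≫ 𝟙 a') ≫ q) :
    HEq (eqToHom h₁ ≫ η ▷ 𝟙 b' ≫ eqToHom h₃ ≫ x ◁ eqToHom h₂ ≫ eqToHom h₄) η := by
  simp [Strict.rightUnitor_eqToIso]

theorem assoc_naturality_heq {a b a' b' a'' b'' a₃ b₃ : E} {p : a ⟶ b} {q : a' ⟶ b'}
    {r : a'' ⟶ b''} {s : a₃ ⟶ b₃} {x : a ⟶ a'} {y : b ⟶ b'} {x' : a' ⟶ a''} {y' : b' ⟶ b''}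
    {x'' : a'' ⟶ a₃} {y'' : b'' ⟶ b₃} (η : p ≫ y ⟶ x ≫ q) (θ : q ≫ y' ⟶ x' ≫ r)
    (ι : r ≫ y'' ⟶ x'' ≫ s) (h₁ : p ≫ (y ≫ y') ≫ y'' = (p ≫ y ≫ y') ≫ y'')
    (h₂ : p ≫ y ≫ y' = (p ≫ y) ≫ y') (h₃ : (x ≫ q) ≫ y' = x ≫ q ≫ y')
    (h₄ : x ≫ x' ≫ r = (x ≫ x') ≫ r) (h₅ : ((x ≫ x') ≫ r) ≫ y'' = (x ≫ x') ≫ r ≫ y'')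
    (h₆ : (x ≫ x') ≫ x'' ≫ s = ((x ≫ x') ≫ x'') ≫ s)
    (k₁ : p ≫ y ≫ y' ≫ y'' = (p ≫ y) ≫ y' ≫ y'') (k₂ : (x ≫ q) ≫ y' ≫ y'' = x ≫ q ≫ y' ≫ y'')
    (k₃ : q ≫ y' ≫ y'' = (q ≫ y') ≫ y'') (k₄ : (x' ≫ r) ≫ y'' = x' ≫ r ≫ y'')
    (k₅ : x' ≫ x'' ≫ s = (x' ≫ x'') ≫ s) (k₆ : x ≫ (x' ≫ x'') ≫ s = (x ≫ x' ≫ x'') ≫ s) :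
    HEq (eqToHom h₁ ≫ (eqToHom h₂ ≫ η ▷ y' ≫ eqToHom h₃ ≫ x ◁ θ ≫ eqToHom h₄) ▷ y'' ≫
        eqToHom h₅ ≫ (x ≫ x') ◁ ι ≫ eqToHom h₆)
      (eqToHom k₁ ≫ η ▷ (y' ≫ y'') ≫ eqToHom k₂ ≫
        x ◁ (eqToHom k₃ ≫ θ ▷ y'' ≫ eqToHom k₄ ≫ x' ◁ ι ≫ eqToHom k₅) ≫ eqToHom k₆) := by
  simp only [Strict.associator_eqToIso, eqToIso.hom, eqToIso.inv, comp_whiskerRight,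
    eqToHom_whiskerRight, whiskerLeft_comp, whiskerLeft_eqToHom, comp_whiskerLeft,
    whiskerRight_comp, whisker_assoc, Category.assoc, eqToHom_trans, eqToHom_trans_assoc,
    eqToHom_comp_heq_iff, heq_eqToHom_comp_iff]
  simp only [← Category.assoc, comp_eqToHom_heq_iff, heq_comp_eqToHom_iff]
  rfl

/-- Transformations are composed by composing their components in `E`, so the strictness of `E` is
inherited. -/
instance : Bicategory.Strict (OplaxFunctor D E) where
  id_comp η := trans_ext D E (fun a => Strict.id_comp _) fun f => by
    rw [comp_naturality, id_naturality]
    exact id_comp_naturality_heq E _ _ _ _ _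
  comp_id η := trans_ext D E (fun a => Strict.comp_id _) fun f => by
    rw [comp_naturality, id_naturality]
    exact comp_id_naturality_heq E _ _ _ _ _
  assoc η θ ι := trans_ext D E (fun a => Strict.assoc _ _ _) fun f => by
    simp only [comp_naturality]
    exact assoc_naturality_heq E _ _ _ _ _ _ _ _ _ _ _ _ _ _ _
  leftUnitor_eqToIso η := by
    ext a
    simp [eqToHom_as_app, Strict.leftUnitor_eqToIso]
    rfl
  rightUnitor_eqToIso η := by
    ext a
    simp [eqToHom_as_app, Strict.rightUnitor_eqToIso]
    rfl
  associator_eqToIso η θ ι := by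
    ext a
    simp [eqToHom_as_app, Strict.associator_eqToIso]
    rfl

end OplaxHom

/-- The strict 2-category of oplax functors, oplax transformations and modifications. -/
def oplaxHom (D E : TwoCat.{u}) : TwoCat.{u} where
  carrier := OplaxFunctor D E

/-! ### Values of the formal 2-cells that occur in the relations -/

namespace Presented

section

variable {K : Type u} [Category.{u} K] {G : ∀ ⦃a b : K⦄, (a ⟶ b) → (a ⟶ b) → Type u}
  {E : TwoCat.{u}} (φ : K ⥤ E) (γ : ∀ ⦃a b : K⦄ ⦃f g : a ⟶ b⦄, G f g → (φ.map f ⟶ φ.map g))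

/-- The formulas of this section move the coherence cells of `φ` to where the relations of
`MultiData` and of the lax Gray tensor product have theirs. Each shape serves both presentations. -/
theorem Cell.eval_hcomp {a b c : K} {f g : a ⟶ b} {h k : b ⟶ c} (s : Cell G f g) (t : Cell G h k) :
    (s.hcomp t).eval φ γ = eqToHom (φ.map_comp f h) ≫
      (s.eval φ γ ▷ φ.map h ≫ φ.map g ◁ t.eval φ γ) ≫ eqToHom (φ.map_comp g k).symm := by
  simp [Cell.hcomp, Cell.eval]

theorem Cell.eval_conj_hcomp {a b c : K} {f g : a ⟶ b} {h k : b ⟶ c} {l m : a ⟶ c}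
    (s : Cell G f g) (t : Cell G h k) (p : l = f ≫ h) (q : g ≫ k = m) :
    (Cell.vcomp (.eqTo p) (.vcomp (s.hcomp t) (.eqTo q))).eval φ γ =
      eqToHom (by rw [p, φ.map_comp]) ≫ (s.eval φ γ ▷ φ.map h ≫ φ.map g ◁ t.eval φ γ) ≫
        eqToHom (by rw [← q, φ.map_comp]) := by
  simp [Cell.hcomp, Cell.eval]

theorem Cell.eval_comp_left {a b c d e k : K} {r : a ⟶ b} {l : b ⟶ c} {l' : a ⟶ d} {r' : d ⟶ c}
    {l₂ : c ⟶ e} {l₂' : d ⟶ k} {r₂ : k ⟶ e} {p q : a ⟶ e} (s : Cell G (r ≫ l) (l' ≫ r'))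
    (t : Cell G (r' ≫ l₂) (l₂' ≫ r₂)) (hp : p = (r ≫ l) ≫ l₂) (hq : l' ≫ l₂' ≫ r₂ = q) :
    (Cell.vcomp (.eqTo hp) (.vcomp (.whiskerRight s l₂) (.vcomp (.eqTo (Category.assoc _ _ _))
      (.vcomp (.whiskerLeft l' t) (.eqTo hq))))).eval φ γ =
      eqToHom (by rw [hp, φ.map_comp]) ≫ s.eval φ γ ▷ φ.map l₂ ≫
        eqToHom (by simp) ≫ φ.map l' ◁ t.eval φ γ ≫
          eqToHom (by rw [← hq, φ.map_comp l' (l₂' ≫ r₂)]) := by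
  simp [Cell.eval]

theorem Cell.eval_comp_right {a b c d e k : K} {r : a ⟶ b} {r₂ : b ⟶ c} {l : c ⟶ d}
    {p q : a ⟶ d} {m : b ⟶ k} {n : k ⟶ d} {m' : a ⟶ e} {n' : e ⟶ k}
    (t : Cell G (r₂ ≫ l) (m ≫ n)) (s : Cell G (r ≫ m) (m' ≫ n'))
    (hp : p = r ≫ r₂ ≫ l) (hq : (m' ≫ n') ≫ n = q) :
    (Cell.vcomp (.eqTo hp) (.vcomp (.whiskerLeft r t) (.vcomp (.eqTo (Category.assoc _ _ _).symm)
      (.vcomp (.whiskerRight s n) (.eqTo hq))))).eval φ γ =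
      eqToHom (by rw [hp, φ.map_comp]) ≫ φ.map r ◁ t.eval φ γ ≫
        eqToHom (by simp) ≫ s.eval φ γ ▷ φ.map n ≫
          eqToHom (by rw [← hq, φ.map_comp (m' ≫ n') n]) := by
  simp [Cell.eval]

theorem Cell.eval_yangBaxter_left {a₀ a₁ a₂ a₃ a₄ a₅ a₆ : K} {f₁ : a₀ ⟶ a₁} {f₂ : a₁ ⟶ a₂}
    {f₃ : a₂ ⟶ a₃} {g₁ : a₀ ⟶ a₄} {g₂ : a₄ ⟶ a₂} {h₂ : a₄ ⟶ a₅} {h₃ : a₅ ⟶ a₃} {k₁ : a₀ ⟶ a₆}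
    {k₂ : a₆ ⟶ a₅} (s : Cell G (f₁ ≫ f₂) (g₁ ≫ g₂)) (t : Cell G (g₂ ≫ f₃) (h₂ ≫ h₃))
    (r : Cell G (g₁ ≫ h₂) (k₁ ≫ k₂)) :
    (Cell.vcomp (.whiskerRight s f₃) (.vcomp (.eqTo (Category.assoc _ _ _))
      (.vcomp (.whiskerLeft g₁ t) (.vcomp (.eqTo (Category.assoc _ _ _).symm)
        (.whiskerRight r h₃))))).eval φ γ =
      eqToHom (φ.map_comp _ _) ≫ (s.eval φ γ ▷ φ.map f₃ ≫ eqToHom (by simp) ≫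
        φ.map g₁ ◁ t.eval φ γ ≫ eqToHom (by simp) ≫ r.eval φ γ ▷ φ.map h₃) ≫
          eqToHom (φ.map_comp _ _).symm := by
  simp [Cell.eval]

theorem Cell.eval_yangBaxter_right {a₀ a₁ a₂ a₃ a₄ a₅ a₆ : K} {f₁ : a₀ ⟶ a₁} {f₂ : a₁ ⟶ a₂}
    {f₃ : a₂ ⟶ a₃} {g₂ : a₁ ⟶ a₄} {g₃ : a₄ ⟶ a₃} {h₁ : a₀ ⟶ a₅} {h₂ : a₅ ⟶ a₄} {k₂ : a₅ ⟶ a₆}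
    {k₃ : a₆ ⟶ a₃} (s : Cell G (f₂ ≫ f₃) (g₂ ≫ g₃)) (t : Cell G (f₁ ≫ g₂) (h₁ ≫ h₂))
    (r : Cell G (h₂ ≫ g₃) (k₂ ≫ k₃)) :
    (Cell.vcomp (.eqTo (Category.assoc _ _ _)) (.vcomp (.whiskerLeft f₁ s)
      (.vcomp (.eqTo (Category.assoc _ _ _).symm) (.vcomp (.whiskerRight t g₃)
        (.vcomp (.eqTo (Category.assoc _ _ _)) (.vcomp (.whiskerLeft h₁ r)
          (.eqTo (Category.assoc _ _ _).symm))))))).eval φ γ =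
      eqToHom (by simp) ≫ φ.map f₁ ◁ s.eval φ γ ≫ eqToHom (by simp) ≫
        t.eval φ γ ▷ φ.map g₃ ≫ eqToHom (by simp) ≫ φ.map h₁ ◁ r.eval φ γ ≫
          eqToHom (by simp) := by
  simp [Cell.eval]

end

end Presented

/-! ### Families of cells that satisfy the relations of the explicit presentation -/

/-- The values in a strict 2-category `E` of the generators of `multiGray C`, subject to its
relations. -/
structure MultiData {n : ℕ} (C : Fin n → TwoCat.{u}) (E : TwoCat.{u}) where
  obj : Multi.Obj C → E
  one {i : Fin n} {x y : C i} (f : x ⟶ y) {a b : Multi.Obj C} (h : Multi.IsStep i x y a b) :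
    obj a ⟶ obj b
  one_id {i : Fin n} {x : C i} {a : Multi.Obj C} (h : Multi.IsStep i x x a a) :
    one (𝟙 x) h = 𝟙 (obj a)
  one_comp {i : Fin n} {x y z : C i} (f : x ⟶ y) (g : y ⟶ z) {a b c : Multi.Obj C}
    (h : Multi.IsStep i x y a b) (h' : Multi.IsStep i y z b c) :
    one (f ≫ g) (h.trans h') = one f h ≫ one g h'
  two {i : Fin n} {x y : C i} {f g : x ⟶ y} (φ : f ⟶ g) {a b : Multi.Obj C}
    (h : Multi.IsStep i x y a b) : one f h ⟶ one g h
  two_id {i : Fin n} {x y : C i} (f : x ⟶ y) {a b : Multi.Obj C} (h : Multi.IsStep i x y a b) :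
    two (𝟙 f) h = 𝟙 (one f h)
  two_comp {i : Fin n} {x y : C i} {f g k : x ⟶ y} (φ : f ⟶ g) (ψ : g ⟶ k) {a b : Multi.Obj C}
    (h : Multi.IsStep i x y a b) : two (φ ≫ ψ) h = two φ h ≫ two ψ h
  two_hcomp {i : Fin n} {x y z : C i} {f f' : x ⟶ y} {g g' : y ⟶ z} (φ : f ⟶ f') (ψ : g ⟶ g')
    {a b c : Multi.Obj C} (h : Multi.IsStep i x y a b) (h' : Multi.IsStep i y z b c) :
    two (φ ▷ g ≫ f' ◁ ψ) (h.trans h') = eqToHom (one_comp f g h h') ≫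
      (two φ h ▷ one g h' ≫ one f' h ◁ two ψ h') ≫ eqToHom (one_comp f' g' h h').symm
  swap {i j : Fin n} (hij : i < j) {x x' : C i} (f : x ⟶ x') {y y' : C j} (g : y ⟶ y')
    {a b c d : Multi.Obj C} (s : Multi.IsSquare i j x x' y y' a b c d) :
    one g s.ac ≫ one f s.cd ⟶ one f s.ab ≫ one g s.bd
  swap_id_right {i j : Fin n} (hij : i < j) {x x' : C i} (f : x ⟶ x') {y : C j} {a b : Multi.Obj C}
    (s : Multi.IsSquare i j x x' y y a b a b) :
    swap hij f (𝟙 y) s = eqToHom (by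
      rw [one_id, one_id]; exact (Category.id_comp _).trans (Category.comp_id _).symm)
  swap_id_left {i j : Fin n} (hij : i < j) {x : C i} {y y' : C j} (g : y ⟶ y') {a c : Multi.Obj C}
    (s : Multi.IsSquare i j x x y y' a a c c) :
    swap hij (𝟙 x) g s = eqToHom (by
      rw [one_id, one_id]; exact (Category.comp_id _).trans (Category.id_comp _).symm)
  swap_comp_left {i j : Fin n} (hij : i < j) {x x' x'' : C i} (f : x ⟶ x') (f' : x' ⟶ x'')
    {y y' : C j} (g : y ⟶ y') {a b e c d k : Multi.Obj C}
    (s : Multi.IsSquare i j x x' y y' a b c d) (t : Multi.IsSquare i j x' x'' y y' b e d k) :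
    swap hij (f ≫ f') g ⟨s.ab.trans t.ab, s.ac, t.bd, s.cd.trans t.cd⟩ =
      eqToHom (by rw [one_comp _ _ s.cd t.cd]; exact (Category.assoc _ _ _).symm) ≫
        swap hij f g s ▷ one f' t.cd ≫ eqToHom (Category.assoc _ _ _) ≫
          one f s.ab ◁ swap hij f' g t ≫
            eqToHom (by rw [one_comp _ _ s.ab t.ab]; exact (Category.assoc _ _ _).symm)
  swap_comp_right {i j : Fin n} (hij : i < j) {x x' : C i} (f : x ⟶ x') {y y' y'' : C j}
    (g : y ⟶ y') (g' : y' ⟶ y'') {a b c d e k : Multi.Obj C}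
    (s : Multi.IsSquare i j x x' y y' a b c d) (t : Multi.IsSquare i j x x' y' y'' c d e k) :
    swap hij f (g ≫ g') ⟨s.ab, s.ac.trans t.ac, s.bd.trans t.bd, t.cd⟩ =
      eqToHom (by rw [one_comp _ _ s.ac t.ac]; exact Category.assoc _ _ _) ≫
        one g s.ac ◁ swap hij f g' t ≫ eqToHom (Category.assoc _ _ _).symm ≫
          swap hij f g s ▷ one g' t.bd ≫
            eqToHom (by rw [one_comp _ _ s.bd t.bd]; exact Category.assoc _ _ _)
  swap_naturality {i j : Fin n} (hij : i < j) {x x' : C i} {f f' : x ⟶ x'} (φ : f ⟶ f')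
    {y y' : C j} {g g' : y ⟶ y'} (ψ : g ⟶ g') {a b c d : Multi.Obj C}
    (s : Multi.IsSquare i j x x' y y' a b c d) :
    (two ψ s.ac ▷ one f s.cd ≫ one g' s.ac ◁ two φ s.cd) ≫ swap hij f' g' s =
      swap hij f g s ≫ two φ s.ab ▷ one g s.bd ≫ one f' s.ab ◁ two ψ s.bd
  yangBaxter {i j k : Fin n} (hij : i < j) (hjk : j < k) {x x' : C i} (f : x ⟶ x')
    {y y' : C j} (g : y ⟶ y') {z z' : C k} (h : z ⟶ z')
    {a₀₀₀ a₁₀₀ a₀₁₀ a₁₁₀ a₀₀₁ a₁₀₁ a₀₁₁ a₁₁₁ : Multi.Obj C}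
    (sij : Multi.IsSquare i j x x' y y' a₀₀₀ a₁₀₀ a₀₁₀ a₁₁₀)
    (sij' : Multi.IsSquare i j x x' y y' a₀₀₁ a₁₀₁ a₀₁₁ a₁₁₁)
    (sik : Multi.IsSquare i k x x' z z' a₀₀₀ a₁₀₀ a₀₀₁ a₁₀₁)
    (sik' : Multi.IsSquare i k x x' z z' a₀₁₀ a₁₁₀ a₀₁₁ a₁₁₁)
    (sjk : Multi.IsSquare j k y y' z z' a₀₀₀ a₀₁₀ a₀₀₁ a₀₁₁)
    (sjk' : Multi.IsSquare j k y y' z z' a₁₀₀ a₁₁₀ a₁₀₁ a₁₁₁) :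
    swap hjk g h sjk ▷ one f sij'.cd ≫ eqToHom (Category.assoc _ _ _) ≫
        one g sij.ac ◁ swap (hij.trans hjk) f h sik' ≫ eqToHom (Category.assoc _ _ _).symm ≫
          swap hij f g sij ▷ one h sjk'.bd =
      eqToHom (Category.assoc _ _ _) ≫ one h sik.ac ◁ swap hij f g sij' ≫
        eqToHom (Category.assoc _ _ _).symm ≫ swap (hij.trans hjk) f h sik ▷ one g sij'.bd ≫
          eqToHom (Category.assoc _ _ _) ≫ one f sij.ab ◁ swap hjk g h sjk' ≫
            eqToHom (Category.assoc _ _ _).symm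

namespace MultiData

open Presented

variable {n : ℕ} {C : Fin n → TwoCat.{u}} {E : TwoCat.{u}}

section lift

variable (X : MultiData C E)

/-- On a short sequence of generators `pathMap` computes to the composite of the values. The
`eqToHom`s that evaluation introduces there join definitionally equal 1-cells and can be removed. -/
theorem conj_eqToHom_rfl {a b : E} {f g : a ⟶ b} (hf : f = f) (η : f ⟶ g) (hg : g = g) :
    eqToHom hf ≫ η ≫ eqToHom hg = η := by simp

/-- The morphism of quivers given by the values of the generating 1-cells. -/
def prefunctor : Multi.Obj C ⥤q E where
  obj := X.obj
  map := fun {a b} (e : Multi.Gen₁ C a b) =>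
    match a, b, e with
    | _, _, .cell f h => X.one f h

/-- The functor on 1-cells given by the values of the generating 1-cells. -/
def functor : Multi.OneCat C ⥤ E :=
  PresentedCat.lift (Multi.Rel₁ C) X.prefunctor (by
    intro a b f g h
    cases h with
    | id h => exact X.one_id h
    | comp f g h h' => exact (X.one_comp f g h h').symm)

/-- The values of the generating 2-cells. -/
def gen₂ : ∀ ⦃a b : Multi.OneCat C⦄ ⦃f g : a ⟶ b⦄, Multi.Gen₂ C f g →
    (X.functor.map f ⟶ X.functor.map g)
  | _, _, _, _, .cell φ h => X.two φ h
  | _, _, _, _, .swap hij f g s => X.swap hij f g s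

theorem eval_eq {a b : Multi.OneCat C} {f g : a ⟶ b} {s t : Cell (Multi.Gen₂ C) f g}
    (h : Multi.Rel₂ C s t) : s.eval X.functor X.gen₂ = t.eval X.functor X.gen₂ := by
  cases h with
  | id f h => exact X.two_id f h
  | vcomp φ ψ h => exact (X.two_comp φ ψ h).symm
  | hcomp φ ψ h h' =>
    refine Eq.trans ?_ (Cell.eval_conj_hcomp _ _ _ _ _ _).symm
    exact X.two_hcomp φ ψ h h'
  | swap_id_right hij f s => exact X.swap_id_right hij f s
  | swap_id_left hij g s => exact X.swap_id_left hij g s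
  | swap_comp_left hij f f' g s t =>
    refine Eq.trans ?_ (Cell.eval_comp_left _ _ _ _ _ _).symm
    exact X.swap_comp_left hij f f' g s t
  | swap_comp_right hij f g g' s t =>
    refine Eq.trans ?_ (Cell.eval_comp_right _ _ _ _ _ _).symm
    exact X.swap_comp_right hij f g g' s t
  | swap_naturality hij φ ψ s =>
    simp only [Cell.eval_hcomp, Cell.eval]
    refine Eq.trans (congrArg (· ≫ _) (conj_eqToHom_rfl _ _ _))
      (Eq.trans ?_ (congrArg (_ ≫ ·) (conj_eqToHom_rfl _ _ _)).symm)
    exact X.swap_naturality hij φ ψ s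
  | yangBaxter hij hjk f g h sij sij' sik sik' sjk sjk' =>
    refine (Cell.eval_yangBaxter_left _ _ _ _ _).trans
      (Eq.trans ?_ (Cell.eval_yangBaxter_right _ _ _ _ _).symm)
    refine (conj_eqToHom_rfl _ _ _).trans ?_
    exact X.yangBaxter hij hjk f g h sij sij' sik sik' sjk sjk'

/-- The strict 2-functor out of the explicit presentation given by the values of the generators. -/
def lift : StrictPseudofunctor (multiGray C) E :=
  Presented.lift (R := Multi.Rel₂ C) (φ := X.functor) (γ := X.gen₂) X.eval_eq

end lift

end MultiData

/-! ### Strict 2-functors out of the explicit presentation as families of cells -/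

namespace MultiGray

open Multi Presented

variable {n : ℕ} {C : Fin n → TwoCat.{u}} {E : TwoCat.{u}}

theorem oneCell_id {i : Fin n} {x : C i} {a : Obj C} (h : IsStep i x x a a) :
    oneCell (𝟙 x) h = 𝟙 (pt a) := one_id h

theorem oneCell_comp {i : Fin n} {x y z : C i} (f : x ⟶ y) (g : y ⟶ z) {a b c : Obj C}
    (h : IsStep i x y a b) (h' : IsStep i y z b c) :
    oneCell (f ≫ g) (h.trans h') = oneCell f h ≫ oneCell g h' := one_comp f g h h'

theorem oneCell_induction {P : ∀ {a b : multiGray C}, (a ⟶ b) → Prop} (id : ∀ a, P (𝟙 a))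
    (comp : ∀ {a b c : multiGray C} (f : a ⟶ b) (g : b ⟶ c), P f → P g → P (f ≫ g))
    (oneCell : ∀ {i : Fin n} {x y : C i} (f : x ⟶ y) {a b : Obj C} (h : IsStep i x y a b),
      P (oneCell f h)) {a b : multiGray C} (f : a ⟶ b) : P f :=
  PresentedCat.induction (r := Rel₁ C) (P := fun f => P (a := of (Rel₂ C) _) (of₁ (Rel₂ C) f))
    (fun a => id a) (fun f g => comp f g) (fun {a b} e => by
      obtain ⟨f, h⟩ := e
      exact oneCell f h) f

theorem hom_ext {S T : StrictPseudofunctor (multiGray C) E}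
    (hobj : ∀ a : Obj C, S.obj (pt a) = T.obj (pt a))
    (hone : ∀ {i : Fin n} {x y : C i} (f : x ⟶ y) {a b : Obj C} (h : IsStep i x y a b),
      HEq (S.map (oneCell f h)) (T.map (oneCell f h)))
    (htwo : ∀ {i : Fin n} {x y : C i} {f g : x ⟶ y} (φ : f ⟶ g) {a b : Obj C}
      (h : IsStep i x y a b), HEq (S.map₂ (twoCell φ h)) (T.map₂ (twoCell φ h)))
    (hswap : ∀ {i j : Fin n} (hij : i < j) {x x' : C i} (f : x ⟶ x') {y y' : C j} (g : y ⟶ y')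
      {a b c d : Obj C} (s : IsSquare i j x x' y y' a b c d),
      HEq (S.map₂ (swapCell hij f g s)) (T.map₂ (swapCell hij f g s))) : S = T := by
  have hobj' : ∀ a : multiGray C, S.obj a = T.obj a := fun a => hobj a.as
  have hmap : ∀ {a b : multiGray C} (f : a ⟶ b), HEq (S.map f) (T.map f) := fun f => by
    induction f using oneCell_induction with
    | id a =>
      rw [S.map_id, T.map_id]
      exact id_heq (hobj' a)
    | comp f g hf hg =>
      rw [S.map_comp, T.map_comp]
      exact comp_heq (hobj' _) (hobj' _) (hobj' _) hf hg
    | oneCell f h => exact hone f h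
  refine Presented.hom_ext (R := Rel₂ C) hobj' (fun f => hmap f) ?_
  rintro a b f g (⟨φ, h⟩ | ⟨hij, f, g, s⟩)
  · exact htwo φ h
  · exact hswap hij f g s

end MultiGray

namespace MultiData

open Presented

variable {n : ℕ} {C : Fin n → TwoCat.{u}} {E : TwoCat.{u}}

/-- The values of the generators under a strict 2-functor. -/
def ofFunctor (S : StrictPseudofunctor (multiGray C) E) : MultiData C E where
  obj a := S.obj (MultiGray.pt a)
  one f _ _ h := S.map (MultiGray.oneCell f h)
  one_id h := by rw [MultiGray.oneCell_id, S.map_id]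
  one_comp f g _ _ _ h h' := by rw [MultiGray.oneCell_comp, S.map_comp]
  two φ _ _ h := S.map₂ (MultiGray.twoCell φ h)
  two_id f _ _ h := eval_restrict S (.id f h)
  two_comp φ ψ _ _ h := (eval_restrict S (.vcomp φ ψ h)).symm
  two_hcomp φ ψ _ _ _ h h' := (eval_restrict S (.hcomp φ ψ h h')).trans
    (Cell.eval_conj_hcomp _ _ _ _ _ _)
  -- `S.map` of a composite is the composite of the images only propositionally, hence the
  -- conjugation.
  swap hij _ _ f _ _ g _ _ _ _ s := eqToHom (S.map_comp _ _).symm ≫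
    S.map₂ (MultiGray.swapCell hij f g s) ≫ eqToHom (S.map_comp _ _)
  swap_id_right hij _ _ f _ _ _ s := by
    -- The equality proofs inside `eqToHom` are existentially quantified here and below: their form
    -- is irrelevant, and `simp` then works with variables in their place.
    obtain ⟨p, h⟩ : ∃ p, S.map₂ (MultiGray.swapCell hij f (𝟙 _) s) = eqToHom p :=
      ⟨_, eval_restrict S (.swap_id_right hij f s)⟩
    rw [h]
    simp
  swap_id_left hij _ _ _ g _ _ s := by
    obtain ⟨p, h⟩ : ∃ p, S.map₂ (MultiGray.swapCell hij (𝟙 _) g s) = eqToHom p :=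
      ⟨_, eval_restrict S (.swap_id_left hij g s)⟩
    rw [h]
    simp
  swap_comp_left hij _ _ _ f f' _ _ g _ _ _ _ _ _ s t := by
    obtain ⟨p, q, r, h⟩ : ∃ p q r, S.map₂ (MultiGray.swapCell hij (f ≫ f') g
        ⟨s.ab.trans t.ab, s.ac, t.bd, s.cd.trans t.cd⟩) =
        eqToHom p ≫ S.map₂ (MultiGray.swapCell hij f g s) ▷ S.map (MultiGray.oneCell f' t.cd) ≫
          eqToHom q ≫ S.map (MultiGray.oneCell f s.ab) ◁ S.map₂ (MultiGray.swapCell hij f' g t) ≫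
            eqToHom r :=
      ⟨_, _, _, (eval_restrict S (.swap_comp_left hij f f' g s t)).trans
        (Cell.eval_comp_left _ _ _ _ _ _)⟩
    rw [h]
    simp
  swap_comp_right hij _ _ f _ _ _ g g' _ _ _ _ _ _ s t := by
    obtain ⟨p, q, r, h⟩ : ∃ p q r, S.map₂ (MultiGray.swapCell hij f (g ≫ g')
        ⟨s.ab, s.ac.trans t.ac, s.bd.trans t.bd, t.cd⟩) =
        eqToHom p ≫ S.map (MultiGray.oneCell g s.ac) ◁ S.map₂ (MultiGray.swapCell hij f g' t) ≫
          eqToHom q ≫ S.map₂ (MultiGray.swapCell hij f g s) ▷ S.map (MultiGray.oneCell g' t.bd) ≫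
            eqToHom r :=
      ⟨_, _, _, (eval_restrict S (.swap_comp_right hij f g g' s t)).trans
        (Cell.eval_comp_right _ _ _ _ _ _)⟩
    rw [h]
    simp
  swap_naturality hij _ _ f f' φ _ _ g g' ψ _ _ _ _ s := by
    obtain ⟨p, q, r, t, h⟩ : ∃ p q r t,
        (eqToHom p ≫ (S.map₂ (MultiGray.twoCell ψ s.ac) ▷ S.map (MultiGray.oneCell f s.cd) ≫
          S.map (MultiGray.oneCell g' s.ac) ◁ S.map₂ (MultiGray.twoCell φ s.cd)) ≫ eqToHom q) ≫
            S.map₂ (MultiGray.swapCell hij f' g' s) =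
          S.map₂ (MultiGray.swapCell hij f g s) ≫ eqToHom r ≫
            (S.map₂ (MultiGray.twoCell φ s.ab) ▷ S.map (MultiGray.oneCell g s.bd) ≫
              S.map (MultiGray.oneCell f' s.ab) ◁ S.map₂ (MultiGray.twoCell ψ s.bd)) ≫
                eqToHom t :=
      ⟨_, _, _, _, (congrArg (· ≫ _) (Cell.eval_hcomp _ _ _ _)).symm.trans
        ((eval_restrict S (.swap_naturality hij φ ψ s)).trans
          (congrArg (_ ≫ ·) (Cell.eval_hcomp _ _ _ _)))⟩
    -- The evaluated relation lives between images of composites; conjugation by the inverse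
    -- coherence cells moves it to composites of images.
    simpa using congrArg (fun x => eqToHom p.symm ≫ x ≫ eqToHom t.symm) h
  yangBaxter hij hjk _ _ f _ _ g _ _ h _ _ _ _ _ _ _ _ sij sij' sik sik' sjk sjk' := by
    obtain ⟨p₁, p₂, p₃, p₄, q₁, q₂, q₃, q₄, e⟩ : ∃ p₁ p₂ p₃ p₄ q₁ q₂ q₃ q₄,
        (eqToHom p₁ ≫
          (S.map₂ (MultiGray.swapCell hjk g h sjk) ▷ S.map (MultiGray.oneCell f sij'.cd) ≫
            eqToHom p₂ ≫ S.map (MultiGray.oneCell g sij.ac) ◁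
              S.map₂ (MultiGray.swapCell (hij.trans hjk) f h sik') ≫ eqToHom p₃ ≫
                S.map₂ (MultiGray.swapCell hij f g sij) ▷ S.map (MultiGray.oneCell h sjk'.bd)) ≫
                  eqToHom p₄ :
          S.map ((MultiGray.oneCell h sik.ac ≫ MultiGray.oneCell g sjk.cd) ≫
              MultiGray.oneCell f sij'.cd) ⟶
            S.map ((MultiGray.oneCell f sij.ab ≫ MultiGray.oneCell g sij.bd) ≫
              MultiGray.oneCell h sjk'.bd)) =
          eqToHom q₁ ≫ S.map (MultiGray.oneCell h sik.ac) ◁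
            S.map₂ (MultiGray.swapCell hij f g sij') ≫ eqToHom q₂ ≫
              S.map₂ (MultiGray.swapCell (hij.trans hjk) f h sik) ▷
                S.map (MultiGray.oneCell g sij'.bd) ≫ eqToHom q₃ ≫
                  S.map (MultiGray.oneCell f sij.ab) ◁
                    S.map₂ (MultiGray.swapCell hjk g h sjk') ≫ eqToHom q₄ :=
      ⟨_, _, _, _, _, _, _, _, (Cell.eval_yangBaxter_left _ _ _ _ _).symm.trans
        ((eval_restrict S (.yangBaxter hij hjk f g h sij sij' sik sik' sjk sjk')).trans
          (Cell.eval_yangBaxter_right _ _ _ _ _))⟩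
    -- As before, but the source and target are images of threefold composites, so `S.map_comp` has
    -- to be undone twice on each side.
    simpa using congrArg (fun x =>
      eqToHom (congrArg (· ≫ S.map (MultiGray.oneCell f sij'.cd)) (S.map_comp _ _).symm) ≫
        eqToHom p₁.symm ≫ x ≫ eqToHom p₄.symm ≫
          eqToHom (congrArg (· ≫ S.map (MultiGray.oneCell h sjk'.bd)) (S.map_comp _ _))) e

/-- The half of the correspondence between families and strict 2-functors that is needed: applied to
the identity it shows that the tautological family lifts to the identity. -/
theorem lift_ofFunctor (S : StrictPseudofunctor (multiGray C) E) : (ofFunctor S).lift = S :=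
  MultiGray.hom_ext (fun _ => rfl) (by intros; rfl) (by intros; rfl)
    (by intros; exact eqToHom_comp_eqToHom_heq _ _ _)

end MultiData

/-! ### The lax Gray tensor product -/

namespace Gray

open Presented

variable {B D E : TwoCat.{u}}

theorem left_id (b : B) (d : D) : left (𝟙 b) d = 𝟙 (pt b d) := left₁_id b d

theorem right_id (b : B) (d : D) : right b (𝟙 d) = 𝟙 (pt b d) := right₁_id b d

theorem left_comp {b b' b'' : B} (f : b ⟶ b') (f' : b' ⟶ b'') (d : D) :
    left (f ≫ f') d = left f d ≫ left f' d := left₁_comp f f' d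

theorem right_comp (b : B) {d d' d'' : D} (g : d ⟶ d') (g' : d' ⟶ d'') :
    right b (g ≫ g') = right b g ≫ right b g' := right₁_comp b g g'

/-- Evaluating in `gray B D` itself along the identity 2-functor replaces formal whiskerings by
actual ones; the defining relations become the equations listed below. -/
theorem eval_id {X Y : OneCat B D} {f g : X ⟶ Y} {s t : Cell (Gen₂ B D) f g}
    (h : Rel₂ B D s t) :
    s.eval (restrict (Rel₂ B D) (StrictPseudofunctor.id (gray B D)))
        (fun _ _ _ _ s => mk (Rel₂ B D) (.gen s)) =
      t.eval (restrict (Rel₂ B D) (StrictPseudofunctor.id (gray B D)))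
        (fun _ _ _ _ s => mk (Rel₂ B D) (.gen s)) :=
  eval_restrict (StrictPseudofunctor.id (gray B D)) h

theorem left₂_id {b b' : B} (f : b ⟶ b') (d : D) : left₂ (𝟙 f) d = 𝟙 (left f d) :=
  eval_id (.left_id f d)

theorem right₂_id (b : B) {d d' : D} (g : d ⟶ d') : right₂ b (𝟙 g) = 𝟙 (right b g) :=
  eval_id (.right_id b g)

theorem left₂_comp {b b' : B} {f f' f'' : b ⟶ b'} (φ : f ⟶ f') (φ' : f' ⟶ f'') (d : D) :
    left₂ (φ ≫ φ') d = left₂ φ d ≫ left₂ φ' d :=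
  (eval_id (.left_vcomp φ φ' d)).symm

theorem right₂_comp (b : B) {d d' : D} {g g' g'' : d ⟶ d'} (ψ : g ⟶ g') (ψ' : g' ⟶ g'') :
    right₂ b (ψ ≫ ψ') = right₂ b ψ ≫ right₂ b ψ' :=
  (eval_id (.right_vcomp b ψ ψ')).symm

theorem left₂_hcomp {b b' b'' : B} {f f' : b ⟶ b'} {h h' : b' ⟶ b''} (φ : f ⟶ f') (χ : h ⟶ h')
    (d : D) :
    left₂ (φ ▷ h ≫ f' ◁ χ) d = eqToHom (left_comp f h d) ≫
      (left₂ φ d ▷ left h d ≫ left f' d ◁ left₂ χ d) ≫ eqToHom (left_comp f' h' d).symm :=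
  (eval_id (.left_hcomp φ χ d)).trans (Cell.eval_conj_hcomp _ _ _ _ _ _)

theorem right₂_hcomp (b : B) {d d' d'' : D} {g g' : d ⟶ d'} {h h' : d' ⟶ d''} (ψ : g ⟶ g')
    (χ : h ⟶ h') :
    right₂ b (ψ ▷ h ≫ g' ◁ χ) = eqToHom (right_comp b g h) ≫
      (right₂ b ψ ▷ right b h ≫ right b g' ◁ right₂ b χ) ≫ eqToHom (right_comp b g' h').symm :=
  (eval_id (.right_hcomp b ψ χ)).trans (Cell.eval_conj_hcomp _ _ _ _ _ _)

theorem swap_id_right {b b' : B} (f : b ⟶ b') (d : D) :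
    swap f (𝟙 d) = eqToHom (by
      rw [right_id, right_id]; exact (Category.id_comp _).trans (Category.comp_id _).symm) :=
  eval_id (.swap_id_right f d)

theorem swap_id_left (b : B) {d d' : D} (g : d ⟶ d') :
    swap (𝟙 b) g = eqToHom (by
      rw [left_id, left_id]; exact (Category.comp_id _).trans (Category.id_comp _).symm) :=
  eval_id (.swap_id_left b g)

theorem swap_comp_left {b b' b'' : B} (f : b ⟶ b') (f' : b' ⟶ b'') {d d' : D} (g : d ⟶ d') :
    swap (f ≫ f') g = eqToHom (by rw [left_comp]; exact (Category.assoc _ _ _).symm) ≫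
      swap f g ▷ left f' d' ≫ eqToHom (Category.assoc _ _ _) ≫ left f d ◁ swap f' g ≫
        eqToHom (by rw [left_comp]; exact (Category.assoc _ _ _).symm) :=
  (eval_id (.swap_comp_left f f' g)).trans (Cell.eval_comp_left _ _ _ _ _ _)

theorem swap_comp_right {b b' : B} (f : b ⟶ b') {d d' d'' : D} (g : d ⟶ d') (g' : d' ⟶ d'') :
    swap f (g ≫ g') = eqToHom (by rw [right_comp]; exact Category.assoc _ _ _) ≫
      right b g ◁ swap f g' ≫ eqToHom (Category.assoc _ _ _).symm ≫ swap f g ▷ right b' g' ≫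
        eqToHom (by rw [right_comp]; exact Category.assoc _ _ _) :=
  (eval_id (.swap_comp_right f g g')).trans (Cell.eval_comp_right _ _ _ _ _ _)

theorem swap_naturality {b b' : B} {f f' : b ⟶ b'} (φ : f ⟶ f') {d d' : D} {g g' : d ⟶ d'}
    (ψ : g ⟶ g') :
    (right₂ b ψ ▷ left f d' ≫ right b g' ◁ left₂ φ d') ≫ swap f' g' =
      swap f g ≫ left₂ φ d ▷ right b' g ≫ left f' d ◁ right₂ b' ψ :=
  sound (.of (Rel₂.swap_naturality φ ψ))

variable (B) in
/-- The strict 2-functor `b ↦ (b, d)`. -/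
def leftFunctor (d : D) : StrictPseudofunctor B (gray B D) :=
  StrictPseudofunctor.mk''
  { obj := fun b => pt b d
    map := fun f => left f d
    map₂ := fun φ => left₂ φ d
    map₂_id := fun f => left₂_id f d
    map₂_comp := fun φ φ' => left₂_comp φ φ' d
    map_id := fun b => left_id b d
    map_comp := fun f f' => left_comp f f' d
    map₂_whisker_left := fun f _ _ η => by
      -- Whiskering by `f` is horizontal composition with the identity 2-cell of `f`.
      simpa [left₂_id] using left₂_hcomp (𝟙 f) η d
    map₂_whisker_right := fun η g => by
      simpa [left₂_id] using left₂_hcomp η (𝟙 g) d }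

/-- Kept apart from `hom_ext` because agreement on all 1-cells is needed before γ can be compared at
composite 1-cells. -/
theorem map_heq_of_left_of_right {S T : StrictPseudofunctor (gray B D) E}
    (hobj : ∀ b d, S.obj (pt b d) = T.obj (pt b d))
    (hleft : ∀ {b b' : B} (f : b ⟶ b') (d : D), HEq (S.map (left f d)) (T.map (left f d)))
    (hright : ∀ (b : B) {d d' : D} (g : d ⟶ d'), HEq (S.map (right b g)) (T.map (right b g)))
    {a b : gray B D} (f : a ⟶ b) : HEq (S.map f) (T.map f) := by
  have hobj' : ∀ a : gray B D, S.obj a = T.obj a := fun a => hobj a.as.fst a.as.snd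
  refine PresentedCat.induction (r := Rel₁ B D)
    (P := fun f => HEq (S.map (of₁ (Rel₂ B D) f)) (T.map (of₁ (Rel₂ B D) f))) ?_ ?_ ?_ f
  · intro a
    exact (heq_of_eq (S.map_id _)).trans ((id_heq (hobj' a)).trans (heq_of_eq (T.map_id _).symm))
  · intro a b c f g hf hg
    exact (heq_of_eq (S.map_comp _ _)).trans ((comp_heq (hobj' a) (hobj' b) (hobj' c) hf hg).trans
      (heq_of_eq (T.map_comp _ _).symm))
  · rintro a b (⟨f, d⟩ | ⟨b, g⟩)
    · exact hleft f d
    · exact hright b g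

theorem hom_ext {S T : StrictPseudofunctor (gray B D) E}
    (hobj : ∀ b d, S.obj (pt b d) = T.obj (pt b d))
    (hleft : ∀ {b b' : B} (f : b ⟶ b') (d : D), HEq (S.map (left f d)) (T.map (left f d)))
    (hright : ∀ (b : B) {d d' : D} (g : d ⟶ d'), HEq (S.map (right b g)) (T.map (right b g)))
    (hleft₂ : ∀ {b b' : B} {f f' : b ⟶ b'} (φ : f ⟶ f') (d : D),
      HEq (S.map₂ (left₂ φ d)) (T.map₂ (left₂ φ d)))
    (hright₂ : ∀ (b : B) {d d' : D} {g g' : d ⟶ d'} (ψ : g ⟶ g'),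
      HEq (S.map₂ (right₂ b ψ)) (T.map₂ (right₂ b ψ)))
    (hswap : ∀ {b b' : B} (f : b ⟶ b') {d d' : D} (g : d ⟶ d'),
      HEq (S.map₂ (swap f g)) (T.map₂ (swap f g))) : S = T := by
  have hobj' : ∀ a : gray B D, S.obj a = T.obj a := fun a => hobj a.as.fst a.as.snd
  refine Presented.hom_ext (R := Rel₂ B D) hobj'
    (fun f => map_heq_of_left_of_right hobj hleft hright f) ?_
  rintro a b f g (⟨φ, d⟩ | ⟨b, ψ⟩ | ⟨f, g⟩)
  · exact hleft₂ φ d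
  · exact hright₂ b ψ
  · exact hswap f g

theorem map₂_swap_id_heq {S T : StrictPseudofunctor (gray B D) E}
    (hobj : ∀ a, S.obj a = T.obj a) (hmap : ∀ {a b : gray B D} (f : a ⟶ b), HEq (S.map f) (T.map f))
    (b : B) {d d' : D} (g : d ⟶ d') : HEq (S.map₂ (swap (𝟙 b) g)) (T.map₂ (swap (𝟙 b) g)) := by
  rw [swap_id_left]
  exact StrictPseudofunctor.map₂_eqToHom_heq hobj hmap _

/-- γ of a composite is built from γ of the factors. Together with the identity case this allows
γ_{f,g} to be compared only for `f` in a generating set of 1-cells of `B`. -/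
theorem map₂_swap_comp_heq {S T : StrictPseudofunctor (gray B D) E}
    (hobj : ∀ a, S.obj a = T.obj a) (hmap : ∀ {a b : gray B D} (f : a ⟶ b), HEq (S.map f) (T.map f))
    {b b' b'' : B} (f : b ⟶ b') (f' : b' ⟶ b'') {d d' : D} (g : d ⟶ d')
    (hf : HEq (S.map₂ (swap f g)) (T.map₂ (swap f g)))
    (hf' : HEq (S.map₂ (swap f' g)) (T.map₂ (swap f' g))) :
    HEq (S.map₂ (swap (f ≫ f') g)) (T.map₂ (swap (f ≫ f') g)) := by
  rw [swap_comp_left]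
  exact StrictPseudofunctor.map₂_comp_heq hobj hmap
    (StrictPseudofunctor.map₂_eqToHom_heq hobj hmap _)
    (StrictPseudofunctor.map₂_comp_heq hobj hmap
      (StrictPseudofunctor.map₂_whiskerRight_heq hobj hmap hf _)
      (StrictPseudofunctor.map₂_comp_heq hobj hmap
        (StrictPseudofunctor.map₂_eqToHom_heq hobj hmap _)
        (StrictPseudofunctor.map₂_comp_heq hobj hmap
          (StrictPseudofunctor.map₂_whiskerLeft_heq hobj hmap _ hf')
          (StrictPseudofunctor.map₂_eqToHom_heq hobj hmap _))))

end Gray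

/-! ### Strict 2-functors into the 2-category of oplax functors -/

namespace oplaxHom

variable {D E : TwoCat.{u}}

/-- A 0-cell of `oplaxHom D E` as an oplax functor. -/
def toOplax (F : oplaxHom D E) : OplaxFunctor D E := F

variable {F G H : oplaxHom D E}

/-- The component of an oplax transformation at a 0-cell. -/
def app (η : F ⟶ G) (d : D) : (toOplax F).obj d ⟶ (toOplax G).obj d :=
  Oplax.OplaxTrans.app (F := toOplax F) (G := toOplax G) η d

/-- The component of an oplax transformation at a 1-cell. -/
def nat (η : F ⟶ G) {d d' : D} (g : d ⟶ d') :
    (toOplax F).map g ≫ app η d' ⟶ app η d ≫ (toOplax G).map g :=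
  Oplax.OplaxTrans.naturality (F := toOplax F) (G := toOplax G) η g

/-- The component of a modification at a 0-cell. -/
def app₂ {η θ : F ⟶ G} (Γ : η ⟶ θ) (d : D) : app η d ⟶ app θ d :=
  Oplax.OplaxTrans.Modification.app (Oplax.OplaxTrans.Hom.as (F := toOplax F) (G := toOplax G) Γ) d

theorem nat_id (F : oplaxHom D E) {d d' : D} (g : d ⟶ d') :
    nat (𝟙 F) g = eqToHom ((Strict.comp_id _).trans (Strict.id_comp _).symm) :=
  OplaxHom.id_naturality (toOplax F) g

theorem nat_comp (η : F ⟶ G) (θ : G ⟶ H) {d d' : D} (g : d ⟶ d') :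
    nat (η ≫ θ) g = eqToHom (Strict.assoc _ _ _).symm ≫ nat η g ▷ app θ d' ≫
      eqToHom (Strict.assoc _ _ _) ≫ app η d ◁ nat θ g ≫ eqToHom (Strict.assoc _ _ _).symm :=
  OplaxHom.comp_naturality (F := toOplax F) (G := toOplax G) (H := toOplax H) η θ g

/-- The transformation is a variable because `H.map (𝟙 b)` is an identity only propositionally, and
the type of `nat` depends on it. -/
theorem nat_of_eq_id {η : F ⟶ F} (h : η = 𝟙 F) {d d' : D} (g : d ⟶ d') :
    nat η g = eqToHom (by subst h; exact (Strict.comp_id _).trans (Strict.id_comp _).symm) := by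
  subst h; exact nat_id F g

theorem nat_of_eq_comp {η : F ⟶ G} {θ : G ⟶ H} {ι : F ⟶ H} (h : ι = η ≫ θ) {d d' : D}
    (g : d ⟶ d') :
    nat ι g = eqToHom (by subst h; exact (Strict.assoc _ _ _).symm) ≫ nat η g ▷ app θ d' ≫
      eqToHom (Strict.assoc _ _ _) ≫ app η d ◁ nat θ g ≫
        eqToHom (by subst h; exact (Strict.assoc _ _ _).symm) := by
  subst h; exact nat_comp η θ g

theorem nat_naturality (η : F ⟶ G) {d d' : D} {g g' : d ⟶ d'} (ψ : g ⟶ g') :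
    (toOplax F).map₂ ψ ▷ app η d' ≫ nat η g' = nat η g ≫ app η d ◁ (toOplax G).map₂ ψ :=
  Oplax.OplaxTrans.naturality_naturality (F := toOplax F) (G := toOplax G) η ψ

theorem app₂_comp {η θ ι : F ⟶ G} (Γ : η ⟶ θ) (Γ' : θ ⟶ ι) (d : D) :
    app₂ (Γ ≫ Γ') d = app₂ Γ d ≫ app₂ Γ' d := rfl

theorem app₂_whiskerLeft (η : F ⟶ G) {θ ι : G ⟶ H} (Γ : θ ⟶ ι) (d : D) :
    app₂ (η ◁ Γ) d = app η d ◁ app₂ Γ d := rfl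

theorem app₂_whiskerRight {η θ : F ⟶ G} (Γ : η ⟶ θ) (ι : G ⟶ H) (d : D) :
    app₂ (Γ ▷ ι) d = app₂ Γ d ▷ app ι d := rfl

theorem app₂_eqToHom {η θ : F ⟶ G} (h : η = θ) (d : D) :
    app₂ (eqToHom h) d = eqToHom (congrArg (app · d) h) := by
  subst h; rfl

theorem app₂_naturality {η θ : F ⟶ G} (Γ : η ⟶ θ) {d d' : D} (g : d ⟶ d') :
    (toOplax F).map g ◁ app₂ Γ d' ≫ nat θ g = nat η g ≫ app₂ Γ d ▷ (toOplax G).map g :=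
  (Oplax.OplaxTrans.Hom.as (F := toOplax F) (G := toOplax G) Γ).naturality g

/-- Naturality of γ in both arguments: the modification axiom of `Γ` handles the first, the
naturality of an oplax transformation the second, and interchange joins them. -/
theorem hcomp_nat {η θ : F ⟶ G} (Γ : η ⟶ θ) {d d' : D} {g g' : d ⟶ d'} (ψ : g ⟶ g') :
    ((toOplax F).map₂ ψ ▷ app η d' ≫ (toOplax F).map g' ◁ app₂ Γ d') ≫ nat θ g' =
      nat η g ≫ (app₂ Γ d ▷ (toOplax G).map g ≫ app θ d ◁ (toOplax G).map₂ ψ) := by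
  rw [Category.assoc, app₂_naturality, ← Category.assoc, nat_naturality, Category.assoc,
    whisker_exchange]

/-- The structure 2-cells of the oplax functor `F` are identities. -/
structure IsStrict (F : oplaxHom D E) : Prop where
  map_id (d : D) : (toOplax F).map (𝟙 d) = 𝟙 ((toOplax F).obj d)
  map_comp {d d' d'' : D} (g : d ⟶ d') (g' : d' ⟶ d'') :
    (toOplax F).map (g ≫ g') = (toOplax F).map g ≫ (toOplax F).map g'
  mapId_eq (d : D) : (toOplax F).mapId d = eqToHom (map_id d)
  mapComp_eq {d d' d'' : D} (g : d ⟶ d') (g' : d' ⟶ d'') :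
    (toOplax F).mapComp g g' = eqToHom (map_comp g g')

/-- A strict 2-functor as a 0-cell of `oplaxHom D E`. -/
def ofStrict (S : StrictPseudofunctor D E) : oplaxHom D E := S.toPseudofunctor.toOplax

theorem isStrict_ofStrict (S : StrictPseudofunctor D E) : IsStrict (ofStrict S) where
  map_id := S.map_id
  map_comp := S.map_comp
  mapId_eq d := congrArg Iso.hom (S.mapId_eq_eqToIso d)
  mapComp_eq g g' := congrArg Iso.hom (S.mapComp_eq_eqToIso g g')

/-- Naturality of `mapComp` in each argument, with `mapComp` an identity 2-cell. -/
theorem IsStrict.map₂_hcomp (hF : IsStrict F) {d d' d'' : D} {g g' : d ⟶ d'} {h h' : d' ⟶ d''}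
    (ψ : g ⟶ g') (χ : h ⟶ h') : (toOplax F).map₂ (ψ ▷ h ≫ g' ◁ χ) = eqToHom (hF.map_comp g h) ≫
      ((toOplax F).map₂ ψ ▷ (toOplax F).map h ≫ (toOplax F).map g' ◁ (toOplax F).map₂ χ) ≫
        eqToHom (hF.map_comp g' h').symm := by
  have h₁ := (toOplax F).mapComp_naturality_left ψ h
  have h₂ := (toOplax F).mapComp_naturality_right g' χ
  rw [hF.mapComp_eq, hF.mapComp_eq] at h₁ h₂
  rw [← cancel_mono (eqToHom (hF.map_comp g' h'))]
  simp only [PrelaxFunctor.map₂_comp, Category.assoc, h₂, reassoc_of% h₁]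
  simp

/-- The unit axiom of an oplax transformation loses its structure cells when source and target are
strict, and becomes the relation for γ_{f,Id}. In the same way the composition axiom below becomes
the relation for γ in a composite second argument. -/
theorem nat_id_right (hF : IsStrict F) (hG : IsStrict G) (η : F ⟶ G) (d : D) :
    nat η (𝟙 d) = eqToHom (by
      rw [hF.map_id, hG.map_id]; exact (Strict.id_comp _).trans (Strict.comp_id _).symm) := by
  have h := Oplax.OplaxTrans.naturality_id (F := toOplax F) (G := toOplax G) η d
  rw [hF.mapId_eq, hG.mapId_eq] at h
  change nat η (𝟙 d) ≫ app η d ◁ eqToHom _ = eqToHom _ ▷ app η d ≫ (λ_ (app η d)).hom ≫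
    (ρ_ (app η d)).inv at h
  rw [← cancel_mono (app η d ◁ eqToHom (hG.map_id d)), h]
  simp [Strict.leftUnitor_eqToIso, Strict.rightUnitor_eqToIso]

theorem nat_comp_right (hF : IsStrict F) (hG : IsStrict G) (η : F ⟶ G) {d d' d'' : D}
    (g : d ⟶ d') (g' : d' ⟶ d'') :
    nat η (g ≫ g') = eqToHom (by rw [hF.map_comp]; exact Strict.assoc _ _ _) ≫
      (toOplax F).map g ◁ nat η g' ≫ eqToHom (Strict.assoc _ _ _).symm ≫
        nat η g ▷ (toOplax G).map g' ≫
          eqToHom (by rw [hG.map_comp]; exact Strict.assoc _ _ _) := by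
  have h := Oplax.OplaxTrans.naturality_comp (F := toOplax F) (G := toOplax G) η g g'
  rw [hF.mapComp_eq, hG.mapComp_eq] at h
  change nat η (g ≫ g') ≫ app η d ◁ eqToHom _ = eqToHom _ ▷ app η d'' ≫ (α_ _ _ _).hom ≫
    (toOplax F).map g ◁ nat η g' ≫ (α_ _ _ _).inv ≫ nat η g ▷ (toOplax G).map g' ≫
      (α_ _ _ _).hom at h
  rw [← cancel_mono (app η d ◁ eqToHom (hG.map_comp g g')), h]
  simp [Strict.associator_eqToIso]

end oplaxHom

/-! ### Uncurrying: from 2-functors into `oplaxHom D E` to 2-functors on `gray B D` -/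

namespace Gray

open Presented oplaxHom

variable {B D E : TwoCat.{u}} (H : StrictPseudofunctor B (oplaxHom D E))
  (hH : ∀ b, IsStrict (H.obj b))

/-- The values of the generating 1-cells. -/
def uncurryPrefunctor : Obj B D ⥤q E where
  obj X := (toOplax (H.obj X.fst)).obj X.snd
  map := fun {X Y} (e : Gen₁ B D X Y) =>
    match X, Y, e with
    | _, _, .left f d => app (H.map f) d
    | _, _, .right b g => (toOplax (H.obj b)).map g

/-- The functor on 1-cells given by the values of the generating 1-cells. -/
def uncurryFunctor : OneCat B D ⥤ E :=
  PresentedCat.lift (Rel₁ B D) (uncurryPrefunctor H) (by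
    intro a b f g h
    cases h with
    | left_id b d => exact congrArg (app · d) (H.map_id b)
    | right_id b d => exact (hH b).map_id d
    | left_comp f f' d => exact (congrArg (app · d) (H.map_comp f f')).symm
    | right_comp b g g' => exact ((hH b).map_comp g g').symm)

/-- The values of the generating 2-cells. -/
def uncurryGen₂ : ∀ ⦃a b : OneCat B D⦄ ⦃f g : a ⟶ b⦄, Gen₂ B D f g →
    ((uncurryFunctor H hH).map f ⟶ (uncurryFunctor H hH).map g)
  | _, _, _, _, .left φ d => app₂ (H.map₂ φ) d
  | _, _, _, _, .right b ψ => (toOplax (H.obj b)).map₂ ψ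
  | _, _, _, _, .swap f g => nat (H.map f) g

/-- Each relation is a piece of the structure of `H`. The relations for (–, Id) are its
2-functoriality, those for (Id, –) the strictness of its values. The rules for γ in the first
argument say how oplax transformations compose, and those in the second are the axioms of an oplax
transformation. -/
theorem uncurry_eval_eq {a b : OneCat B D} {f g : a ⟶ b} {s t : Cell (Gen₂ B D) f g}
    (h : Rel₂ B D s t) : s.eval (uncurryFunctor H hH) (uncurryGen₂ H hH) =
      t.eval (uncurryFunctor H hH) (uncurryGen₂ H hH) := by
  cases h with
  | left_id f d => exact congrArg (app₂ · d) (H.map₂_id f)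
  | right_id b g => exact (toOplax (H.obj b)).map₂_id g
  | left_vcomp φ φ' d => exact (congrArg (app₂ · d) (H.map₂_comp φ φ')).symm
  | right_vcomp b ψ ψ' => exact ((toOplax (H.obj b)).map₂_comp ψ ψ').symm
  | left_hcomp φ χ d =>
    refine Eq.trans ?_ (Cell.eval_conj_hcomp _ _ _ _ _ _).symm
    change app₂ (H.map₂ _) d = _
    rw [H.map₂_comp, H.map₂_whiskerLeft, H.map₂_whiskerRight]
    simp only [Category.assoc, eqToHom_trans_assoc, eqToHom_refl, Category.id_comp, app₂_comp,
      app₂_eqToHom, app₂_whiskerLeft, app₂_whiskerRight]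
    rfl
  | right_hcomp b ψ χ =>
    refine Eq.trans ?_ (Cell.eval_conj_hcomp _ _ _ _ _ _).symm
    exact (hH b).map₂_hcomp ψ χ
  | swap_id_right f d => exact nat_id_right (hH _) (hH _) (H.map f) d
  | swap_id_left b g =>
    exact nat_of_eq_id (H.map_id b) g
  | swap_comp_left f f' g =>
    refine Eq.trans ?_ (Cell.eval_comp_left _ _ _ _ _ _).symm
    exact nat_of_eq_comp (H.map_comp f f') g
  | swap_comp_right f g g' =>
    refine Eq.trans ?_ (Cell.eval_comp_right _ _ _ _ _ _).symm
    exact nat_comp_right (hH _) (hH _) (H.map f) g g'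
  | swap_naturality φ ψ =>
    simp only [Cell.eval_hcomp, Cell.eval]
    refine Eq.trans (congrArg (· ≫ _) (MultiData.conj_eqToHom_rfl _ _ _))
      (Eq.trans ?_ (congrArg (_ ≫ ·) (MultiData.conj_eqToHom_rfl _ _ _)).symm)
    exact hcomp_nat (H.map₂ φ) ψ

/-- The strict 2-functor out of the lax Gray tensor product that corresponds to a strict
2-functor into the 2-category of oplax functors. -/
def uncurry : StrictPseudofunctor (gray B D) E :=
  Presented.lift (R := Rel₂ B D) (φ := uncurryFunctor H hH) (γ := uncurryGen₂ H hH)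
    (uncurry_eval_eq H hH)

end Gray

/-! ### Splitting off the last factor -/

/-- The two cases for an element of `Fin (n + 1)`, as an inductive family. -/
inductive FinPos {n : ℕ} : Fin (n + 1) → Type
  | castSucc (i : Fin n) : FinPos i.castSucc
  | last : FinPos (Fin.last n)

namespace FinPos

variable {n : ℕ}

/-- The case that applies to `i`. -/
def of (i : Fin (n + 1)) : FinPos i := Fin.lastCases .last .castSucc i

theorem of_castSucc (i : Fin n) : of i.castSucc = .castSucc i := Fin.lastCases_castSucc _

theorem of_last : of (Fin.last n) = .last := Fin.lastCases_last

end FinPos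

namespace Multi

variable {n : ℕ}

/-- All factors but the last. -/
abbrev initFam (C : Fin (n + 1) → TwoCat.{u}) : Fin n → TwoCat.{u} := fun i => C i.castSucc

variable {C : Fin (n + 1) → TwoCat.{u}}

namespace Obj

/-- All entries but the last. -/
def init (a : Obj C) : Obj (initFam C) := ⟨fun i => a.val i.castSucc⟩

/-- The last entry. -/
def last (a : Obj C) : C (Fin.last n) := a.val (Fin.last n)

/-- The tuple with a given last entry and given other entries. -/
def snoc (a : Obj (initFam C)) (d : C (Fin.last n)) : Obj C :=
  ⟨Fin.snoc (α := fun i => C i) a.val d⟩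

theorem snoc_val_castSucc (a : Obj (initFam C)) (d : C (Fin.last n)) (i : Fin n) :
    (snoc a d).val i.castSucc = a.val i :=
  Fin.snoc_castSucc (α := fun i => C i) ..

theorem snoc_val_last (a : Obj (initFam C)) (d : C (Fin.last n)) :
    (snoc a d).val (Fin.last n) = d :=
  Fin.snoc_last (α := fun i => C i) ..

theorem init_snoc (a : Obj (initFam C)) (d : C (Fin.last n)) : (snoc a d).init = a :=
  Obj.ext (funext fun i => snoc_val_castSucc a d i)

theorem last_snoc (a : Obj (initFam C)) (d : C (Fin.last n)) : (snoc a d).last = d :=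
  snoc_val_last a d

theorem snoc_init_last (a : Obj C) : snoc a.init a.last = a :=
  Obj.ext (Fin.snoc_init_self (α := fun i => C i) a.val)

end Obj

open Obj

theorem IsStep.init {i : Fin n} {x y : C i.castSucc} {a b : Obj C}
    (h : IsStep i.castSucc x y a b) : IsStep (C := initFam C) i x y a.init b.init :=
  ⟨h.src, h.tgt, fun _ hj => h.off _ fun e => hj (Fin.castSucc_injective _ e)⟩

theorem IsStep.last_eq {i : Fin n} {x y : C i.castSucc} {a b : Obj C}
    (h : IsStep i.castSucc x y a b) : a.last = b.last :=
  h.off _ (Fin.castSucc_ne_last i).symm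

theorem IsStep.init_eq {x y : C (Fin.last n)} {a b : Obj C}
    (h : IsStep (Fin.last n) x y a b) : a.init = b.init :=
  Obj.ext (funext fun i => h.off _ (Fin.castSucc_ne_last i))

theorem IsStep.snoc {i : Fin n} {x y : C i.castSucc} {a b : Obj (initFam C)}
    (h : IsStep (C := initFam C) i x y a b) (d : C (Fin.last n)) :
    IsStep i.castSucc x y (snoc a d) (snoc b d) where
  src := (snoc_val_castSucc a d i).trans h.src
  tgt := (snoc_val_castSucc b d i).trans h.tgt
  off j hj := by
    cases FinPos.of j with
    | castSucc j =>
      rw [snoc_val_castSucc, snoc_val_castSucc]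
      exact h.off j fun e => hj (congrArg _ e)
    | last => rw [snoc_val_last, snoc_val_last]

theorem isStep_last (a : Obj (initFam C)) (d d' : C (Fin.last n)) :
    IsStep (Fin.last n) d d' (snoc a d) (snoc a d') where
  src := snoc_val_last a d
  tgt := snoc_val_last a d'
  off j hj := by
    cases FinPos.of j with
    | castSucc j => rw [snoc_val_castSucc, snoc_val_castSucc]
    | last => exact absurd rfl hj

theorem IsStep.square_last {i : Fin n} {x y : C i.castSucc} {a b : Obj (initFam C)}
    (h : IsStep (C := initFam C) i x y a b) (d d' : C (Fin.last n)) :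
    IsSquare i.castSucc (Fin.last n) x y d d' (Obj.snoc a d) (Obj.snoc b d) (Obj.snoc a d')
      (Obj.snoc b d') :=
  ⟨h.snoc d, isStep_last a d d', isStep_last b d d', h.snoc d'⟩

theorem IsSquare.snoc {i j : Fin n} {x x' : C i.castSucc} {y y' : C j.castSucc}
    {a b c e : Obj (initFam C)} (s : IsSquare (C := initFam C) i j x x' y y' a b c e)
    (d : C (Fin.last n)) :
    IsSquare i.castSucc j.castSucc x x' y y' (snoc a d) (snoc b d) (snoc c d) (snoc e d) :=
  ⟨s.ab.snoc d, s.ac.snoc d, s.bd.snoc d, s.cd.snoc d⟩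

end Multi

/-! ### Cells of the lax Gray tensor product between propositionally equal 0-cells -/

namespace Gray

variable {B D : TwoCat.{u}}

/-- The 1-cell `(f, Id)`. -/
def leftCast {b b' : B} (f : b ⟶ b') {d e : D} (h : d = e) : pt b d ⟶ pt b' e :=
  Eq.rec (motive := fun e _ => pt b d ⟶ pt b' e) (left f d) h

/-- The 2-cell `(φ, Id)`. -/
def leftCast₂ {b b' : B} {f f' : b ⟶ b'} (φ : f ⟶ f') {d e : D} (h : d = e) :
    leftCast f h ⟶ leftCast f' h :=
  Eq.rec (motive := fun _ h => leftCast f h ⟶ leftCast f' h) (left₂ φ d) h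

theorem leftCast_comp {b b' b'' : B} (f : b ⟶ b') (f' : b' ⟶ b'') {d d' d'' : D} (h : d = d')
    (h' : d' = d'') : leftCast (f ≫ f') (h.trans h') = leftCast f h ≫ leftCast f' h' := by
  subst h h'; exact left_comp f f' d

end Gray

namespace MultiData

open Multi

variable {n : ℕ} {C : Fin (n + 1) → TwoCat.{u}} {B : TwoCat.{u}}

/-- `IsStep` for a tuple whose last entry has been split off. -/
def SplitStep : ∀ {i : Fin (n + 1)}, FinPos i → (x y : C i) → (a b : Obj (initFam C)) →
    (d e : C (Fin.last n)) → Prop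
  | _, .castSucc i, x, y, a, b, d, e => IsStep (C := initFam C) i x y a b ∧ d = e
  | _, .last, x, y, a, b, d, e => a = b ∧ d = x ∧ e = y

theorem splitStep {i : Fin (n + 1)} (p : FinPos i) {x y : C i} {a b : Obj C}
    (h : IsStep i x y a b) : SplitStep p x y a.init b.init a.last b.last := by
  cases p with
  | castSucc i => exact ⟨h.init, h.last_eq⟩
  | last => exact ⟨h.init_eq, h.src, h.tgt⟩

variable (X : MultiData (initFam C) B)

/-- The 1-cell `(Id, g)`. -/
def rightCast {a b : Obj (initFam C)} {x y d e : C (Fin.last n)} (g : x ⟶ y)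
    (h : a = b ∧ d = x ∧ e = y) : Gray.pt (X.obj a) d ⟶ Gray.pt (X.obj b) e :=
  Eq.rec (motive := fun b _ => Gray.pt (X.obj a) d ⟶ Gray.pt (X.obj b) e)
    (Eq.rec (motive := fun d _ => Gray.pt (X.obj a) d ⟶ Gray.pt (X.obj a) e)
      (Eq.rec (motive := fun e _ => Gray.pt (X.obj a) x ⟶ Gray.pt (X.obj a) e)
        (Gray.right (X.obj a) g) h.2.2.symm) h.2.1.symm) h.1

/-- The values of the generating 1-cells in the tensor product with the last factor. -/
def splitOne : ∀ {i : Fin (n + 1)} (p : FinPos i) {x y : C i} (_ : x ⟶ y)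
    {a b : Obj (initFam C)} {d e : C (Fin.last n)} (_ : SplitStep p x y a b d e),
    Gray.pt (X.obj a) d ⟶ Gray.pt (X.obj b) e
  | _, .castSucc _, _, _, f, _, _, _, _, h => Gray.leftCast (X.one f h.1) h.2
  | _, .last, _, _, f, _, _, _, _, h => X.rightCast f h

theorem splitOne_id {i : Fin (n + 1)} (p : FinPos i) {x : C i} {a : Obj (initFam C)}
    {d : C (Fin.last n)} (h : SplitStep p x x a a d d) :
    X.splitOne p (𝟙 x) h = 𝟙 (Gray.pt (X.obj a) d) := by
  cases p with
  | castSucc i =>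
    exact (congrArg (Gray.left · d) (X.one_id h.1)).trans (Gray.left_id _ _)
  | last =>
    -- The discarded equations have become reflexive, so the transports along them reduce by proof
    -- irrelevance.
    obtain ⟨-, rfl, -⟩ := h
    exact Gray.right_id _ _

theorem SplitStep.trans {i : Fin (n + 1)} {p : FinPos i} {x y z : C i} {a b c : Obj (initFam C)}
    {d e k : C (Fin.last n)} (h : SplitStep p x y a b d e) (h' : SplitStep p y z b c e k) :
    SplitStep p x z a c d k := by
  cases p with
  | castSucc i => exact ⟨h.1.trans h'.1, h.2.trans h'.2⟩
  | last => exact ⟨h.1.trans h'.1, h.2.1, h'.2.2⟩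

theorem splitOne_comp {i : Fin (n + 1)} (p : FinPos i) {x y z : C i} (f : x ⟶ y) (g : y ⟶ z)
    {a b c : Obj (initFam C)} {d e k : C (Fin.last n)} (h : SplitStep p x y a b d e)
    (h' : SplitStep p y z b c e k) :
    X.splitOne p (f ≫ g) (h.trans h') = X.splitOne p f h ≫ X.splitOne p g h' := by
  cases p with
  | castSucc i =>
    obtain ⟨h, rfl⟩ := h
    obtain ⟨h', rfl⟩ := h'
    exact (congrArg (Gray.left · d) (X.one_comp f g h h')).trans (Gray.left_comp _ _ _)
  | last =>
    obtain ⟨rfl, rfl, rfl⟩ := h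
    obtain ⟨rfl, -, rfl⟩ := h'
    exact Gray.right_comp _ _ _

/-- The 2-cell `(Id, ψ)`. -/
def rightCast₂ {a b : Obj (initFam C)} {x y d e : C (Fin.last n)} {g g' : x ⟶ y} (ψ : g ⟶ g')
    (h : a = b ∧ d = x ∧ e = y) : X.rightCast g h ⟶ X.rightCast g' h :=
  Eq.rec (motive := fun b hb => X.rightCast g (⟨hb, h.2⟩ : a = b ∧ d = x ∧ e = y) ⟶
      X.rightCast g' ⟨hb, h.2⟩)
    (Eq.rec (motive := fun d (hd : x = d) =>
        X.rightCast g (⟨rfl, hd.symm, h.2.2⟩ : a = a ∧ d = x ∧ e = y) ⟶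
          X.rightCast g' ⟨rfl, hd.symm, h.2.2⟩)
      (Eq.rec (motive := fun e (he : y = e) =>
          X.rightCast g (⟨rfl, rfl, he.symm⟩ : a = a ∧ x = x ∧ e = y) ⟶
            X.rightCast g' ⟨rfl, rfl, he.symm⟩)
        (Gray.right₂ (X.obj a) ψ) h.2.2.symm) h.2.1.symm) h.1

/-- The values of the generating 2-cells `{φ}ᵢ` in the tensor product with the last factor. -/
def splitTwo : ∀ {i : Fin (n + 1)} (p : FinPos i) {x y : C i} {f g : x ⟶ y} (_ : f ⟶ g)
    {a b : Obj (initFam C)} {d e : C (Fin.last n)} (h : SplitStep p x y a b d e),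
    X.splitOne p f h ⟶ X.splitOne p g h
  | _, .castSucc _, _, _, _, _, φ, _, _, _, _, h => Gray.leftCast₂ (X.two φ h.1) h.2
  | _, .last, _, _, _, _, φ, _, _, _, _, h => X.rightCast₂ φ h

theorem splitTwo_id {i : Fin (n + 1)} (p : FinPos i) {x y : C i} (f : x ⟶ y)
    {a b : Obj (initFam C)} {d e : C (Fin.last n)} (h : SplitStep p x y a b d e) :
    X.splitTwo p (𝟙 f) h = 𝟙 (X.splitOne p f h) := by
  cases p with
  | castSucc i =>
    obtain ⟨h, rfl⟩ := h
    exact (congrArg (Gray.left₂ · d) (X.two_id f h)).trans (Gray.left₂_id _ _)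
  | last =>
    obtain ⟨rfl, rfl, rfl⟩ := h
    exact Gray.right₂_id _ _

theorem splitTwo_comp {i : Fin (n + 1)} (p : FinPos i) {x y : C i} {f g k : x ⟶ y} (φ : f ⟶ g)
    (ψ : g ⟶ k) {a b : Obj (initFam C)} {d e : C (Fin.last n)} (h : SplitStep p x y a b d e) :
    X.splitTwo p (φ ≫ ψ) h = X.splitTwo p φ h ≫ X.splitTwo p ψ h := by
  cases p with
  | castSucc i =>
    obtain ⟨h, rfl⟩ := h
    exact (congrArg (Gray.left₂ · d) (X.two_comp φ ψ h)).trans (Gray.left₂_comp _ _ _)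
  | last =>
    obtain ⟨rfl, rfl, rfl⟩ := h
    exact Gray.right₂_comp _ _ _

/-- The family of cells `(–, Id)` with a fixed 0-cell of the last factor. -/
def leftData (d : C (Fin.last n)) : MultiData (initFam C) (gray B (C (Fin.last n))) :=
  ofFunctor (X.lift.comp (Gray.leftFunctor B d))

/-- As in the lemmas on γ that follow, a relation among positions before the last is inherited from
`X` along the strict 2-functor `Gray.leftFunctor B d`, which is what `leftData` records. Only
relations that involve the last position use the lax Gray tensor product. -/
theorem splitTwo_hcomp {i : Fin (n + 1)} (p : FinPos i) {x y z : C i} {f f' : x ⟶ y}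
    {g g' : y ⟶ z} (φ : f ⟶ f') (ψ : g ⟶ g') {a b c : Obj (initFam C)} {d e k : C (Fin.last n)}
    (h : SplitStep p x y a b d e) (h' : SplitStep p y z b c e k) :
    X.splitTwo p (φ ▷ g ≫ f' ◁ ψ) (h.trans h') = eqToHom (X.splitOne_comp p f g h h') ≫
      (X.splitTwo p φ h ▷ X.splitOne p g h' ≫ X.splitOne p f' h ◁ X.splitTwo p ψ h') ≫
        eqToHom (X.splitOne_comp p f' g' h h').symm := by
  cases p with
  | castSucc i =>
    obtain ⟨h, rfl⟩ := h
    obtain ⟨h', rfl⟩ := h'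
    exact (X.leftData d).two_hcomp φ ψ h h'
  | last =>
    obtain ⟨rfl, rfl, rfl⟩ := h
    obtain ⟨rfl, -, rfl⟩ := h'
    exact Gray.right₂_hcomp _ _ _

end MultiData

/-! ### The 2-cells γ after the last factor has been split off -/

namespace MultiData

open Multi

variable {n : ℕ} {C : Fin (n + 1) → TwoCat.{u}} {B : TwoCat.{u}}

/-- `IsSquare` for tuples whose last entries have been split off. -/
structure SplitSquare {i j : Fin (n + 1)} (p : FinPos i) (q : FinPos j) (x x' : C i) (y y' : C j)
    (a b c d : Obj (initFam C)) (a' b' c' d' : C (Fin.last n)) : Prop where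
  ab : SplitStep p x x' a b a' b'
  ac : SplitStep q y y' a c a' c'
  bd : SplitStep q y y' b d b' d'
  cd : SplitStep p x x' c d c' d'

theorem splitSquare {i j : Fin (n + 1)} (p : FinPos i) (q : FinPos j) {x x' : C i} {y y' : C j}
    {a b c d : Obj C} (s : IsSquare i j x x' y y' a b c d) :
    SplitSquare p q x x' y y' a.init b.init c.init d.init a.last b.last c.last d.last :=
  ⟨splitStep p s.ab, splitStep q s.ac, splitStep q s.bd, splitStep p s.cd⟩

theorem SplitSquare.isSquare {i j : Fin n} {x x' : C i.castSucc} {y y' : C j.castSucc}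
    {a b c d : Obj (initFam C)} {a' b' c' d' : C (Fin.last n)}
    (s : SplitSquare (.castSucc i) (.castSucc j) x x' y y' a b c d a' b' c' d') :
    IsSquare (C := initFam C) i j x x' y y' a b c d :=
  ⟨s.ab.1, s.ac.1, s.bd.1, s.cd.1⟩

theorem lt_of_castSucc_lt {i j : Fin n} (h : i.castSucc < j.castSucc) : i < j := h

theorem not_last_lt (j : Fin (n + 1)) : ¬ Fin.last n < j := (Fin.le_last j).not_gt

variable (X : MultiData (initFam C) B)

/-- The type of 2-cells `γ_{f,g}` between given tuples. -/
abbrev SwapHom {i : Fin n} {x x' : C i.castSucc} (f : x ⟶ x') {y y' : C (Fin.last n)} (g : y ⟶ y')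
    (a b c d : Obj (initFam C)) (a' b' c' d' : C (Fin.last n)) : Type u :=
  ∀ s : SplitSquare (.castSucc i) .last x x' y y' a b c d a' b' c' d',
    X.splitOne .last g s.ac ≫ X.splitOne (.castSucc i) f s.cd ⟶
      X.splitOne (.castSucc i) f s.ab ≫ X.splitOne .last g s.bd

/-- The 2-cell `γ_{f,g}`. -/
def swapCast {i : Fin n} {x x' : C i.castSucc} (f : x ⟶ x') {y y' : C (Fin.last n)} (g : y ⟶ y')
    {a b c d : Obj (initFam C)} {a' b' c' d' : C (Fin.last n)}
    (s : SplitSquare (.castSucc i) .last x x' y y' a b c d a' b' c' d') :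
    X.splitOne .last g s.ac ≫ X.splitOne (.castSucc i) f s.cd ⟶
      X.splitOne (.castSucc i) f s.ab ≫ X.splitOne .last g s.bd :=
  -- The equations in `s` identify `c` with `a`, `d` with `b`, `a'` and `b'` with `y`, and `c'` and
  -- `d'` with `y'`. `SwapHom` quantifies over the square, so these entries can be transported one
  -- at a time.
  Eq.rec (motive := fun c _ => X.SwapHom f g a b c d a' b' c' d')
    (Eq.rec (motive := fun d _ => X.SwapHom f g a b a d a' b' c' d')
      (Eq.rec (motive := fun a' _ => X.SwapHom f g a b a b a' b' c' d')
        (Eq.rec (motive := fun b' _ => X.SwapHom f g a b a b y b' c' d')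
          (Eq.rec (motive := fun c' _ => X.SwapHom f g a b a b y y c' d')
            (Eq.rec (motive := fun d' _ => X.SwapHom f g a b a b y y y' d')
              (fun s => Gray.swap (X.one f s.ab.1) g) s.bd.2.2.symm) s.ac.2.2.symm)
          s.bd.2.1.symm) s.ac.2.1.symm) s.bd.1) s.ac.1 s

/-- The values of the generating 2-cells `γ` in the tensor product with the last factor. -/
def splitSwap : ∀ {i j : Fin (n + 1)} (p : FinPos i) (q : FinPos j) (_ : i < j) {x x' : C i}
    (f : x ⟶ x') {y y' : C j} (g : y ⟶ y') {a b c d : Obj (initFam C)}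
    {a' b' c' d' : C (Fin.last n)} (s : SplitSquare p q x x' y y' a b c d a' b' c' d'),
    X.splitOne q g s.ac ≫ X.splitOne p f s.cd ⟶ X.splitOne p f s.ab ≫ X.splitOne q g s.bd
  | _, _, .castSucc _, .castSucc _, hij, _, _, f, _, _, g, _, _, _, _, _, _, _, _, s =>
      eqToHom (Gray.leftCast_comp _ _ s.ac.2 s.cd.2).symm ≫
        Gray.leftCast₂ (X.swap (lt_of_castSucc_lt hij) f g s.isSquare) (s.ac.2.trans s.cd.2) ≫
          eqToHom (Gray.leftCast_comp _ _ s.ab.2 s.bd.2)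
  | _, _, .castSucc _, .last, _, _, _, f, _, _, g, _, _, _, _, _, _, _, _, s => X.swapCast f g s
  | _, _, .last, _, hij, _, _, _, _, _, _, _, _, _, _, _, _, _, _, _ => absurd hij (not_last_lt _)

variable {X} {i j : Fin (n + 1)} (p : FinPos i) (q : FinPos j) (hij : i < j)

theorem splitSwap_id_right {x x' : C i} (f : x ⟶ x') {y : C j} {a b : Obj (initFam C)}
    {a' b' : C (Fin.last n)} (s : SplitSquare p q x x' y y a b a b a' b' a' b') :
    X.splitSwap p q hij f (𝟙 y) s = eqToHom (by
      rw [splitOne_id, splitOne_id]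
      exact (Category.id_comp _).trans (Category.comp_id _).symm) := by
  cases p with
  | last => exact absurd hij (not_last_lt _)
  | castSucc i =>
    cases q with
    | castSucc j =>
      obtain ⟨⟨hab, rfl⟩, hac, hbd, hcd⟩ := s
      exact (X.leftData a').swap_id_right hij f ⟨hab, hac.1, hbd.1, hcd.1⟩
    | last =>
      obtain ⟨⟨hab, rfl⟩, ⟨-, rfl, -⟩, -, -⟩ := s
      exact Gray.swap_id_right _ _

theorem splitSwap_id_left {x : C i} {y y' : C j} (g : y ⟶ y') {a c : Obj (initFam C)}
    {a' c' : C (Fin.last n)} (s : SplitSquare p q x x y y' a a c c a' a' c' c') :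
    X.splitSwap p q hij (𝟙 x) g s = eqToHom (by
      rw [splitOne_id, splitOne_id]
      exact (Category.comp_id _).trans (Category.id_comp _).symm) := by
  cases p with
  | last => exact absurd hij (not_last_lt _)
  | castSucc i =>
    cases q with
    | castSucc j =>
      obtain ⟨hab, ⟨hac, rfl⟩, hbd, hcd⟩ := s
      exact (X.leftData a').swap_id_left hij g ⟨hab.1, hac, hbd.1, hcd.1⟩
    | last =>
      obtain ⟨⟨hab, -⟩, ⟨rfl, rfl, rfl⟩, -, -⟩ := s
      -- `X.one (𝟙 x) hab` is an identity only propositionally; a variable in its place can be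
      -- substituted in the type of γ.
      have key : ∀ {u : X.obj a ⟶ X.obj a} (h : u = 𝟙 _), Gray.swap u g = eqToHom (by
          subst h; rw [Gray.left_id, Gray.left_id]
          exact (Category.comp_id _).trans (Category.id_comp _).symm) := by
        rintro u rfl; exact Gray.swap_id_left _ _
      exact key (X.one_id hab)

theorem SplitSquare.comp_left {x x' x'' : C i} {y y' : C j} {a b e c d k : Obj (initFam C)}
    {a' b' e' c' d' k' : C (Fin.last n)}
    {p : FinPos i} {q : FinPos j} (s : SplitSquare p q x x' y y' a b c d a' b' c' d')
    (t : SplitSquare p q x' x'' y y' b e d k b' e' d' k') :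
    SplitSquare p q x x'' y y' a e c k a' e' c' k' :=
  ⟨s.ab.trans t.ab, s.ac, t.bd, s.cd.trans t.cd⟩

theorem SplitSquare.comp_right {x x' : C i} {y y' y'' : C j} {a b c d e k : Obj (initFam C)}
    {a' b' c' d' e' k' : C (Fin.last n)}
    {p : FinPos i} {q : FinPos j} (s : SplitSquare p q x x' y y' a b c d a' b' c' d')
    (t : SplitSquare p q x x' y' y'' c d e k c' d' e' k') :
    SplitSquare p q x x' y y'' a b e k a' b' e' k' :=
  ⟨s.ab, s.ac.trans t.ac, s.bd.trans t.bd, t.cd⟩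

theorem splitSwap_comp_left {x x' x'' : C i} (f : x ⟶ x') (f' : x' ⟶ x'') {y y' : C j} (g : y ⟶ y')
    {a b e c d k : Obj (initFam C)} {a' b' e' c' d' k' : C (Fin.last n)}
    (s : SplitSquare p q x x' y y' a b c d a' b' c' d')
    (t : SplitSquare p q x' x'' y y' b e d k b' e' d' k') :
    X.splitSwap p q hij (f ≫ f') g (s.comp_left t) =
      eqToHom (by rw [splitOne_comp _ _ _ _ s.cd t.cd]; exact (Category.assoc _ _ _).symm) ≫
        X.splitSwap p q hij f g s ▷ X.splitOne p f' t.cd ≫ eqToHom (Category.assoc _ _ _) ≫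
          X.splitOne p f s.ab ◁ X.splitSwap p q hij f' g t ≫
            eqToHom (by
              rw [splitOne_comp _ _ _ _ s.ab t.ab]; exact (Category.assoc _ _ _).symm) := by
  cases p with
  | last => exact absurd hij (not_last_lt _)
  | castSucc i =>
    cases q with
    | castSucc j =>
      obtain ⟨⟨hab, rfl⟩, ⟨hac, rfl⟩, ⟨hbd, rfl⟩, hcd⟩ := s
      obtain ⟨⟨hab', rfl⟩, ⟨hac', -⟩, ⟨hbd', rfl⟩, hcd'⟩ := t
      exact (X.leftData _).swap_comp_left hij f f' g ⟨hab, hac, hbd, hcd.1⟩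
        ⟨hab', hac', hbd', hcd'.1⟩
    | last =>
      obtain ⟨⟨hab, -⟩, ⟨rfl, rfl, rfl⟩, ⟨rfl, rfl, rfl⟩, hcd⟩ := s
      obtain ⟨⟨hab', -⟩, -, ⟨rfl, rfl, rfl⟩, hcd'⟩ := t
      have key : ∀ {u : X.obj a ⟶ X.obj e} (v : X.obj a ⟶ X.obj b) (w : X.obj b ⟶ X.obj e)
          (h : u = v ≫ w), Gray.swap u g =
          eqToHom (by subst h; rw [Gray.left_comp]; exact (Category.assoc _ _ _).symm) ≫
            Gray.swap v g ▷ Gray.left w _ ≫ eqToHom (Category.assoc _ _ _) ≫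
              Gray.left v _ ◁ Gray.swap w g ≫
            eqToHom (by subst h; rw [Gray.left_comp]; exact (Category.assoc _ _ _).symm) := by
        rintro u v w rfl; exact Gray.swap_comp_left _ _ _
      exact key _ _ (X.one_comp f f' hab hab')

theorem splitSwap_comp_right {x x' : C i} (f : x ⟶ x') {y y' y'' : C j} (g : y ⟶ y')
    (g' : y' ⟶ y'') {a b c d e k : Obj (initFam C)} {a' b' c' d' e' k' : C (Fin.last n)}
    (s : SplitSquare p q x x' y y' a b c d a' b' c' d')
    (t : SplitSquare p q x x' y' y'' c d e k c' d' e' k') :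
    X.splitSwap p q hij f (g ≫ g') (s.comp_right t) =
      eqToHom (by rw [splitOne_comp _ _ _ _ s.ac t.ac]; exact Category.assoc _ _ _) ≫
        X.splitOne q g s.ac ◁ X.splitSwap p q hij f g' t ≫ eqToHom (Category.assoc _ _ _).symm ≫
          X.splitSwap p q hij f g s ▷ X.splitOne q g' t.bd ≫
            eqToHom (by rw [splitOne_comp _ _ _ _ s.bd t.bd]; exact Category.assoc _ _ _) := by
  cases p with
  | last => exact absurd hij (not_last_lt _)
  | castSucc i =>
    cases q with
    | castSucc j =>
      obtain ⟨⟨hab, rfl⟩, ⟨hac, rfl⟩, ⟨hbd, rfl⟩, hcd⟩ := s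
      obtain ⟨⟨hab', -⟩, ⟨hac', rfl⟩, ⟨hbd', rfl⟩, hcd'⟩ := t
      exact (X.leftData _).swap_comp_right hij f g g' ⟨hab, hac, hbd, hcd.1⟩
        ⟨hab', hac', hbd', hcd'.1⟩
    | last =>
      obtain ⟨⟨hab, -⟩, ⟨rfl, rfl, rfl⟩, ⟨rfl, rfl, -⟩, hcd⟩ := s
      obtain ⟨⟨hab', rfl⟩, ⟨rfl, -, rfl⟩, ⟨rfl, -, rfl⟩, hcd'⟩ := t
      exact Gray.swap_comp_right _ _ _

theorem splitSwap_naturality {x x' : C i} {f f' : x ⟶ x'} (φ : f ⟶ f') {y y' : C j}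
    {g g' : y ⟶ y'} (ψ : g ⟶ g') {a b c d : Obj (initFam C)} {a' b' c' d' : C (Fin.last n)}
    (s : SplitSquare p q x x' y y' a b c d a' b' c' d') :
    (X.splitTwo q ψ s.ac ▷ X.splitOne p f s.cd ≫ X.splitOne q g' s.ac ◁ X.splitTwo p φ s.cd) ≫
        X.splitSwap p q hij f' g' s =
      X.splitSwap p q hij f g s ≫ X.splitTwo p φ s.ab ▷ X.splitOne q g s.bd ≫
        X.splitOne p f' s.ab ◁ X.splitTwo q ψ s.bd := by
  cases p with
  | last => exact absurd hij (not_last_lt _)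
  | castSucc i =>
    cases q with
    | castSucc j =>
      obtain ⟨⟨hab, rfl⟩, ⟨hac, rfl⟩, ⟨hbd, rfl⟩, hcd⟩ := s
      exact (X.leftData _).swap_naturality hij φ ψ ⟨hab, hac, hbd, hcd.1⟩
    | last =>
      obtain ⟨⟨hab, -⟩, ⟨rfl, rfl, rfl⟩, ⟨rfl, rfl, rfl⟩, hcd⟩ := s
      exact Gray.swap_naturality _ _

end MultiData

namespace Gray

variable {B D : TwoCat.{u}}

/-- The source of the Yang–Baxter equation. The naturality square of γ_{–,h} at `σ` has γ of the two
composites `g ≫ f'` and `f ≫ g'` as sides; splitting each into two steps turns the square into the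
hexagon. -/
theorem swap_yangBaxter {b₀ b₁ b₂ b₃ : B} {f : b₀ ⟶ b₁} {f' : b₂ ⟶ b₃} {g : b₀ ⟶ b₂}
    {g' : b₁ ⟶ b₃} (σ : g ≫ f' ⟶ f ≫ g') {d d' : D} (h : d ⟶ d') :
    swap g h ▷ left f' d' ≫ eqToHom (Category.assoc _ _ _) ≫ left g d ◁ swap f' h ≫
        eqToHom (Category.assoc _ _ _).symm ≫
          (eqToHom (left_comp g f' d).symm ≫ left₂ σ d ≫ eqToHom (left_comp f g' d)) ▷ right b₃ h =
      eqToHom (Category.assoc _ _ _) ≫ right b₀ h ◁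
          (eqToHom (left_comp g f' d').symm ≫ left₂ σ d' ≫ eqToHom (left_comp f g' d')) ≫
        eqToHom (Category.assoc _ _ _).symm ≫ swap f h ▷ left g' d' ≫
          eqToHom (Category.assoc _ _ _) ≫ left f d ◁ swap g' h ≫
            eqToHom (Category.assoc _ _ _).symm := by
  -- The identity on `h` isolates naturality in the first argument.
  have e := swap_naturality σ (𝟙 h)
  rw [right₂_id, right₂_id, id_whiskerRight, whiskerLeft_id, Category.comp_id, Category.id_comp,
    swap_comp_left, swap_comp_left] at e
  have p : (right b₀ h ≫ left g d') ≫ left f' d' = right b₀ h ≫ left (g ≫ f') d' := by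
    rw [left_comp]; exact Category.assoc _ _ _
  have q : left (f ≫ g') d ≫ right b₃ h = (left f d ≫ left g' d) ≫ right b₃ h := by
    rw [left_comp]
  have e' := congrArg (fun x => eqToHom p ≫ x ≫ eqToHom q) e
  simpa using e'.symm

end Gray

namespace MultiData

open Multi

variable {n : ℕ} {C : Fin (n + 1) → TwoCat.{u}} {B : TwoCat.{u}}
  (X : MultiData (initFam C) B)

/-- Since `i < j < k`, only `k` can be the last position. If it is, the equation is
`Gray.swap_yangBaxter` for the 2-cell γ^{i,j}; otherwise it is inherited from `X`. -/
theorem splitSwap_yangBaxter {i j k : Fin (n + 1)} (p : FinPos i) (q : FinPos j) (r : FinPos k)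
    (hij : i < j) (hjk : j < k) {x x' : C i} (f : x ⟶ x') {y y' : C j} (g : y ⟶ y') {z z' : C k}
    (h : z ⟶ z') {a₀₀₀ a₁₀₀ a₀₁₀ a₁₁₀ a₀₀₁ a₁₀₁ a₀₁₁ a₁₁₁ : Obj (initFam C)}
    {d₀₀₀ d₁₀₀ d₀₁₀ d₁₁₀ d₀₀₁ d₁₀₁ d₀₁₁ d₁₁₁ : C (Fin.last n)}
    (sij : SplitSquare p q x x' y y' a₀₀₀ a₁₀₀ a₀₁₀ a₁₁₀ d₀₀₀ d₁₀₀ d₀₁₀ d₁₁₀)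
    (sij' : SplitSquare p q x x' y y' a₀₀₁ a₁₀₁ a₀₁₁ a₁₁₁ d₀₀₁ d₁₀₁ d₀₁₁ d₁₁₁)
    (sik : SplitSquare p r x x' z z' a₀₀₀ a₁₀₀ a₀₀₁ a₁₀₁ d₀₀₀ d₁₀₀ d₀₀₁ d₁₀₁)
    (sik' : SplitSquare p r x x' z z' a₀₁₀ a₁₁₀ a₀₁₁ a₁₁₁ d₀₁₀ d₁₁₀ d₀₁₁ d₁₁₁)
    (sjk : SplitSquare q r y y' z z' a₀₀₀ a₀₁₀ a₀₀₁ a₀₁₁ d₀₀₀ d₀₁₀ d₀₀₁ d₀₁₁)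
    (sjk' : SplitSquare q r y y' z z' a₁₀₀ a₁₁₀ a₁₀₁ a₁₁₁ d₁₀₀ d₁₁₀ d₁₀₁ d₁₁₁) :
    X.splitSwap q r hjk g h sjk ▷ X.splitOne p f sij'.cd ≫ eqToHom (Category.assoc _ _ _) ≫
        X.splitOne q g sij.ac ◁ X.splitSwap p r (hij.trans hjk) f h sik' ≫
          eqToHom (Category.assoc _ _ _).symm ≫
            X.splitSwap p q hij f g sij ▷ X.splitOne r h sjk'.bd =
      eqToHom (Category.assoc _ _ _) ≫ X.splitOne r h sik.ac ◁ X.splitSwap p q hij f g sij' ≫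
        eqToHom (Category.assoc _ _ _).symm ≫
          X.splitSwap p r (hij.trans hjk) f h sik ▷ X.splitOne q g sij'.bd ≫
            eqToHom (Category.assoc _ _ _) ≫ X.splitOne p f sij.ab ◁ X.splitSwap q r hjk g h sjk' ≫
              eqToHom (Category.assoc _ _ _).symm := by
  cases p with
  | last => exact absurd hij (not_last_lt _)
  | castSucc i =>
  cases q with
  | last => exact absurd hjk (not_last_lt _)
  | castSucc j =>
  cases r with
  | castSucc k =>
    obtain ⟨⟨h₁, rfl⟩, ⟨h₂, rfl⟩, ⟨h₃, rfl⟩, ⟨h₄, -⟩⟩ := sij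
    obtain ⟨⟨k₁, e⟩, ⟨k₂, e'⟩, ⟨k₃, e''⟩, ⟨k₄, -⟩⟩ := sij'
    obtain ⟨⟨l₁, -⟩, ⟨l₂, rfl⟩, ⟨l₃, -⟩, ⟨l₄, -⟩⟩ := sik
    subst e e' e''
    obtain ⟨⟨m₁, -⟩, ⟨m₂, -⟩, ⟨m₃, -⟩, ⟨m₄, -⟩⟩ := sik'
    obtain ⟨⟨n₁, -⟩, ⟨n₂, -⟩, ⟨n₃, -⟩, ⟨n₄, -⟩⟩ := sjk
    obtain ⟨⟨o₁, -⟩, ⟨o₂, -⟩, ⟨o₃, -⟩, ⟨o₄, -⟩⟩ := sjk'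
    exact (X.leftData _).yangBaxter hij hjk f g h ⟨h₁, h₂, h₃, h₄⟩ ⟨k₁, k₂, k₃, k₄⟩
      ⟨l₁, l₂, l₃, l₄⟩ ⟨m₁, m₂, m₃, m₄⟩ ⟨n₁, n₂, n₃, n₄⟩ ⟨o₁, o₂, o₃, o₄⟩
  | last =>
    obtain ⟨-, ⟨rfl, rfl, rfl⟩, ⟨rfl, e, e'⟩, -⟩ := sik
    obtain ⟨⟨h₁, e₁⟩, ⟨h₂, e₂⟩, ⟨h₃, e₃⟩, h₄⟩ := sij
    subst e₁ e₂ e₃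
    obtain ⟨-, ⟨rfl, -, e₁⟩, ⟨rfl, -, e₂⟩, -⟩ := sik'
    subst e' e₁ e₂
    exact Gray.swap_yangBaxter (X.swap hij f g ⟨h₁, h₂, h₃, h₄.1⟩) h

/-- The values of the generators of `multiGray C` in the tensor product with the last factor, given
the values of the generators for all factors but the last. -/
def split : MultiData C (gray B (C (Fin.last n))) where
  obj a := Gray.pt (X.obj a.init) a.last
  one f _ _ h := X.splitOne (.of _) f (splitStep _ h)
  one_id h := X.splitOne_id _ (splitStep _ h)
  one_comp f g _ _ _ h h' := X.splitOne_comp _ f g (splitStep _ h) (splitStep _ h')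
  two φ _ _ h := X.splitTwo (.of _) φ (splitStep _ h)
  two_id f _ _ h := X.splitTwo_id _ f (splitStep _ h)
  two_comp φ ψ _ _ h := X.splitTwo_comp _ φ ψ (splitStep _ h)
  two_hcomp φ ψ _ _ _ h h' := X.splitTwo_hcomp _ φ ψ (splitStep _ h) (splitStep _ h')
  swap hij _ _ f _ _ g _ _ _ _ s := X.splitSwap (.of _) (.of _) hij f g (splitSquare _ _ s)
  swap_id_right hij _ _ f _ _ _ s := splitSwap_id_right _ _ hij f (splitSquare _ _ s)
  swap_id_left hij _ _ _ g _ _ s := splitSwap_id_left _ _ hij g (splitSquare _ _ s)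
  swap_comp_left hij _ _ _ f f' _ _ g _ _ _ _ _ _ s t :=
    splitSwap_comp_left _ _ hij f f' g (splitSquare _ _ s) (splitSquare _ _ t)
  swap_comp_right hij _ _ f _ _ _ g g' _ _ _ _ _ _ s t :=
    splitSwap_comp_right _ _ hij f g g' (splitSquare _ _ s) (splitSquare _ _ t)
  swap_naturality hij _ _ _ _ φ _ _ _ _ ψ _ _ _ _ s :=
    splitSwap_naturality _ _ hij φ ψ (splitSquare _ _ s)
  yangBaxter hij hjk _ _ f _ _ g _ _ h _ _ _ _ _ _ _ _ sij sij' sik sik' sjk sjk' :=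
    X.splitSwap_yangBaxter _ _ _ hij hjk f g h (splitSquare _ _ sij) (splitSquare _ _ sij')
      (splitSquare _ _ sik) (splitSquare _ _ sik') (splitSquare _ _ sjk) (splitSquare _ _ sjk')

end MultiData

/-! ### Families of cells with values in the 2-category of oplax functors -/

namespace oplaxHom

variable {D E : TwoCat.{u}}

/-- The unit axiom of an oplax transformation between strict 2-functors, with `p` and `q` in the
role of the images of an identity. As variables these can be substituted; the next lemma treats
composites likewise. -/
theorem eqToHom_naturality_id {a b : E} (f : a ⟶ b) {p : a ⟶ a} {q : b ⟶ b} (hp : p = 𝟙 a)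
    (hq : q = 𝟙 b) (h : p ≫ f = f ≫ q) :
    eqToHom h ≫ f ◁ eqToHom hq = eqToHom hp ▷ f ≫ (λ_ f).hom ≫ (ρ_ f).inv := by
  subst hp hq
  simp [Strict.leftUnitor_eqToIso, Strict.rightUnitor_eqToIso]

theorem eqToHom_naturality_comp {a b c a' b' c' : E} {f : a ⟶ a'} {f' : b ⟶ b'} {f'' : c ⟶ c'}
    {g : a ⟶ b} {h : b ⟶ c} {g' : a' ⟶ b'} {h' : b' ⟶ c'} (η : g ≫ f' ⟶ f ≫ g')
    (θ : h ≫ f'' ⟶ f' ≫ h') {p : a ⟶ c} {q : a' ⟶ c'} (hp : p = g ≫ h) (hq : q = g' ≫ h')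
    (e : p ≫ f'' = g ≫ h ≫ f'') (e' : (f ≫ g') ≫ h' = f ≫ q) :
    (eqToHom e ≫ g ◁ θ ≫ eqToHom (Strict.assoc _ _ _).symm ≫ η ▷ h' ≫ eqToHom e') ≫
        f ◁ eqToHom hq =
      eqToHom hp ▷ f'' ≫ (α_ _ _ _).hom ≫ g ◁ θ ≫ (α_ _ _ _).inv ≫ η ▷ h' ≫
        (α_ _ _ _).hom := by
  subst hp hq
  simp [Strict.associator_eqToIso]

theorem eqToHom_conj_heq {a b : E} {f f' g g' h h' k k' : a ⟶ b} (η : g ⟶ h) (θ : h' ⟶ k)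
    (p : f = g) (p' : f' = g) (q : h = h') (r : k = k') (r' : k = g') :
    HEq (eqToHom p ≫ η ≫ eqToHom q ≫ θ ≫ eqToHom r)
      (eqToHom p' ≫ η ≫ eqToHom q ≫ θ ≫ eqToHom r') := by
  subst p p' r r'; rfl

/-- Moving one associativity cell across identifies the Yang–Baxter equation at the last position
with the modification axiom: `σ` and `τ` are γ^{i,j} at two 0-cells of the last factor, and `η`,
`η'`, `θ`, `θ'` are the naturality 2-cells. -/
theorem modification_of_yangBaxter {a₀ a₁ a₂ a₃ b₀ b₁ b₂ b₃ : E} {f : a₀ ⟶ a₁} {f' : a₂ ⟶ a₃}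
    {g : a₀ ⟶ a₂} {g' : a₁ ⟶ a₃} {k : b₀ ⟶ b₁} {k' : b₂ ⟶ b₃} {l : b₀ ⟶ b₂} {l' : b₁ ⟶ b₃}
    {h₀ : a₀ ⟶ b₀} {h₁ : a₁ ⟶ b₁} {h₂ : a₂ ⟶ b₂} {h₃ : a₃ ⟶ b₃} {σ : g ≫ f' ⟶ f ≫ g'}
    {τ : l ≫ k' ⟶ k ≫ l'} {η : h₀ ≫ l ⟶ g ≫ h₂} {η' : h₁ ≫ l' ⟶ g' ≫ h₃} {θ : h₀ ≫ k ⟶ f ≫ h₁}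
    {θ' : h₂ ≫ k' ⟶ f' ≫ h₃}
    (e : η ▷ k' ≫ eqToHom (Strict.assoc _ _ _) ≫ g ◁ θ' ≫ eqToHom (Strict.assoc _ _ _).symm ≫
        σ ▷ h₃ = eqToHom (Strict.assoc _ _ _) ≫ h₀ ◁ τ ≫ eqToHom (Strict.assoc _ _ _).symm ≫
          θ ▷ l' ≫ eqToHom (Strict.assoc _ _ _) ≫ f ◁ η' ≫ eqToHom (Strict.assoc _ _ _).symm) :
    h₀ ◁ τ ≫ eqToHom (Strict.assoc _ _ _).symm ≫ θ ▷ l' ≫ eqToHom (Strict.assoc _ _ _) ≫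
        f ◁ η' ≫ eqToHom (Strict.assoc _ _ _).symm =
      (eqToHom (Strict.assoc _ _ _).symm ≫ η ▷ k' ≫ eqToHom (Strict.assoc _ _ _) ≫ g ◁ θ' ≫
        eqToHom (Strict.assoc _ _ _).symm) ≫ σ ▷ h₃ := by
  rw [← cancel_epi (eqToHom (Strict.assoc h₀ l k')), ← e]
  simp

/-- The oplax transformation between strict 2-functors with given components. -/
def mkHom {F G : StrictPseudofunctor D E} (app : ∀ d, F.obj d ⟶ G.obj d)
    (nat : ∀ {d d' : D} (g : d ⟶ d'), F.map g ≫ app d' ⟶ app d ≫ G.map g)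
    (nat_naturality : ∀ {d d' : D} {g g' : d ⟶ d'} (ψ : g ⟶ g'),
      F.map₂ ψ ▷ app d' ≫ nat g' = nat g ≫ app d ◁ G.map₂ ψ)
    (nat_id : ∀ d, nat (𝟙 d) = eqToHom (by
      rw [F.map_id, G.map_id]; exact (Strict.id_comp _).trans (Strict.comp_id _).symm))
    (nat_comp : ∀ {d d' d'' : D} (g : d ⟶ d') (g' : d' ⟶ d''), nat (g ≫ g') =
      eqToHom (by rw [F.map_comp]; exact Strict.assoc _ _ _) ≫ F.map g ◁ nat g' ≫
        eqToHom (Strict.assoc _ _ _).symm ≫ nat g ▷ G.map g' ≫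
          eqToHom (by rw [G.map_comp]; exact Strict.assoc _ _ _)) :
    ofStrict F ⟶ ofStrict G :=
  show F.toPseudofunctor.toOplax ⟶ G.toPseudofunctor.toOplax from
  { app := app
    naturality := nat
    naturality_naturality := nat_naturality
    naturality_id := fun d =>
      (congrArg₂ (fun x y => x ≫ app d ◁ y) (nat_id d) ((isStrict_ofStrict G).mapId_eq d)).trans
        ((eqToHom_naturality_id _ (F.map_id d) (G.map_id d) _).trans
          (congrArg (· ▷ app d ≫ _) ((isStrict_ofStrict F).mapId_eq d).symm))
    naturality_comp := fun {d _ d''} g g' =>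
      (congrArg₂ (fun x y => x ≫ app d ◁ y) (nat_comp g g')
        ((isStrict_ofStrict G).mapComp_eq g g')).trans
          ((eqToHom_naturality_comp (nat g) (nat g') (F.map_comp g g') (G.map_comp g g') _ _).trans
            (congrArg (· ▷ app d'' ≫ _) ((isStrict_ofStrict F).mapComp_eq g g').symm)) }

/-- The modification with given components. -/
def mkHom₂ {F G : oplaxHom D E} {η θ : F ⟶ G} (app' : ∀ d, app η d ⟶ app θ d)
    (h : ∀ {d d' : D} (g : d ⟶ d'),
      (toOplax F).map g ◁ app' d' ≫ nat θ g = nat η g ≫ app' d ▷ (toOplax G).map g) : η ⟶ θ :=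
  Oplax.OplaxTrans.Hom.of (F := toOplax F) (G := toOplax G) { app := app', naturality := h }

theorem hom_ext {F G : oplaxHom D E} {η θ : F ⟶ G} (happ : ∀ d, app η d = app θ d)
    (hnat : ∀ {d d' : D} (g : d ⟶ d'), HEq (nat η g) (nat θ g)) : η = θ :=
  OplaxHom.trans_ext D E (F := toOplax F) (G := toOplax G) happ hnat

theorem hom₂_ext {F G : oplaxHom D E} {η θ : F ⟶ G} {Γ Γ' : η ⟶ θ}
    (h : ∀ d, app₂ Γ d = app₂ Γ' d) : Γ = Γ' :=
  Oplax.OplaxTrans.homCategory.ext (F := toOplax F) (G := toOplax G) h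

end oplaxHom

/-! ### Currying a family of cells in the last factor -/

namespace MultiData

open Multi oplaxHom

variable {n : ℕ} {C : Fin (n + 1) → TwoCat.{u}} {E : TwoCat.{u}} (Y : MultiData C E)

/-- The strict 2-functor on the last factor given by 0-cells of the other factors. -/
def row (a : Obj (initFam C)) : StrictPseudofunctor (C (Fin.last n)) E :=
  StrictPseudofunctor.mk''
  { obj := fun d => Y.obj (a.snoc d)
    map := fun g => Y.one g (isStep_last a _ _)
    map₂ := fun ψ => Y.two ψ (isStep_last a _ _)
    map₂_id := fun g => Y.two_id g _
    map₂_comp := fun ψ ψ' => Y.two_comp ψ ψ' _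
    map_id := fun d => Y.one_id _
    map_comp := fun g g' => Y.one_comp g g' _ _
    map₂_whisker_left := fun g _ _ ψ => by
      simpa [Y.two_id] using Y.two_hcomp (𝟙 g) ψ (isStep_last a _ _) (isStep_last a _ _)
    map₂_whisker_right := fun ψ g => by
      simpa [Y.two_id] using Y.two_hcomp ψ (𝟙 g) (isStep_last a _ _) (isStep_last a _ _) }

/-- The oplax transformation given by a 1-cell of one of the factors but the last. -/
def curryOne {i : Fin n} {x y : C i.castSucc} (f : x ⟶ y) {a b : Obj (initFam C)}
    (h : IsStep (C := initFam C) i x y a b) : ofStrict (Y.row a) ⟶ ofStrict (Y.row b) :=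
  mkHom (fun d => Y.one f (h.snoc d))
    (fun g => Y.swap (Fin.castSucc_lt_last i) f g (h.square_last _ _))
    (fun ψ => by
      -- Naturality in the last factor alone; the identity on `f` removes the other factor's
      -- contribution.
      have e := Y.swap_naturality (Fin.castSucc_lt_last i) (𝟙 f) ψ (h.square_last _ _)
      rw [Y.two_id, Y.two_id, whiskerLeft_id, id_whiskerRight, Category.comp_id,
        Category.id_comp] at e
      exact e)
    (fun d => Y.swap_id_right _ f (h.square_last d d))
    (fun g g' => Y.swap_comp_right _ f g g' (h.square_last _ _) (h.square_last _ _))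

/-- The relations for γ in its second argument made `curryOne` an oplax transformation. Those in its
first argument enter here and in `curryOne_comp`, as functoriality. -/
theorem curryOne_id {i : Fin n} {x : C i.castSucc} {a : Obj (initFam C)}
    (h : IsStep (C := initFam C) i x x a a) : Y.curryOne (𝟙 x) h = 𝟙 (ofStrict (Y.row a)) :=
  hom_ext (fun d => Y.one_id _) fun g => by
    rw [nat_id]
    refine (heq_of_eq (Y.swap_id_left (Fin.castSucc_lt_last i) g (h.square_last _ _))).trans ?_
    exact eqToHom_heq rfl rfl (heq_of_eq (congrArg (_ ≫ ·) (Y.one_id _))) _ _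

theorem curryOne_comp {i : Fin n} {x y z : C i.castSucc} (f : x ⟶ y) (g : y ⟶ z)
    {a b c : Obj (initFam C)} (h : IsStep (C := initFam C) i x y a b)
    (h' : IsStep (C := initFam C) i y z b c) :
    Y.curryOne (f ≫ g) (h.trans h') = Y.curryOne f h ≫ Y.curryOne g h' :=
  hom_ext (fun d => Y.one_comp f g _ _) fun g' => by
    rw [nat_comp]
    refine (heq_of_eq (Y.swap_comp_left (Fin.castSucc_lt_last i) f g g' (h.square_last _ _)
      (h'.square_last _ _))).trans ?_
    exact eqToHom_conj_heq _ _ _ _ _ _ _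

/-- The modification given by a 2-cell of one of the factors but the last. -/
def curryTwo {i : Fin n} {x y : C i.castSucc} {f g : x ⟶ y} (φ : f ⟶ g) {a b : Obj (initFam C)}
    (h : IsStep (C := initFam C) i x y a b) : Y.curryOne f h ⟶ Y.curryOne g h :=
  mkHom₂ (fun d => Y.two φ (h.snoc d)) fun k => by
    -- The complementary special case: with the identity on `k`, naturality of γ in `φ` is the
    -- modification axiom.
    have e := Y.swap_naturality (Fin.castSucc_lt_last i) φ (𝟙 k) (h.square_last _ _)
    rw [Y.two_id, Y.two_id, id_whiskerRight, whiskerLeft_id, Category.id_comp,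
      Category.comp_id] at e
    exact e

/-- The modification given by 1-cells of two of the factors but the last. -/
def currySwap {i j : Fin n} (hij : i < j) {x x' : C i.castSucc} (f : x ⟶ x') {y y' : C j.castSucc}
    (g : y ⟶ y') {a b c d : Obj (initFam C)}
    (s : IsSquare (C := initFam C) i j x x' y y' a b c d) :
    Y.curryOne g s.ac ≫ Y.curryOne f s.cd ⟶ Y.curryOne f s.ab ≫ Y.curryOne g s.bd :=
  mkHom₂ (fun d => Y.swap (Fin.castSucc_lt_castSucc_iff.2 hij) f g (s.snoc d)) fun k => by
    rw [nat_comp, nat_comp]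
    exact modification_of_yangBaxter (Y.yangBaxter (Fin.castSucc_lt_castSucc_iff.2 hij)
      (Fin.castSucc_lt_last j) f g k (s.snoc _) (s.snoc _) (s.ab.square_last _ _)
      (s.cd.square_last _ _) (s.ac.square_last _ _) (s.bd.square_last _ _))

/-- The values of the generators for all factors but the last in the 2-category of oplax functors
on the last factor. -/
def curry : MultiData (initFam C) (oplaxHom (C (Fin.last n)) E) where
  obj a := ofStrict (Y.row a)
  one f _ _ h := Y.curryOne f h
  one_id h := Y.curryOne_id h
  one_comp f g _ _ _ h h' := Y.curryOne_comp f g h h'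
  two φ _ _ h := Y.curryTwo φ h
  -- Modifications are equal if their components are, and at a 0-cell `d` each relation is the same
  -- relation of `Y` for the tuples extended by `d`.
  two_id f _ _ h := hom₂_ext fun d => Y.two_id f (h.snoc d)
  two_comp φ ψ _ _ h := hom₂_ext fun d => Y.two_comp φ ψ (h.snoc d)
  two_hcomp φ ψ _ _ _ h h' := hom₂_ext fun d => by
    simp only [app₂_comp, app₂_eqToHom]
    exact Y.two_hcomp φ ψ (h.snoc d) (h'.snoc d)
  swap hij _ _ f _ _ g _ _ _ _ s := Y.currySwap hij f g s
  swap_id_right hij _ _ f _ _ _ s := hom₂_ext fun d => by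
    rw [app₂_eqToHom]
    exact Y.swap_id_right (Fin.castSucc_lt_castSucc_iff.2 hij) f (s.snoc d)
  swap_id_left hij _ _ _ g _ _ s := hom₂_ext fun d => by
    rw [app₂_eqToHom]
    exact Y.swap_id_left (Fin.castSucc_lt_castSucc_iff.2 hij) g (s.snoc d)
  swap_comp_left hij _ _ _ f f' _ _ g _ _ _ _ _ _ s t := hom₂_ext fun d => by
    simp only [app₂_comp, app₂_eqToHom]
    exact Y.swap_comp_left (Fin.castSucc_lt_castSucc_iff.2 hij) f f' g (s.snoc d) (t.snoc d)
  swap_comp_right hij _ _ f _ _ _ g g' _ _ _ _ _ _ s t := hom₂_ext fun d => by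
    simp only [app₂_comp, app₂_eqToHom]
    exact Y.swap_comp_right (Fin.castSucc_lt_castSucc_iff.2 hij) f g g' (s.snoc d) (t.snoc d)
  swap_naturality hij _ _ _ _ φ _ _ _ _ ψ _ _ _ _ s := hom₂_ext fun d =>
    Y.swap_naturality (Fin.castSucc_lt_castSucc_iff.2 hij) φ ψ (s.snoc d)
  yangBaxter hij hjk _ _ f _ _ g _ _ h _ _ _ _ _ _ _ _ sij sij' sik sik' sjk sjk' :=
    hom₂_ext fun d => by
      simp only [app₂_comp, app₂_eqToHom]
      exact Y.yangBaxter (Fin.castSucc_lt_castSucc_iff.2 hij) (Fin.castSucc_lt_castSucc_iff.2 hjk)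
        f g h (sij.snoc d) (sij'.snoc d) (sik.snoc d) (sik'.snoc d) (sjk.snoc d) (sjk'.snoc d)

end MultiData

/-! ### The explicit presentation and the tensor product with the last factor -/

namespace oplaxHom

variable {K D E : TwoCat.{u}} {S T : StrictPseudofunctor K (oplaxHom D E)}

/-- These congruences read an equation of 2-functors into `oplaxHom D E` componentwise. They are
applied to `F.comp H = Y.curry.lift`, whose right side has known components on generators. -/
theorem obj_congr (h : S = T) (a : K) (d : D) :
    (toOplax (S.obj a)).obj d = (toOplax (T.obj a)).obj d := by subst h; rfl

theorem map_congr (h : S = T) (a : K) {d d' : D} (g : d ⟶ d') :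
    HEq ((toOplax (S.obj a)).map g) ((toOplax (T.obj a)).map g) := by subst h; rfl

theorem map₂_congr (h : S = T) (a : K) {d d' : D} {g g' : d ⟶ d'} (ψ : g ⟶ g') :
    HEq ((toOplax (S.obj a)).map₂ ψ) ((toOplax (T.obj a)).map₂ ψ) := by subst h; rfl

theorem app_congr (h : S = T) {a b : K} (f : a ⟶ b) (d : D) :
    HEq (app (S.map f) d) (app (T.map f) d) := by subst h; rfl

theorem app₂_congr (h : S = T) {a b : K} {f g : a ⟶ b} (φ : f ⟶ g) (d : D) :
    HEq (app₂ (S.map₂ φ) d) (app₂ (T.map₂ φ) d) := by subst h; rfl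

theorem nat_map_congr (h : S = T) {a b : K} (f : a ⟶ b) {d d' : D} (g : d ⟶ d') :
    HEq (nat (S.map f) g) (nat (T.map f) g) := by subst h; rfl

theorem nat_source_congr (h : S = T) {a b : K} (f : a ⟶ b) {d d' : D} (g : d ⟶ d') :
    HEq ((toOplax (S.obj a)).map g ≫ app (S.map f) d')
      ((toOplax (T.obj a)).map g ≫ app (T.map f) d') := by subst h; rfl

theorem nat_target_congr (h : S = T) {a b : K} (f : a ⟶ b) {d d' : D} (g : d ⟶ d') :
    HEq (app (S.map f) d ≫ (toOplax (S.obj b)).map g)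
      (app (T.map f) d ≫ (toOplax (T.obj b)).map g) := by subst h; rfl

theorem app₂_map₂_conj_heq (S : StrictPseudofunctor K (oplaxHom D E)) {a b : K}
    {f f' g g' : a ⟶ b} (p : f' = f) (η : f ⟶ g) (q : g = g') (d : D) :
    HEq (app₂ (S.map₂ (eqToHom p ≫ η ≫ eqToHom q)) d) (app₂ (S.map₂ η) d) := by
  subst p q; simp

end oplaxHom

namespace Gray

variable {B D E : TwoCat.{u}}

theorem left₂_conj_heq {a b : B} {f f' g g' : a ⟶ b} (p : f' = f) (η : f ⟶ g) (q : g = g')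
    (d : D) : HEq (left₂ (eqToHom p ≫ η ≫ eqToHom q) d) (left₂ η d) := by
  subst p q; simp

end Gray

namespace MultiData

open Multi oplaxHom

variable {n : ℕ} {C : Fin (n + 1) → TwoCat.{u}} {B E : TwoCat.{u}}

section

variable (Y : MultiData C E)

theorem one_heq {i : Fin (n + 1)} {x y : C i} (f : x ⟶ y) {a b a' b' : Obj C} (ha : a = a')
    (hb : b = b') (h : IsStep i x y a b) (h' : IsStep i x y a' b') :
    HEq (Y.one f h) (Y.one f h') := by
  subst ha hb; rfl

theorem two_heq {i : Fin (n + 1)} {x y : C i} {f g : x ⟶ y} (φ : f ⟶ g) {a b a' b' : Obj C}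
    (ha : a = a') (hb : b = b') (h : IsStep i x y a b) (h' : IsStep i x y a' b') :
    HEq (Y.two φ h) (Y.two φ h') := by
  subst ha hb; rfl

theorem swap_heq {i j : Fin (n + 1)} (hij : i < j) {x x' : C i} (f : x ⟶ x') {y y' : C j}
    (g : y ⟶ y') {a b c d a' b' c' d' : Obj C} (ha : a = a') (hb : b = b') (hc : c = c')
    (hd : d = d') (s : IsSquare i j x x' y y' a b c d) (s' : IsSquare i j x x' y y' a' b' c' d') :
    HEq (Y.swap hij f g s) (Y.swap hij f g s') := by
  subst ha hb hc hd; rfl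

variable (F : StrictPseudofunctor (multiGray (initFam C)) B)
  (H : StrictPseudofunctor B (oplaxHom (C (Fin.last n)) E)) (hH : ∀ b, IsStrict (H.obj b))

/-- The hypothesis `hY` says that `H` extends the curried family along `F`. Uncurrying `H` therefore
sends a split generator back to the value of that generator in `Y`, component by component; the next
two lemmas do the same for 2-cells. -/
theorem uncurry_splitOne (hY : F.comp H = Y.curry.lift)
    {i : Fin (n + 1)} (p : FinPos i) {x y : C i} (f : x ⟶ y)
    {a b : Obj (initFam C)} {d e : C (Fin.last n)} (h : SplitStep p x y a b d e)
    (h' : IsStep i x y (a.snoc d) (b.snoc e)) :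
    HEq ((Gray.uncurry H hH).map ((ofFunctor F).splitOne p f h)) (Y.one f h') := by
  cases p with
  | castSucc i =>
    obtain ⟨h, rfl⟩ := h
    exact app_congr hY (MultiGray.oneCell (C := initFam C) f h) d
  | last =>
    obtain ⟨rfl, rfl, rfl⟩ := h
    exact map_congr hY (MultiGray.pt a) f

theorem uncurry_splitTwo (hY : F.comp H = Y.curry.lift)
    {i : Fin (n + 1)} (p : FinPos i) {x y : C i} {f g : x ⟶ y} (φ : f ⟶ g)
    {a b : Obj (initFam C)} {d e : C (Fin.last n)} (h : SplitStep p x y a b d e)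
    (h' : IsStep i x y (a.snoc d) (b.snoc e)) :
    HEq ((Gray.uncurry H hH).map₂ ((ofFunctor F).splitTwo p φ h)) (Y.two φ h') := by
  cases p with
  | castSucc i =>
    obtain ⟨h, rfl⟩ := h
    exact app₂_congr hY (MultiGray.twoCell (C := initFam C) φ h) d
  | last =>
    obtain ⟨rfl, rfl, rfl⟩ := h
    exact map₂_congr hY (MultiGray.pt a) φ

theorem uncurry_splitSwap (hY : F.comp H = Y.curry.lift)
    {i j : Fin (n + 1)} (p : FinPos i) (q : FinPos j) (hij : i < j)
    {x x' : C i} (f : x ⟶ x') {y y' : C j} (g : y ⟶ y') {a b c d : Obj (initFam C)}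
    {a' b' c' d' : C (Fin.last n)} (s : SplitSquare p q x x' y y' a b c d a' b' c' d')
    (s' : IsSquare i j x x' y y' (a.snoc a') (b.snoc b') (c.snoc c') (d.snoc d')) :
    HEq ((Gray.uncurry H hH).map₂ ((ofFunctor F).splitSwap p q hij f g s)) (Y.swap hij f g s') := by
  cases p with
  | last => exact absurd hij (not_last_lt _)
  | castSucc i =>
    cases q with
    | castSucc j =>
      obtain ⟨⟨hab, rfl⟩, ⟨hac, rfl⟩, ⟨hbd, rfl⟩, hcd⟩ := s
      refine (StrictPseudofunctor.map₂_conj_heq _ _ _ _).trans ?_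
      refine (app₂_map₂_conj_heq H _ _ _ _).trans ?_
      exact app₂_congr hY (MultiGray.swapCell (C := initFam C) hij f g ⟨hab, hac, hbd, hcd.1⟩) _
    | last =>
      obtain ⟨⟨hab, -⟩, ⟨rfl, rfl, rfl⟩, ⟨rfl, rfl, rfl⟩, hcd⟩ := s
      exact nat_map_congr hY (MultiGray.oneCell (C := initFam C) f hab) g

/-- Currying in the last factor and uncurrying again changes nothing, up to the equality of a tuple
with its reassembly. -/
theorem split_comp_uncurry (hY : F.comp H = Y.curry.lift) :
    (ofFunctor F).split.lift.comp (Gray.uncurry H hH) = Y.lift := by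
  have e : ∀ a : Obj C, a = a.init.snoc a.last := fun a => a.snoc_init_last.symm
  refine MultiGray.hom_ext ?_ ?_ ?_ ?_
  · intro a
    exact (obj_congr hY (MultiGray.pt a.init) a.last).trans (congrArg Y.obj a.snoc_init_last)
  · intro i x y f a b h
    exact (Y.uncurry_splitOne F H hH hY _ f (splitStep _ h) (by rwa [← e, ← e])).trans
      (Y.one_heq f a.snoc_init_last b.snoc_init_last _ h)
  · intro i x y f g φ a b h
    exact (Y.uncurry_splitTwo F H hH hY _ φ (splitStep _ h) (by rwa [← e, ← e])).trans
      (Y.two_heq φ a.snoc_init_last b.snoc_init_last _ h)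
  · intro i j hij x x' f y y' g a b c d s
    exact (Y.uncurry_splitSwap F H hH hY _ _ hij f g (splitSquare _ _ s)
      (by rwa [← e, ← e, ← e, ← e])).trans
        (Y.swap_heq hij f g a.snoc_init_last b.snoc_init_last c.snoc_init_last d.snoc_init_last _ s)

end

end MultiData

/-! ### The composite on the tensor product -/

namespace MultiData

open Multi oplaxHom

variable {n : ℕ} {C : Fin (n + 1) → TwoCat.{u}} {B : TwoCat.{u}}

section

variable (X : MultiData (initFam C) B)

/-- `FinPos.of` computes only propositionally, and so do `init` and `last` of a reassembled tuple.
Here and in the lemmas that follow all these equations are hypotheses to be substituted away. -/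
theorem splitOne_castSucc_heq {i : Fin n} {p : FinPos i.castSucc} (hp : p = .castSucc i)
    {x y : C i.castSucc} (f : x ⟶ y) {a b a' b' : Obj (initFam C)} {d d' e' : C (Fin.last n)}
    (ha : a' = a) (hb : b' = b) (hd : d' = d) (he : e' = d) (h : SplitStep p x y a' b' d' e')
    (h' : IsStep (C := initFam C) i x y a b) :
    HEq (X.splitOne p f h) (Gray.left (X.one f h') d) := by
  subst hp ha hb hd he; rfl

theorem splitOne_last_heq {p : FinPos (Fin.last n)} (hp : p = .last)
    {x y : C (Fin.last n)} (f : x ⟶ y) {a a' b' : Obj (initFam C)} {d' e' : C (Fin.last n)}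
    (ha : a' = a) (hb : b' = a) (hd : d' = x) (he : e' = y) (h : SplitStep p x y a' b' d' e') :
    HEq (X.splitOne p f h) (Gray.right (X.obj a) f) := by
  subst hp ha hb hd he; rfl

theorem splitTwo_castSucc_heq {i : Fin n} {p : FinPos i.castSucc} (hp : p = .castSucc i)
    {x y : C i.castSucc} {f g : x ⟶ y} (φ : f ⟶ g) {a b a' b' : Obj (initFam C)}
    {d d' e' : C (Fin.last n)} (ha : a' = a) (hb : b' = b) (hd : d' = d) (he : e' = d)
    (h : SplitStep p x y a' b' d' e') (h' : IsStep (C := initFam C) i x y a b) :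
    HEq (X.splitTwo p φ h) (Gray.left₂ (X.two φ h') d) := by
  subst hp ha hb hd he; rfl

theorem splitTwo_last_heq {p : FinPos (Fin.last n)} (hp : p = .last)
    {x y : C (Fin.last n)} {f g : x ⟶ y} (φ : f ⟶ g) {a a' b' : Obj (initFam C)}
    {d' e' : C (Fin.last n)} (ha : a' = a) (hb : b' = a) (hd : d' = x) (he : e' = y)
    (h : SplitStep p x y a' b' d' e') :
    HEq (X.splitTwo p φ h) (Gray.right₂ (X.obj a) φ) := by
  subst hp ha hb hd he; rfl

theorem splitSwap_castSucc_heq {i j : Fin n} {p : FinPos i.castSucc} {q : FinPos j.castSucc}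
    (hp : p = .castSucc i) (hq : q = .castSucc j) (hij' : i.castSucc < j.castSucc) (hij : i < j)
    {x x' : C i.castSucc} (f : x ⟶ x') {y y' : C j.castSucc} (g : y ⟶ y')
    {a b c d a' b' c' d' : Obj (initFam C)} {e a'' b'' c'' d'' : C (Fin.last n)}
    (ha : a' = a) (hb : b' = b) (hc : c' = c) (hd : d' = d) (ha' : a'' = e) (hb' : b'' = e)
    (hc' : c'' = e) (hd' : d'' = e)
    (s : SplitSquare p q x x' y y' a' b' c' d' a'' b'' c'' d'')
    (s' : IsSquare (C := initFam C) i j x x' y y' a b c d) :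
    HEq (X.splitSwap p q hij' f g s) (Gray.left₂ (X.swap hij f g s') e) := by
  subst hp hq ha hb hc hd ha' hb' hc' hd'
  exact eqToHom_comp_eqToHom_heq _ _ _

theorem splitSwap_last_heq {i : Fin n} {p : FinPos i.castSucc} {q : FinPos (Fin.last n)}
    (hp : p = .castSucc i) (hq : q = .last) (hij : i.castSucc < Fin.last n)
    {x x' : C i.castSucc} (f : x ⟶ x') {y y' : C (Fin.last n)} (g : y ⟶ y')
    {a b a' b' c' d' : Obj (initFam C)} {a'' b'' c'' d'' : C (Fin.last n)}
    (ha : a' = a) (hb : b' = b) (hc : c' = a) (hd : d' = b) (ha' : a'' = y) (hb' : b'' = y)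
    (hc' : c'' = y') (hd' : d'' = y')
    (s : SplitSquare p q x x' y y' a' b' c' d' a'' b'' c'' d'')
    (h : IsStep (C := initFam C) i x x' a b) :
    HEq (X.splitSwap p q hij f g s) (Gray.swap (X.one f h) g) := by
  subst hp hq ha hb hc hd ha' hb' hc' hd'
  rfl

end

end MultiData

namespace MultiData

open Multi oplaxHom MultiGray

variable {n : ℕ} {C : Fin (n + 1) → TwoCat.{u}} {B : TwoCat.{u}}
  (F : StrictPseudofunctor (multiGray (initFam C)) B)
  (G : StrictPseudofunctor B (multiGray (initFam C)))
  (H : StrictPseudofunctor B (oplaxHom (C (Fin.last n)) (multiGray C)))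
  (hH : ∀ b, IsStrict (H.obj b))

/-- Precomposition with `F` makes `multiGray (initFam C)` the source, where generators suffice. `F`
is cancelled afterwards by means of `G`. -/
theorem uncurry_comp_split_left
    (hH' : F.comp H = (ofFunctor (StrictPseudofunctor.id (multiGray C))).curry.lift)
    (d : C (Fin.last n)) :
    F.comp ((Gray.leftFunctor B d).comp ((Gray.uncurry H hH).comp (ofFunctor F).split.lift)) =
      F.comp (Gray.leftFunctor B d) := by
  have hobj : ∀ a : Obj (initFam C), (Gray.uncurry H hH).obj (Gray.pt (F.obj (pt a)) d) =
      pt (a.snoc d) := fun a => obj_congr hH' (pt a) d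
  refine MultiGray.hom_ext ?_ ?_ ?_ ?_
  · intro a
    refine (congrArg (ofFunctor F).split.lift.obj (hobj a)).trans ?_
    exact congrArg₂ (fun a d => Gray.pt (F.obj (pt a)) d) (a.init_snoc d) (a.last_snoc d)
  · intro i x y f a b h
    refine (StrictPseudofunctor.map_heq (ofFunctor F).split.lift (hobj a) (hobj b)
      (app_congr hH' (oneCell (C := initFam C) f h) d)).trans ?_
    exact splitOne_castSucc_heq _ (FinPos.of_castSucc i) f (a.init_snoc d) (b.init_snoc d)
      (a.last_snoc d) (b.last_snoc d) _ h
  · intro i x y f g φ a b h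
    refine (StrictPseudofunctor.map₂_heq (ofFunctor F).split.lift (hobj a) (hobj b)
      (app_congr hH' (oneCell (C := initFam C) f h) d)
      (app_congr hH' (oneCell (C := initFam C) g h) d)
      (app₂_congr hH' (twoCell (C := initFam C) φ h) d)).trans ?_
    exact splitTwo_castSucc_heq _ (FinPos.of_castSucc i) φ (a.init_snoc d) (b.init_snoc d)
      (a.last_snoc d) (b.last_snoc d) _ h
  · intro i j hij x x' f y y' g a b c e s
    refine (StrictPseudofunctor.map₂_heq (ofFunctor F).split.lift (hobj a) (hobj e)
      (app_congr hH' (oneCell (C := initFam C) g s.ac ≫ oneCell (C := initFam C) f s.cd) d)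
      (app_congr hH' (oneCell (C := initFam C) f s.ab ≫ oneCell (C := initFam C) g s.bd) d)
      (app₂_congr hH' (swapCell (C := initFam C) hij f g s) d)).trans ?_
    refine HEq.trans ?_ (Gray.left₂_conj_heq (F.map_comp _ _).symm _ (F.map_comp _ _) _)
    refine HEq.trans ?_ (splitSwap_castSucc_heq (ofFunctor F) (FinPos.of_castSucc i)
      (FinPos.of_castSucc j) (Fin.castSucc_lt_castSucc_iff.2 hij) hij f g (a.init_snoc d)
      (b.init_snoc d) (c.init_snoc d) (e.init_snoc d) (a.last_snoc d) (b.last_snoc d)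
      (c.last_snoc d) (e.last_snoc d) (splitSquare _ _ (s.snoc d)) s)
    exact StrictPseudofunctor.map₂_conj_heq (ofFunctor F).split.lift _ _ _

/-- Cells (–, Id) are handled by cancelling `F`, cells (Id, –) by surjectivity of `F` on 0-cells,
and γ by writing its first argument as the image of a sequence of generators. -/
theorem uncurry_comp_split
    (hH' : F.comp H = (ofFunctor (StrictPseudofunctor.id (multiGray C))).curry.lift)
    (hG : G.comp F = StrictPseudofunctor.id B) :
    (Gray.uncurry H hH).comp (ofFunctor F).split.lift =
      StrictPseudofunctor.id (gray B (C (Fin.last n))) := by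
  have hobj : ∀ (a : Obj (initFam C)) (d : C (Fin.last n)),
      (Gray.uncurry H hH).obj (Gray.pt (F.obj (pt a)) d) = pt (a.snoc d) :=
    fun a d => obj_congr hH' (pt a) d
  have hsurj : ∀ b : B, ∃ a : Obj (initFam C), F.obj (pt a) = b := fun b =>
    ⟨(G.obj b).as, congrArg (fun K : StrictPseudofunctor B B => K.obj b) hG⟩
  have hleft : ∀ d : C (Fin.last n), (Gray.leftFunctor B d).comp
      ((Gray.uncurry H hH).comp (ofFunctor F).split.lift) = Gray.leftFunctor B d := fun d => by
    -- Precomposing with `G` cancels `F`, as `G.comp F` is the identity.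
    have h := congrArg (StrictPseudofunctor.comp G) (uncurry_comp_split_left F H hH hH' d)
    rwa [← StrictPseudofunctor.comp_assoc G F, ← StrictPseudofunctor.comp_assoc G F, hG,
      StrictPseudofunctor.id_comp, StrictPseudofunctor.id_comp] at h
  have ho : ∀ (b : B) (d : C (Fin.last n)),
      ((Gray.uncurry H hH).comp (ofFunctor F).split.lift).obj (Gray.pt b d) = Gray.pt b d :=
    fun b d => congrArg (fun K : StrictPseudofunctor B (gray B (C (Fin.last n))) => K.obj b)
      (hleft d)
  have hl : ∀ {b b' : B} (f : b ⟶ b') (d : C (Fin.last n)),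
      HEq (((Gray.uncurry H hH).comp (ofFunctor F).split.lift).map (Gray.left f d))
        (Gray.left f d) := fun {b b'} f d => by
    have key : ∀ {K L : StrictPseudofunctor B (gray B (C (Fin.last n)))}, K = L →
        HEq (K.map f) (L.map f) := by rintro _ _ rfl; rfl
    exact key (hleft d)
  have hl₂ : ∀ {b b' : B} {f f' : b ⟶ b'} (φ : f ⟶ f') (d : C (Fin.last n)),
      HEq (((Gray.uncurry H hH).comp (ofFunctor F).split.lift).map₂ (Gray.left₂ φ d))
        (Gray.left₂ φ d) := fun {b b' f f'} φ d => by
    have key : ∀ {K L : StrictPseudofunctor B (gray B (C (Fin.last n)))}, K = L →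
        HEq (K.map₂ φ) (L.map₂ φ) := by rintro _ _ rfl; rfl
    exact key (hleft d)
  have hr : ∀ (b : B) {d d' : C (Fin.last n)} (g : d ⟶ d'),
      HEq (((Gray.uncurry H hH).comp (ofFunctor F).split.lift).map (Gray.right b g))
        (Gray.right b g) := fun b d d' g => by
    obtain ⟨a, rfl⟩ := hsurj b
    refine (StrictPseudofunctor.map_heq (ofFunctor F).split.lift (hobj a d) (hobj a d')
      (map_congr hH' (pt a) g)).trans ?_
    exact splitOne_last_heq _ FinPos.of_last g (a.init_snoc d) (a.init_snoc d') (a.last_snoc d)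
      (a.last_snoc d') _
  have hr₂ : ∀ (b : B) {d d' : C (Fin.last n)} {g g' : d ⟶ d'} (ψ : g ⟶ g'),
      HEq (((Gray.uncurry H hH).comp (ofFunctor F).split.lift).map₂ (Gray.right₂ b ψ))
        (Gray.right₂ b ψ) := fun b d d' g g' ψ => by
    obtain ⟨a, rfl⟩ := hsurj b
    refine (StrictPseudofunctor.map₂_heq (ofFunctor F).split.lift (hobj a d) (hobj a d')
      (map_congr hH' (pt a) g) (map_congr hH' (pt a) g') (map₂_congr hH' (pt a) ψ)).trans ?_
    exact splitTwo_last_heq _ FinPos.of_last ψ (a.init_snoc d) (a.init_snoc d') (a.last_snoc d)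
      (a.last_snoc d') _
  refine Gray.hom_ext ho hl hr hl₂ hr₂ ?_
  intro b b' f d d' g
  have hobj' : ∀ a : gray B (C (Fin.last n)),
      ((Gray.uncurry H hH).comp (ofFunctor F).split.lift).obj a =
        (StrictPseudofunctor.id (gray B (C (Fin.last n)))).obj a :=
    fun a => ho a.as.fst a.as.snd
  have hmap : ∀ {a b : gray B (C (Fin.last n))} (f : a ⟶ b),
      HEq (((Gray.uncurry H hH).comp (ofFunctor F).split.lift).map f)
        ((StrictPseudofunctor.id (gray B (C (Fin.last n)))).map f) :=
    fun f => Gray.map_heq_of_left_of_right ho hl hr f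
  -- Replaces `f` by `F.map (G.map f)`. The variable `K` makes the substitution possible although
  -- the type of γ depends on `f`.
  have key : ∀ K : StrictPseudofunctor B B, K = StrictPseudofunctor.id B →
      HEq (((Gray.uncurry H hH).comp (ofFunctor F).split.lift).map₂ (Gray.swap (K.map f) g))
        ((StrictPseudofunctor.id (gray B (C (Fin.last n)))).map₂ (Gray.swap (K.map f) g)) →
      HEq (((Gray.uncurry H hH).comp (ofFunctor F).split.lift).map₂ (Gray.swap f g))
        ((StrictPseudofunctor.id (gray B (C (Fin.last n)))).map₂ (Gray.swap f g)) := by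
    rintro _ rfl h; exact h
  refine key _ hG ?_
  suffices h : ∀ {a a' : multiGray (initFam C)} (m : a ⟶ a'),
      HEq (((Gray.uncurry H hH).comp (ofFunctor F).split.lift).map₂ (Gray.swap (F.map m) g))
        ((StrictPseudofunctor.id (gray B (C (Fin.last n)))).map₂ (Gray.swap (F.map m) g)) from
    h (G.map f)
  intro a a' m
  -- γ respects identities and composites in its first argument, so only a single generator needs
  -- the explicit form of the two 2-functors.
  induction m using oneCell_induction with
  | id a =>
    rw [F.map_id]
    exact Gray.map₂_swap_id_heq hobj' hmap _ g
  | comp m m' hm hm' =>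
    rw [F.map_comp]
    exact Gray.map₂_swap_comp_heq hobj' hmap _ _ g hm hm'
  | oneCell f h =>
    rename_i i x y a b
    refine (StrictPseudofunctor.map₂_heq (ofFunctor F).split.lift (hobj a d) (hobj b d')
      (nat_source_congr hH' (oneCell (C := initFam C) f h) g)
      (nat_target_congr hH' (oneCell (C := initFam C) f h) g)
      (nat_map_congr hH' (oneCell (C := initFam C) f h) g)).trans ?_
    refine HEq.trans ?_ (splitSwap_last_heq (ofFunctor F) (FinPos.of_castSucc i) FinPos.of_last
      (Fin.castSucc_lt_last i) f g (a.init_snoc d) (b.init_snoc d) (a.init_snoc d')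
      (b.init_snoc d') (a.last_snoc d) (b.last_snoc d) (a.last_snoc d') (b.last_snoc d')
      (splitSquare _ _ (h.square_last d d')) h)
    exact StrictPseudofunctor.map₂_conj_heq (ofFunctor F).split.lift _ _ _

end MultiData

end OplaxFunctors

/-! ### The case of a single factor -/

namespace MultiData

open Multi MultiGray

variable {C : Fin 1 → TwoCat.{u}}

/-- `IsStep` for the entries of tuples of length one. -/
def SingleStep : ∀ {i : Fin 1}, FinPos i → (x y : C i) → (d e : C (Fin.last 0)) → Prop
  | _, .castSucc i, _, _, _, _ => i.elim0
  | _, .last, x, y, d, e => d = x ∧ e = y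

theorem singleStep {i : Fin 1} (p : FinPos i) {x y : C i} {a b : Obj C} (h : IsStep i x y a b) :
    SingleStep p x y a.last b.last := by
  cases p with
  | castSucc i => exact i.elim0
  | last => exact ⟨h.src, h.tgt⟩

theorem SingleStep.trans {i : Fin 1} {p : FinPos i} {x y z : C i} {d e k : C (Fin.last 0)}
    (h : SingleStep p x y d e) (h' : SingleStep p y z e k) : SingleStep p x z d k := by
  cases p with
  | castSucc i => exact i.elim0
  | last => exact ⟨h.1, h'.2⟩

/-- A 1-cell between propositionally equal 0-cells. -/
def homCast {D : TwoCat.{u}} {x y d e : D} (f : x ⟶ y) (h : d = x ∧ e = y) : d ⟶ e :=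
  Eq.rec (motive := fun d _ => d ⟶ e) (Eq.rec (motive := fun e _ => x ⟶ e) f h.2.symm) h.1.symm

/-- A 2-cell between 1-cells between propositionally equal 0-cells. -/
def homCast₂ {D : TwoCat.{u}} {x y d e : D} {f g : x ⟶ y} (φ : f ⟶ g) (h : d = x ∧ e = y) :
    homCast f h ⟶ homCast g h :=
  Eq.rec (motive := fun d (hd : x = d) => homCast f (⟨hd.symm, h.2⟩ : d = x ∧ e = y) ⟶
      homCast g ⟨hd.symm, h.2⟩)
    (Eq.rec (motive := fun e (he : y = e) => homCast f (⟨rfl, he.symm⟩ : x = x ∧ e = y) ⟶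
      homCast g ⟨rfl, he.symm⟩) φ h.2.symm) h.1.symm

/-- The values of the generating 1-cells in the only factor. -/
def singleOne : ∀ {i : Fin 1} (p : FinPos i) {x y : C i} (_ : x ⟶ y) {d e : C (Fin.last 0)}
    (_ : SingleStep p x y d e), d ⟶ e
  | _, .castSucc i, _, _, _, _, _, _ => i.elim0
  | _, .last, _, _, f, _, _, h => homCast f h

/-- The values of the generating 2-cells in the only factor. -/
def singleTwo : ∀ {i : Fin 1} (p : FinPos i) {x y : C i} {f g : x ⟶ y} (_ : f ⟶ g)
    {d e : C (Fin.last 0)} (h : SingleStep p x y d e), singleOne p f h ⟶ singleOne p g h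
  | _, .castSucc i, _, _, _, _, _, _, _, _ => i.elim0
  | _, .last, _, _, _, _, φ, _, _, h => homCast₂ φ h

theorem singleOne_id {i : Fin 1} (p : FinPos i) {x : C i} {d : C (Fin.last 0)}
    (h : SingleStep p x x d d) : singleOne p (𝟙 x) h = 𝟙 d := by
  cases p with
  | castSucc i => exact i.elim0
  | last => obtain ⟨rfl, -⟩ := h; rfl

theorem singleOne_comp {i : Fin 1} (p : FinPos i) {x y z : C i} (f : x ⟶ y) (g : y ⟶ z)
    {d e k : C (Fin.last 0)} (h : SingleStep p x y d e) (h' : SingleStep p y z e k) :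
    singleOne p (f ≫ g) (h.trans h') = singleOne p f h ≫ singleOne p g h' := by
  cases p with
  | castSucc i => exact i.elim0
  | last =>
    obtain ⟨rfl, rfl⟩ := h
    obtain ⟨-, rfl⟩ := h'
    rfl

theorem singleTwo_id {i : Fin 1} (p : FinPos i) {x y : C i} (f : x ⟶ y) {d e : C (Fin.last 0)}
    (h : SingleStep p x y d e) : singleTwo p (𝟙 f) h = 𝟙 (singleOne p f h) := by
  cases p with
  | castSucc i => exact i.elim0
  | last => obtain ⟨rfl, rfl⟩ := h; rfl

theorem singleTwo_comp {i : Fin 1} (p : FinPos i) {x y : C i} {f g k : x ⟶ y} (φ : f ⟶ g)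
    (ψ : g ⟶ k) {d e : C (Fin.last 0)} (h : SingleStep p x y d e) :
    singleTwo p (φ ≫ ψ) h = singleTwo p φ h ≫ singleTwo p ψ h := by
  cases p with
  | castSucc i => exact i.elim0
  | last => obtain ⟨rfl, rfl⟩ := h; rfl

theorem singleTwo_hcomp {i : Fin 1} (p : FinPos i) {x y z : C i} {f f' : x ⟶ y} {g g' : y ⟶ z}
    (φ : f ⟶ f') (ψ : g ⟶ g') {d e k : C (Fin.last 0)} (h : SingleStep p x y d e)
    (h' : SingleStep p y z e k) :
    singleTwo p (φ ▷ g ≫ f' ◁ ψ) (h.trans h') = eqToHom (singleOne_comp p f g h h') ≫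
      (singleTwo p φ h ▷ singleOne p g h' ≫ singleOne p f' h ◁ singleTwo p ψ h') ≫
        eqToHom (singleOne_comp p f' g' h h').symm := by
  cases p with
  | castSucc i => exact i.elim0
  | last =>
    obtain ⟨rfl, rfl⟩ := h
    obtain ⟨-, rfl⟩ := h'
    exact (conj_eqToHom_rfl _ _ _).symm

theorem not_lt_of_fin_one {i j : Fin 1} : ¬ i < j := fun h => h.ne (Subsingleton.elim i j)

variable (C) in
/-- The values of the generators in the only factor. -/
def single : MultiData C (C (Fin.last 0)) where
  obj a := a.last
  one f _ _ h := singleOne (.of _) f (singleStep _ h)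
  one_id h := singleOne_id _ (singleStep _ h)
  one_comp f g _ _ _ h h' := singleOne_comp _ f g (singleStep _ h) (singleStep _ h')
  two φ _ _ h := singleTwo (.of _) φ (singleStep _ h)
  two_id f _ _ h := singleTwo_id _ f (singleStep _ h)
  two_comp φ ψ _ _ h := singleTwo_comp _ φ ψ (singleStep _ h)
  two_hcomp φ ψ _ _ _ h h' := singleTwo_hcomp _ φ ψ (singleStep _ h) (singleStep _ h')
  swap hij := absurd hij not_lt_of_fin_one
  swap_id_right hij := absurd hij not_lt_of_fin_one
  swap_id_left hij := absurd hij not_lt_of_fin_one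
  swap_comp_left hij := absurd hij not_lt_of_fin_one
  swap_comp_right hij := absurd hij not_lt_of_fin_one
  swap_naturality hij := absurd hij not_lt_of_fin_one
  yangBaxter hij := absurd hij not_lt_of_fin_one

variable (C) in
/-- The strict 2-functor from the only factor to the explicit presentation. -/
def singleInv : StrictPseudofunctor (C (Fin.last 0)) (multiGray C) :=
  -- The only factor is the last one, so the remaining factors contribute the empty tuple.
  (ofFunctor (StrictPseudofunctor.id (multiGray C))).row ⟨fun i => i.elim0⟩

theorem snoc_elim0_last (a : Obj C) : Obj.snoc ⟨fun i => i.elim0⟩ a.last = a :=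
  (congrArg (fun b => Obj.snoc b a.last) (Obj.ext (funext fun i => i.elim0))).trans
    a.snoc_init_last

theorem singleInv_singleOne {i : Fin 1} (p : FinPos i) {x y : C i} (f : x ⟶ y)
    {d e : C (Fin.last 0)} (h : SingleStep p x y d e) {a b : Obj C}
    (ha : Obj.snoc ⟨fun i => i.elim0⟩ d = a) (hb : Obj.snoc ⟨fun i => i.elim0⟩ e = b)
    (h' : IsStep i x y a b) :
    HEq ((singleInv C).map (singleOne p f h)) (oneCell f h') := by
  cases p with
  | castSucc i => exact i.elim0
  | last => obtain ⟨rfl, rfl⟩ := h; subst ha hb; rfl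

theorem singleInv_singleTwo {i : Fin 1} (p : FinPos i) {x y : C i} {f g : x ⟶ y} (φ : f ⟶ g)
    {d e : C (Fin.last 0)} (h : SingleStep p x y d e) {a b : Obj C}
    (ha : Obj.snoc ⟨fun i => i.elim0⟩ d = a) (hb : Obj.snoc ⟨fun i => i.elim0⟩ e = b)
    (h' : IsStep i x y a b) :
    HEq ((singleInv C).map₂ (singleTwo p φ h)) (twoCell φ h') := by
  cases p with
  | castSucc i => exact i.elim0
  | last => obtain ⟨rfl, rfl⟩ := h; subst ha hb; rfl

theorem single_comp_singleInv :
    (single C).lift.comp (singleInv C) = StrictPseudofunctor.id (multiGray C) :=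
  MultiGray.hom_ext (fun a => congrArg pt (snoc_elim0_last a))
    (fun f a b h => singleInv_singleOne _ f _ (snoc_elim0_last a) (snoc_elim0_last b) h)
    (fun φ a b h => singleInv_singleTwo _ φ _ (snoc_elim0_last a) (snoc_elim0_last b) h)
    (fun hij => absurd hij not_lt_of_fin_one)

theorem singleOne_last_heq {p : FinPos (Fin.last 0)} (hp : p = .last) {x y : C (Fin.last 0)}
    (f : x ⟶ y) {d e : C (Fin.last 0)} (hd : d = x) (he : e = y) (h : SingleStep p x y d e) :
    HEq (singleOne p f h) f := by
  subst hp hd he; rfl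

theorem singleTwo_last_heq {p : FinPos (Fin.last 0)} (hp : p = .last) {x y : C (Fin.last 0)}
    {f g : x ⟶ y} (φ : f ⟶ g) {d e : C (Fin.last 0)} (hd : d = x) (he : e = y)
    (h : SingleStep p x y d e) : HEq (singleTwo p φ h) φ := by
  subst hp hd he; rfl

theorem singleInv_comp_single :
    (singleInv C).comp (single C).lift = StrictPseudofunctor.id (C (Fin.last 0)) :=
  StrictPseudofunctor.ext_of_heq (fun d => Obj.last_snoc ⟨fun i => i.elim0⟩ d)
    (fun {d e} f => singleOne_last_heq (FinPos.of_last (n := 0)) f (Obj.last_snoc _ d)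
      (Obj.last_snoc _ e) (singleStep _ (isStep_last ⟨fun i => i.elim0⟩ d e)))
    (fun {d e _ _} φ => singleTwo_last_heq (FinPos.of_last (n := 0)) φ (Obj.last_snoc _ d)
      (Obj.last_snoc _ e) (singleStep _ (isStep_last ⟨fun i => i.elim0⟩ d e)))

theorem isOneCell_singleOne {i : Fin 1} (p : FinPos i) {x y : C i} (f : x ⟶ y)
    {d e : C (Fin.last 0)} (h : SingleStep p x y d e) :
    GrayIter.IsOneCell 0 C i f (A := d) (B := e) (singleOne p f h) := by
  cases p with
  | castSucc i => exact i.elim0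
  | last => obtain ⟨rfl, rfl⟩ := h; exact .base C f

theorem isTwoCell_singleTwo {i : Fin 1} (p : FinPos i) {x y : C i} {f g : x ⟶ y} (φ : f ⟶ g)
    {d e : C (Fin.last 0)} (h : SingleStep p x y d e) :
    GrayIter.IsTwoCell 0 C i φ (A := d) (B := e) (F := singleOne p f h) (G := singleOne p g h)
      (singleTwo p φ h) := by
  cases p with
  | castSucc i => exact i.elim0
  | last => obtain ⟨rfl, rfl⟩ := h; exact .base C φ

end MultiData

/-! ### The iterated tensor product -/

namespace MultiData

open Multi MultiGray

variable {n : ℕ} {C : Fin (n + 2) → TwoCat.{u}}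
  (F : StrictPseudofunctor (multiGray (initFam C)) (grayIter n (initFam C)))

theorem isOneCell_splitOne
    (hF : ∀ (i : Fin (n + 1)) (x y : initFam C i) (f : x ⟶ y) (a b : Obj (initFam C))
      (h : IsStep i x y a b), GrayIter.IsOneCell n (initFam C) i f (F.map (oneCell f h)))
    {i : Fin (n + 2)} (p : FinPos i) {x y : C i} (f : x ⟶ y) {a b : Obj (initFam C)}
    {d e : C (Fin.last (n + 1))} (h : SplitStep p x y a b d e) :
    GrayIter.IsOneCell (n + 1) C i f (A := Gray.pt (F.obj (pt a)) d)
      (B := Gray.pt (F.obj (pt b)) e) ((ofFunctor F).splitOne p f h) := by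
  cases p with
  | castSucc i =>
    obtain ⟨h, rfl⟩ := h
    exact .castSucc (hF i x y f a b h) d
  | last =>
    obtain ⟨rfl, rfl, rfl⟩ := h
    exact .last (F.obj (pt a)) f

theorem isTwoCell_splitTwo
    (hF : ∀ (i : Fin (n + 1)) (x y : initFam C i) (f g : x ⟶ y) (φ : f ⟶ g)
      (a b : Obj (initFam C)) (h : IsStep i x y a b),
      GrayIter.IsTwoCell n (initFam C) i φ (F.map₂ (twoCell φ h)))
    {i : Fin (n + 2)} (p : FinPos i) {x y : C i} {f g : x ⟶ y} (φ : f ⟶ g)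
    {a b : Obj (initFam C)} {d e : C (Fin.last (n + 1))} (h : SplitStep p x y a b d e) :
    GrayIter.IsTwoCell (n + 1) C i φ (A := Gray.pt (F.obj (pt a)) d)
      (B := Gray.pt (F.obj (pt b)) e) (F := (ofFunctor F).splitOne p f h)
      (G := (ofFunctor F).splitOne p g h) ((ofFunctor F).splitTwo p φ h) := by
  cases p with
  | castSucc i =>
    obtain ⟨h, rfl⟩ := h
    exact .castSucc (hF i x y f g φ a b h) d
  | last =>
    obtain ⟨rfl, rfl, rfl⟩ := h
    exact .last (F.obj (pt a)) φ

theorem isSwap_splitSwap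
    (hF₁ : ∀ (i : Fin (n + 1)) (x y : initFam C i) (f : x ⟶ y) (a b : Obj (initFam C))
      (h : IsStep i x y a b), GrayIter.IsOneCell n (initFam C) i f (F.map (oneCell f h)))
    (hF : ∀ (i j : Fin (n + 1)) (hij : i < j) (x x' : initFam C i) (f : x ⟶ x')
      (y y' : initFam C j) (g : y ⟶ y') (a b c d : Obj (initFam C))
      (s : IsSquare i j x x' y y' a b c d),
      GrayIter.IsSwap n (initFam C) i j f g (F.map₂ (swapCell hij f g s)))
    {i j : Fin (n + 2)} (p : FinPos i) (q : FinPos j) (hij : i < j) {x x' : C i} (f : x ⟶ x')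
    {y y' : C j} (g : y ⟶ y') {a b c d : Obj (initFam C)} {a' b' c' d' : C (Fin.last (n + 1))}
    (s : SplitSquare p q x x' y y' a b c d a' b' c' d') :
    GrayIter.IsSwap (n + 1) C i j f g (A := Gray.pt (F.obj (pt a)) a')
      (B := Gray.pt (F.obj (pt d)) d')
      (F := (ofFunctor F).splitOne q g s.ac ≫ (ofFunctor F).splitOne p f s.cd)
      (G := (ofFunctor F).splitOne p f s.ab ≫ (ofFunctor F).splitOne q g s.bd)
      ((ofFunctor F).splitSwap p q hij f g s) := by
  cases p with
  | last => exact absurd hij (not_last_lt _)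
  | castSucc i =>
    cases q with
    | castSucc j =>
      obtain ⟨⟨hab, rfl⟩, ⟨hac, rfl⟩, ⟨hbd, rfl⟩, hcd⟩ := s
      -- The inner conjugation comes from `F.map_comp` in `ofFunctor`, the outer one from
      -- `Gray.leftCast_comp` in `splitSwap`.
      exact .congr (.castSucc (.congr (hF i j hij x x' f y y' g a b c d ⟨hab, hac, hbd, hcd.1⟩)
        _ _) _) _ _
    | last =>
      obtain ⟨⟨hab, -⟩, ⟨rfl, rfl, rfl⟩, ⟨rfl, rfl, rfl⟩, hcd⟩ := s
      exact .last (hF₁ i x x' f a b hab) g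

end MultiData

/-! ### The induction on the number of factors -/

open MultiData in
theorem mainTheorem4 (n : ℕ) (C : Fin (n + 1) → TwoCat.{u}) :
    ∃ (F : StrictPseudofunctor (multiGray C) (grayIter n C))
      (G : StrictPseudofunctor (grayIter n C) (multiGray C)),
      F.comp G = StrictPseudofunctor.id (multiGray C) ∧
      G.comp F = StrictPseudofunctor.id (grayIter n C) ∧
      (∀ a : Multi.Obj C, F.obj (MultiGray.pt a) = GrayIter.pt n C a.val) ∧
      (∀ (i : Fin (n + 1)) (x y : C i) (f : x ⟶ y) (a b : Multi.Obj C)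
        (h : Multi.IsStep i x y a b),
        GrayIter.IsOneCell n C i f (F.map (MultiGray.oneCell f h))) ∧
      (∀ (i : Fin (n + 1)) (x y : C i) (f g : x ⟶ y) (φ : f ⟶ g) (a b : Multi.Obj C)
        (h : Multi.IsStep i x y a b),
        GrayIter.IsTwoCell n C i φ (F.map₂ (MultiGray.twoCell φ h))) ∧
      (∀ (i j : Fin (n + 1)) (hij : i < j) (x x' : C i) (f : x ⟶ x') (y y' : C j) (g : y ⟶ y')
        (a b c d : Multi.Obj C) (s : Multi.IsSquare i j x x' y y' a b c d),
        GrayIter.IsSwap n C i j f g (F.map₂ (MultiGray.swapCell hij f g s))) := by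
  induction n with
  | zero =>
    exact ⟨(single C).lift, singleInv C, single_comp_singleInv, singleInv_comp_single,
      fun _ => rfl, fun i x y f a b h => isOneCell_singleOne (.of i) f (singleStep _ h),
      fun i x y f g φ a b h => isTwoCell_singleTwo (.of i) φ (singleStep _ h),
      fun i j hij => absurd hij not_lt_of_fin_one⟩
  | succ n ih =>
    obtain ⟨F, G, hFG, hGF, hobj, hone, htwo, hswap⟩ := ih (Multi.initFam C)
    -- The tautological family of `multiGray C`, curried in the last factor.
    let L := (ofFunctor (StrictPseudofunctor.id (multiGray C))).curry.lift
    -- Since `G` is inverse to `F`, `G.comp L` extends `L` along `F`, which is the hypothesis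
    -- required to compute both composites.
    have hL : F.comp (G.comp L) = L := by
      rw [← StrictPseudofunctor.comp_assoc, hFG, StrictPseudofunctor.id_comp]
    -- Every value of `L` is a `row`, hence strict by construction.
    have hG : ∀ b, oplaxHom.IsStrict ((G.comp L).obj b) := fun b =>
      oplaxHom.isStrict_ofStrict _
    refine ⟨(ofFunctor F).split.lift, Gray.uncurry (G.comp L) hG, ?_,
      uncurry_comp_split F G (G.comp L) hG hL hGF, ?_, ?_, ?_, ?_⟩
    · refine (split_comp_uncurry _ F _ hG hL).trans ?_
      exact lift_ofFunctor _
    · intro a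
      exact congrArg (Gray.pt · a.last) (hobj a.init)
    · intro i x y f a b h
      exact isOneCell_splitOne F hone (.of i) f (splitStep _ h)
    · intro i x y f g φ a b h
      exact isTwoCell_splitTwo F htwo (.of i) φ (splitStep _ h)
    · intro i j hij x x' f y y' g a b c d s
      exact isSwap_splitSwap F hone hswap (.of i) (.of j) hij f g (splitSquare _ _ s)
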